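/- Let $\mathcal S$ be a finite non-empty set, partitioned as $\mathcal S=\mathcal S^{\rm one}\cup\mathcal S^{\rm sym}$ into two disjoint (possibly empty) sets, let $P=(p(i,j))_{i,j\in\mathcal S}$ be an irreducible stochastic matrix, and let $\mu=(\mu_k)_{k\in\mathcal S}$ be its invariant probability distribution. For $\alpha,c\in(0,\infty)$ let $\mathfrak D_{\alpha,c}$ be the set of Borel probability densities $v:\mathbb R\to[0,\infty)$ for which there is a function $C:[0,\infty)\to(0,\infty)$ with $\sup_y C(y)<\infty$ and $\lim_{y\to\infty}C(y)=c$ such that $v(y)=C(y)\,y^{-1-\alpha}$ for $y>0$ and $v(y)=0$ for $y\le 0$. Write $v\in\mathfrak D^+_{\alpha,c}$ if, in addition, $C(y)=c+O(y^{-\delta})$ as $y\to\infty$ for some $\delta>0$. For each $k\in\mathcal S$ let $\alpha_k,c_k\in(0,\infty)$ and $v_k\in\mathfrak D_{\alpha_k,c_k}$, and for $y\in\mathbb R$ put $w_k(y)=v_k(-y)$, $\chi_k=1$ if $k\in\mathcal S^{\rm one}$, and $w_k(y)=\tfrac12 v_k(|y|)$, $\chi_k=\tfrac12$ if $k\in\mathcal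 S^{\rm sym}$. Let $(X_n,\xi_n)_{n\ge0}$ be a time-homogeneous Markov process on $[0,\infty)\times\mathcal S$ (with any initial distribution) whose transition probabilities are, for Borel $B\subseteq[0,\infty)$ and $j\in\mathcal S$, $$\Pr[(X_{n+1},\xi_{n+1})\in B\times\{j\}\mid (X_n,\xi_n)=(x,i)]=p(i,j)\int_B w_i(-z-x)\,dz+\mathbf 1\{i=j\}\int_B w_i(z-x)\,dz .$$ Call $X_n$ recurrent if $\liminf_{n\to\infty}X_n=0$ a.s., and transient if $\lim_{n\to\infty}X_n=\infty$ a.s. (a) If $\max_{k\in\mathcal S}\chi_k\alpha_k\ge1$, then $X_n$ is recurrent. (b) Suppose that $\max_{k\in\mathcal S}\chi_k\alpha_k<1$. (i) If $\sum_{k\in\mathcal S}\mu_k\cot(\chi_k\pi\alpha_k)<0$, then $X_n$ is recurrent. (ii) If $\sum_{k\in\mathcal S}\mu_k\cot(\chi_k\pi\alpha_k)>0$, then $X_n$ is transient. (iii) If $v_k\in\mathfrak D^+_{\alpha_k,c_k}$ for every $k\in\mathcal S$ and $\sum_{k\in\mathcal S}\mu_k\cot(\chi_k\pi\alpha_k)=0$,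 then $X_n$ is recurrent. -/

import Mathlib

open MeasureTheory Filter Topology
open scoped ProbabilityTheory

noncomputable section

namespace HalfLineWalk

/-- `IsTailFactor α c v C`: the function `C`, considered on `[0, ∞)`, is positive, bounded, tends
to `c` at infinity, and `v y = C y * y ^ (-1 - α)` for `y > 0`, `v y = 0` for `y ≤ 0`. -/
structure IsTailFactor (α c : ℝ) (v C : ℝ → ℝ) : Prop where
  pos : ∀ y, 0 ≤ y → 0 < C y
  bounded : ∃ M : ℝ, ∀ y, 0 ≤ y → C y ≤ M
  tendsto : Tendsto C atTop (𝓝 c)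
  eq_of_pos : ∀ y, 0 < y → v y = C y * y ^ (-1 - α)
  eq_of_nonpos : ∀ y, y ≤ 0 → v y = 0

/-- `v` is a (Borel) probability density function on the real line. -/
structure IsDensity (v : ℝ → ℝ) : Prop where
  measurable : Measurable v
  nonneg : ∀ y, 0 ≤ v y
  integrable : Integrable v
  integral_eq_one : ∫ y, v y = 1

/-- The class `𝔇_{α,c}` of heavy-tailed densities on the positive half-line. -/
def HeavyTailed (α c : ℝ) (v : ℝ → ℝ) : Prop :=
  IsDensity v ∧ ∃ C : ℝ → ℝ, IsTailFactor α c v C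

/-- The class `𝔇⁺_{α,c}`: in addition `C y = c + O(y ^ (-δ))` as `y → ∞`, for some `δ > 0`. -/
def HeavyTailedPlus (α c : ℝ) (v : ℝ → ℝ) : Prop :=
  IsDensity v ∧ ∃ C : ℝ → ℝ, IsTailFactor α c v C ∧
    ∃ δ : ℝ, 0 < δ ∧ (fun y => C y - c) =O[atTop] (fun y : ℝ => y ^ (-δ))

/-- The probability vector `μ` is invariant for the matrix `P`. -/
def IsInvariantLaw {S : Type*} [Fintype S] (P : Matrix S S ℝ) (μ : S → ℝ) : Prop :=
  (∀ k, 0 ≤ μ k) ∧ ∑ k, μ k = 1 ∧ ∀ k, (∑ j, μ j * P j k) - μ k = 0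

/-- `χ k = 1` on one-sided branches and `χ k = 1/2` on symmetric branches; `one` is the set of
one-sided branches and its complement the set of symmetric branches. -/
def chi {S : Type*} [DecidableEq S] (one : Finset S) (k : S) : ℝ :=
  if k ∈ one then 1 else 1 / 2

/-- The increment density on branch `k`. -/
def increment {S : Type*} [DecidableEq S] (one : Finset S) (v : S → ℝ → ℝ) (k : S) (y : ℝ) : ℝ :=
  if k ∈ one then v k (-y) else 1 / 2 * v k |y|

/-- The probability that a step of the walk with routing matrix `P` and increment densities `w`
leads from `(x, i)` into `B × {j}`, for a Borel set `B ⊆ [0, ∞)`. -/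
def stepProb {S : Type*} [DecidableEq S] (P : Matrix S S ℝ) (w : S → ℝ → ℝ)
    (x : ℝ) (i : S) (B : Set ℝ) (j : S) : ℝ :=
  P i j * (∫ z in B, w i (-z - x)) + if i = j then ∫ z in B, w i (z - x) else 0

/-- The σ-algebra generated by `(X 0, ξ 0), …, (X n, ξ n)`. -/
@[reducible] def history {Ω S : Type*} [MeasurableSpace S] (X : ℕ → Ω → ℝ) (ξ : ℕ → Ω → S) (n : ℕ) :
    MeasurableSpace Ω :=
  ⨆ m ≤ n, MeasurableSpace.comap (fun ω => (X m ω, ξ m ω)) inferInstance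

/-- `(X n, ξ n)` is a time-homogeneous Markov process on `[0, ∞) × S`, with an arbitrary initial
law, whose one-step transition probabilities are `stepProb P w`. -/
structure IsWalk {Ω S : Type*} [MeasurableSpace Ω] [DecidableEq S] [MeasurableSpace S]
    (P : Matrix S S ℝ) (w : S → ℝ → ℝ) (Pr : Measure Ω) (X : ℕ → Ω → ℝ) (ξ : ℕ → Ω → S) :
    Prop where
  measurable_fst : ∀ n, Measurable (X n)
  measurable_snd : ∀ n, Measurable (ξ n)
  nonneg : ∀ n ω, 0 ≤ X n ω
  transition : ∀ (n : ℕ) (B : Set ℝ) (j : S), MeasurableSet B → B ⊆ Set.Ici 0 →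
    Pr⟦{ω | X (n + 1) ω ∈ B ∧ ξ (n + 1) ω = j} | history X ξ n⟧
      =ᵐ[Pr] fun ω => stepProb P w (X n ω) (ξ n ω) B j

/-- `liminf X n = 0` almost surely (the lower limit is taken in the extended reals). -/
def IsRecurrent {Ω : Type*} [MeasurableSpace Ω] (Pr : Measure Ω) (X : ℕ → Ω → ℝ) : Prop :=
  ∀ᵐ ω ∂Pr, liminf (fun n => (X n ω : EReal)) atTop = 0

/-- `X n → ∞` almost surely. -/
def IsTransient {Ω : Type*} [MeasurableSpace Ω] (Pr : Measure Ω) (X : ℕ → Ω → ℝ) : Prop :=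
  ∀ᵐ ω ∂Pr, Tendsto (fun n => X n ω) atTop atTop

end HalfLineWalk

end

open HalfLineWalk

/-! The proof is a Foster–Lyapunov argument for `logHeight`, the function K + log⁺ x + θ i. From a
far point (x, i) write the jump size as y = x u. By `tendsto_integral_comp_div` the density v i
behaves at scale x like c i · x ^ (-1 - α i) · u ^ (-1 - α i), so when χα < 1 the mean increment of
the height is asymptotically c i · x ^ (-α i) times the Mellin integral of `driftProfile`. A jump
inwards contributes log |1 - u|, a jump outwards log (1 + u), and a jump across the origin (u ≥ 1)
adds the mean change d i = (Pθ - θ) i of the branch correction. By `integral_driftProfile` the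
integral equals (χ/α)(π cot(χπα) + d i); the cotangent comes from its partial fraction expansion.

The rates x ^ (-α i) differ between branches, so only signs matter. The Poisson equation
(`exists_poisson_solution`) gives θ for which π cot(χ i π α i) + d i is the same number on every
branch, namely π times the μ-average of the cotangents. Thus the sign of that average governs the
drift of the height on all branches at once.

If it is negative, the height itself is a supermartingale far out and tends to infinity, which gives
recurrence (`IsWalk.isRecurrent`). If it is positive, the reciprocal of the height is one and tends
to zero; its quadratic error is controlled by a large additive constant in the height, which gives
transience (`IsWalk.isTransient`). If it vanishes, the square root of the height is used: the rate
assumed on the tails makes the first-order term O(x ^ (-α - ε)), while the strict concavity of the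
root gains x ^ (-α) up to powers of log x.

If χα ≥ 1 on some branch, the profile, which is about -u ^ (1/χ) near 0, has integral -∞. Truncating
it near 0 gives an upper bound with negative integral whatever d is, so the Poisson equation may be
solved with an arbitrarily negative value on that branch. Since μ charges every branch, the average
can be made negative, and recurrence follows. -/

namespace HalfLineWalk

/-! ### Integrability against powers and the Mellin transform of log |1 - u| -/

lemma integrableOn_abs_sub_one_rpow {r : ℝ} (hr : -1 < r) :
    IntegrableOn (fun u : ℝ => |1 - u| ^ r) (Set.Ioc 0 2) := by
  have h0 : ∀ b : ℝ, IntervalIntegrable (fun u : ℝ => u ^ r) volume 0 b :=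
    fun b => intervalIntegral.intervalIntegrable_rpow' hr
  have h1 : IntervalIntegrable (fun u : ℝ => |1 - u| ^ r) volume 0 1 := by
    have h := ((h0 1).comp_sub_left 1).symm
    simp only [sub_self, sub_zero] at h
    refine h.congr_ae ?_
    refine (ae_restrict_iff' measurableSet_uIoc).2 (Eventually.of_forall fun u hu => ?_)
    rw [Set.uIoc_of_le zero_le_one] at hu
    simp only [abs_of_nonneg (sub_nonneg.2 hu.2)]
  have h2 : IntervalIntegrable (fun u : ℝ => |1 - u| ^ r) volume 1 2 := by
    have h := (h0 1).comp_sub_right 1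
    norm_num at h
    refine h.congr_ae ?_
    refine (ae_restrict_iff' measurableSet_uIoc).2 (Eventually.of_forall fun u hu => ?_)
    rw [Set.uIoc_of_le one_le_two] at hu
    simp only [abs_sub_comm 1 u, abs_of_nonneg (sub_nonneg.2 hu.1.le)]
  exact (intervalIntegrable_iff_integrableOn_Ioc_of_le zero_le_two).1 (h1.trans h2)

/-- A function with power bounds at `0`, `1` and `∞` is integrable against `u ^ (-1 - β)`. -/
lemma integrableOn_mul_rpow_of_bounds {φ : ℝ → ℝ} (hφ : Measurable φ) {β p q A : ℝ}
    (hp : β < p) (hq : q < β)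
    (h0 : ∀ u, 0 < u → u ≤ 1 / 2 → |φ u| ≤ A * u ^ p)
    (h1 : ∀ u, 1 / 2 < u → u ≤ 2 → u ≠ 1 → |φ u| ≤ A * |1 - u| ^ (-(3 / 4) : ℝ))
    (h2 : ∀ u, 2 < u → |φ u| ≤ A * u ^ q) :
    IntegrableOn (fun u => φ u * u ^ (-1 - β)) (Set.Ioi 0) := by
  have hm : Measurable (fun u => φ u * u ^ (-1 - β)) := by fun_prop
  have e1 : IntegrableOn (fun u => φ u * u ^ (-1 - β)) (Set.Ioc 0 (1 / 2)) := by
    have hb : IntegrableOn (fun u : ℝ => A * u ^ (p - 1 - β)) (Set.Ioc 0 (1 / 2)) := by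
      refine Integrable.const_mul ?_ A
      exact (intervalIntegrable_iff_integrableOn_Ioc_of_le (by norm_num)).1
        (intervalIntegral.intervalIntegrable_rpow' (by linarith))
    refine hb.mono' hm.aestronglyMeasurable ?_
    refine (ae_restrict_iff' measurableSet_Ioc).2 (Eventually.of_forall fun u hu => ?_)
    have hu0 : 0 < u := hu.1
    rw [Real.norm_eq_abs, abs_mul, abs_of_pos (Real.rpow_pos_of_pos hu0 _),
      show p - 1 - β = p + (-1 - β) by ring, Real.rpow_add hu0, ← mul_assoc]
    exact mul_le_mul_of_nonneg_right (h0 u hu0 hu.2) (Real.rpow_pos_of_pos hu0 _).le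
  have e2 : IntegrableOn (fun u => φ u * u ^ (-1 - β)) (Set.Ioc (1 / 2) 2) := by
    obtain ⟨B, hB⟩ : ∃ B, ∀ u ∈ Set.Icc (1 / 2 : ℝ) 2, |u ^ (-1 - β)| ≤ B := by
      have hc : ContinuousOn (fun u : ℝ => u ^ (-1 - β)) (Set.Icc (1 / 2) 2) := fun u hu =>
        (Real.continuousAt_rpow_const u _ (Or.inl (by
          have := hu.1; intro h; norm_num [h] at this))).continuousWithinAt
      exact isCompact_Icc.exists_bound_of_continuousOn hc
    have hb : IntegrableOn (fun u : ℝ => B * (A * |1 - u| ^ (-(3 / 4) : ℝ))) (Set.Ioc (1 / 2) 2) :=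
      (((integrableOn_abs_sub_one_rpow (by norm_num)).mono_set
        (Set.Ioc_subset_Ioc_left (by norm_num))).const_mul A).const_mul B
    refine hb.mono' hm.aestronglyMeasurable ?_
    refine (ae_restrict_iff' measurableSet_Ioc).2 ?_
    filter_upwards [compl_mem_ae_iff.2 (measure_singleton (μ := volume) 1)] with u hu1 hu
    rw [Real.norm_eq_abs, abs_mul, mul_comm]
    exact mul_le_mul (hB u ⟨hu.1.le, hu.2⟩) (h1 u hu.1 hu.2 hu1) (abs_nonneg _)
      ((abs_nonneg _).trans (hB u ⟨hu.1.le, hu.2⟩))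
  have e3 : IntegrableOn (fun u => φ u * u ^ (-1 - β)) (Set.Ioi 2) := by
    have hb : IntegrableOn (fun u : ℝ => A * u ^ (q - 1 - β)) (Set.Ioi 2) :=
      Integrable.const_mul (integrableOn_Ioi_rpow_of_lt (by linarith) two_pos) A
    refine hb.mono' hm.aestronglyMeasurable ?_
    refine (ae_restrict_iff' measurableSet_Ioi).2 (Eventually.of_forall fun u hu => ?_)
    have hu0 : 0 < u := lt_trans two_pos hu
    rw [Real.norm_eq_abs, abs_mul, abs_of_pos (Real.rpow_pos_of_pos hu0 _),
      show q - 1 - β = q + (-1 - β) by ring, Real.rpow_add hu0, ← mul_assoc]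
    exact mul_le_mul_of_nonneg_right (h2 u hu) (Real.rpow_pos_of_pos hu0 _).le
  have hU : Set.Ioi (0 : ℝ) = Set.Ioc 0 (1 / 2) ∪ (Set.Ioc (1 / 2) 2 ∪ Set.Ioi 2) := by
    rw [Set.Ioc_union_Ioi_eq_Ioi (by norm_num), Set.Ioc_union_Ioi_eq_Ioi (by norm_num)]
  rw [hU]
  exact e1.union (e2.union e3)

lemma abs_log_one_sub_le {u : ℝ} (h0 : 0 ≤ u) (h1 : u ≤ 1 / 2) : |Real.log (1 - u)| ≤ 2 * u := by
  have hp : 0 < 1 - u := by linarith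
  rw [abs_of_nonpos (Real.log_nonpos hp.le (by linarith))]
  have h := Real.one_sub_inv_le_log_of_pos hp
  have : (1 - u)⁻¹ ≤ 1 + 2 * u := by
    rw [inv_le_iff_one_le_mul₀ hp]; nlinarith
  linarith

lemma abs_log_le_rpow {y : ℝ} (h0 : 0 ≤ y) (h1 : y ≤ 1) :
    |Real.log y| ≤ 4 * y ^ (-(1 / 4) : ℝ) := by
  rcases h0.eq_or_lt with rfl | hy
  · simp
  have h := (Real.abs_log_mul_self_rpow_lt y (1 / 4) hy h1 (by norm_num)).le
  rw [abs_mul, abs_of_pos (Real.rpow_pos_of_pos hy _)] at h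
  rw [Real.rpow_neg h0, ← div_eq_mul_inv, le_div_iff₀ (Real.rpow_pos_of_pos hy _)]
  linarith

/-- Expand -log (1 - u) in its power series and integrate term by term. The evaluations at s = β and
s = -β are the contributions of (1, ∞) and (0, 1) to the Mellin transform. -/
lemma hasSum_integral_log_one_sub {s : ℝ} (hs : -1 < s) :
    HasSum (fun n : ℕ => 1 / (((n : ℝ) + 1) * (n + 1 + s)))
      (∫ u in Set.Ioo (0 : ℝ) 1, -Real.log (1 - u) * u ^ (s - 1)) := by
  have hn : ∀ n : ℕ, (0 : ℝ) < n + 1 + s := fun n => by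
    have : (0 : ℝ) ≤ n := n.cast_nonneg
    linarith
  set F : ℕ → ℝ → ℝ := fun n u => u ^ ((n : ℝ) + s) / (n + 1) with hF
  have hFi : ∀ n, ∫ u in Set.Ioo (0 : ℝ) 1, F n u = 1 / (((n : ℝ) + 1) * (n + 1 + s)) := by
    intro n
    have h := hn n
    rw [← integral_Ioc_eq_integral_Ioo, ← intervalIntegral.integral_of_le zero_le_one]
    simp only [hF]
    rw [intervalIntegral.integral_div, integral_rpow (Or.inl (by linarith)), Real.one_rpow,
      Real.zero_rpow (by linarith), sub_zero]
    have h1 : (n : ℝ) + s + 1 ≠ 0 := by linarith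
    have h2 : (n : ℝ) + 1 + s ≠ 0 := by linarith
    have h3 : (n : ℝ) + 1 ≠ 0 := by positivity
    rw [div_div, show (n : ℝ) + s + 1 = n + 1 + s by ring, mul_comm]
  have hInt : ∀ n, IntegrableOn (F n) (Set.Ioo (0 : ℝ) 1) := by
    intro n
    have h := hn n
    refine Integrable.div_const ?_ _
    refine IntegrableOn.mono_set ?_ Set.Ioo_subset_Ioc_self
    exact (intervalIntegrable_iff_integrableOn_Ioc_of_le zero_le_one).1
        (intervalIntegral.intervalIntegrable_rpow' (by linarith))
  have hnorm : ∀ n, ∫ u in Set.Ioo (0 : ℝ) 1, ‖F n u‖ = 1 / (((n : ℝ) + 1) * (n + 1 + s)) := by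
    intro n
    rw [← hFi n]
    refine setIntegral_congr_fun measurableSet_Ioo fun u hu => ?_
    refine Real.norm_of_nonneg ?_
    have := hu.1
    simp only [hF]
    positivity
  have hsum : Summable fun n : ℕ => 1 / (((n : ℝ) + 1) * (n + 1 + s)) := by
    have hb : Summable fun n : ℕ => (1 / min 1 (1 + s)) * (1 / ((n : ℝ) + 1) ^ 2) := by
      refine Summable.mul_left _ ?_
      exact_mod_cast (summable_nat_add_iff (G := ℝ) 1).2
        (Real.summable_one_div_nat_pow.2 (by norm_num : 1 < 2))
    refine Summable.of_nonneg_of_le (fun n => ?_) (fun n => ?_) hb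
    · have := hn n; positivity
    · have hm : 0 < min 1 (1 + s) := lt_min one_pos (by linarith)
      rw [one_div_mul_one_div]
      have hn0 : (0 : ℝ) ≤ n := n.cast_nonneg
      refine one_div_le_one_div_of_le (by positivity) ?_
      have : min 1 (1 + s) * ((n : ℝ) + 1) ≤ n + 1 + s := by
        rcases le_total 1 (1 + s) with h | h
        · rw [min_eq_left h]; linarith
        · rw [min_eq_right h]; nlinarith
      calc min 1 (1 + s) * ((n : ℝ) + 1) ^ 2 = (n + 1) * (min 1 (1 + s) * ((n : ℝ) + 1)) := by ring
        _ ≤ _ := by gcongr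
  have key := hasSum_integral_of_summable_integral_norm (μ := volume.restrict (Set.Ioo (0 : ℝ) 1))
    (F := F) hInt (by simpa only [hnorm] using hsum)
  simp only [hFi] at key
  suffices e : ∫ u in Set.Ioo (0 : ℝ) 1, -Real.log (1 - u) * u ^ (s - 1) =
      ∫ u in Set.Ioo (0 : ℝ) 1, ∑' n, F n u by rwa [e]
  refine setIntegral_congr_fun measurableSet_Ioo fun u hu => ?_
  have hlog := (Real.hasSum_pow_div_log_of_abs_lt_one (x := u) (by
    rw [abs_of_pos hu.1]; exact hu.2)).mul_right (u ^ (s - 1))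
  rw [← hlog.tsum_eq]
  refine tsum_congr fun n => ?_
  simp only [hF]
  rw [show (n : ℝ) + s = ((n + 1 : ℕ) : ℝ) + (s - 1) by push_cast; ring, Real.rpow_add hu.1,
    Real.rpow_natCast]
  ring

lemma integral_log_mul_rpow {β : ℝ} (hβ : 0 < β) :
    IntegrableOn (fun t : ℝ => Real.log t * t ^ (β - 1)) (Set.Ioo 0 1) ∧
    ∫ t in Set.Ioo (0 : ℝ) 1, Real.log t * t ^ (β - 1) = -(1 / β ^ 2) := by
  have hd : ∀ t : ℝ, 0 < t → HasDerivAt (fun t : ℝ => t ^ β * Real.log t / β - t ^ β / β ^ 2)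
      (Real.log t * t ^ (β - 1)) t := by
    intro t ht
    have h1 := Real.hasDerivAt_rpow_const (x := t) (p := β) (Or.inl ht.ne')
    have h := ((h1.mul (Real.hasDerivAt_log ht.ne')).div_const β).sub (h1.div_const (β ^ 2))
    refine h.congr_deriv ?_
    have : t ^ β = t ^ (β - 1) * t := by rw [← Real.rpow_add_one ht.ne']; ring_nf
    rw [this]
    field_simp
    ring
  have hint : IntervalIntegrable (fun t : ℝ => Real.log t * t ^ (β - 1)) volume 0 1 := by
    rw [intervalIntegrable_iff_integrableOn_Ioc_of_le zero_le_one]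
    have hb : IntegrableOn (fun u : ℝ => (1 / (β / 2)) * u ^ (β / 2 - 1)) (Set.Ioc 0 1) := by
      refine Integrable.const_mul ?_ _
      exact (intervalIntegrable_iff_integrableOn_Ioc_of_le (by norm_num)).1
        (intervalIntegral.intervalIntegrable_rpow' (by linarith))
    refine hb.mono' (by fun_prop) ?_
    refine (ae_restrict_iff' measurableSet_Ioc).2 (Eventually.of_forall fun t ht => ?_)
    have h := (Real.abs_log_mul_self_rpow_lt t (β / 2) ht.1 ht.2 (by linarith)).le
    rw [show β - 1 = β / 2 + (β / 2 - 1) by ring, Real.rpow_add ht.1, ← mul_assoc,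
      Real.norm_eq_abs, abs_mul, abs_of_pos (Real.rpow_pos_of_pos ht.1 (β / 2 - 1))]
    exact mul_le_mul_of_nonneg_right h (Real.rpow_pos_of_pos ht.1 _).le
  refine ⟨(intervalIntegrable_iff_integrableOn_Ioo_of_le zero_le_one).1 hint, ?_⟩
  rw [← integral_Ioc_eq_integral_Ioo, ← intervalIntegral.integral_of_le zero_le_one]
  rw [intervalIntegral.integral_eq_sub_of_hasDerivAt_of_tendsto
    (f := fun t : ℝ => t ^ β * Real.log t / β - t ^ β / β ^ 2) (fa := 0) (fb := -(1 / β ^ 2))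
    one_pos (fun t ht => hd t ht.1) hint]
  · simp
  · have h1 : Tendsto (fun t : ℝ => Real.log t * t ^ β) (𝓝[>] 0) (𝓝 0) :=
      tendsto_log_mul_rpow_nhdsGT_zero hβ
    have h2 : Tendsto (fun t : ℝ => t ^ β) (𝓝[>] 0) (𝓝 0) := by
      have := (Real.continuousAt_rpow_const 0 β (Or.inr hβ.le)).tendsto
      rw [Real.zero_rpow hβ.ne'] at this
      exact this.mono_left nhdsWithin_le_nhds
    have := (h1.div_const β).sub (h2.div_const (β ^ 2))
    simp only [zero_div, sub_zero] at this
    refine this.congr fun t => ?_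
    ring
  · have := (hd 1 one_pos).continuousAt.tendsto
    simp only [Real.one_rpow, Real.log_one, mul_zero, zero_div, zero_sub] at this
    exact this.mono_left nhdsWithin_le_nhds

/-- The partial fractions of π cot(πβ) divided by β, with each term regrouped to match the two
series of `hasSum_integral_log_one_sub`. -/
lemma pi_mul_cot_div {β : ℝ} (h0 : 0 < β) (h1 : β < 1) :
    HasSum (fun n : ℕ => -(1 / (((n : ℝ) + 1) * (n + 1 + β)) + 1 / (((n : ℝ) + 1) * (n + 1 + -β))))
      (Real.pi / β * Real.cot (Real.pi * β) - 1 / β ^ 2) := by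
  have hz : (β : ℂ) ∈ Complex.integerComplement := by
    rintro ⟨n, hn⟩
    have hn' : (n : ℝ) = β := by exact_mod_cast hn
    have a : (0 : ℤ) < n := by exact_mod_cast hn' ▸ h0
    have b : n < (1 : ℤ) := by exact_mod_cast hn' ▸ h1
    omega
  have h := (summable_cotTerm hz).hasSum
  have e := cot_series_rep' hz
  change _ = ∑' n, cotTerm (β : ℂ) n at e
  rw [← e] at h
  have h' : HasSum (fun n : ℕ => 1 / (β - ((n : ℝ) + 1)) + 1 / (β + (n + 1)))
      (Real.pi * Real.cot (Real.pi * β) - 1 / β) := by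
    rw [← Complex.hasSum_ofReal]
    convert h using 1
    · funext n
      simp [cotTerm]
    · push_cast [Complex.ofReal_cot]
      rfl
  have e1 : Real.pi / β * Real.cot (Real.pi * β) - 1 / β ^ 2 =
      1 / β * (Real.pi * Real.cot (Real.pi * β) - 1 / β) := by
    field_simp
  rw [e1]
  refine (h'.mul_left (1 / β)).congr_fun fun n => ?_
  have hn : (0 : ℝ) ≤ n := n.cast_nonneg
  have a1 : (n : ℝ) + 1 ≠ 0 := by positivity
  have a2 : (n : ℝ) + 1 + β ≠ 0 := by positivity
  have a3 : (n : ℝ) + 1 + -β ≠ 0 := by linarith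
  have a4 : β - ((n : ℝ) + 1) = -((n : ℝ) + 1 + -β) := by ring
  have a5 : β + ((n : ℝ) + 1) = n + 1 + β := by ring
  rw [a4, a5]
  field_simp
  ring

lemma integrableOn_log_abs_one_sub {β : ℝ} (h0 : 0 < β) (h1 : β < 1) :
    IntegrableOn (fun u : ℝ => Real.log |1 - u| * u ^ (-1 - β)) (Set.Ioi 0) := by
  refine integrableOn_mul_rpow_of_bounds (p := 1) (q := β / 2) (A := 4 + 2 / β)
    (by fun_prop) h1 (by linarith) ?_ ?_ ?_
  · intro u hu hu'
    rw [abs_of_pos (show 0 < 1 - u by linarith), Real.rpow_one]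
    have := abs_log_one_sub_le hu.le hu'
    have : 0 < 2 / β := by positivity
    nlinarith
  · intro u hu hu' hu1
    have hy : |1 - u| ≤ 1 := by rw [abs_le]; constructor <;> linarith
    refine (abs_log_le_rpow (abs_nonneg _) hy).trans ?_
    have h : 0 < |1 - u| := abs_pos.2 (sub_ne_zero.2 hu1.symm)
    have hr : |1 - u| ^ (-(1 / 4) : ℝ) ≤ |1 - u| ^ (-(3 / 4) : ℝ) :=
      Real.rpow_le_rpow_of_exponent_ge h hy (by norm_num)
    have : 0 < 2 / β := by positivity
    have h3 : 0 < |1 - u| ^ (-(3 / 4) : ℝ) := Real.rpow_pos_of_pos h _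
    nlinarith
  · intro u hu
    have hu0 : 0 < u := by linarith
    rw [abs_of_neg (show 1 - u < 0 by linarith), abs_of_nonneg (Real.log_nonneg (by linarith))]
    have h2 : Real.log (-(1 - u)) ≤ Real.log u := Real.log_le_log (by linarith) (by linarith)
    have h3 := Real.log_le_rpow_div hu0.le (show 0 < β / 2 by linarith)
    have h4 : u ^ (β / 2) / (β / 2) = 2 / β * u ^ (β / 2) := by field_simp
    have : 0 < u ^ (β / 2) := Real.rpow_pos_of_pos hu0 _
    nlinarith

/-- The Mellin transform of `log |1 - u|`. -/
theorem integral_log_abs_one_sub {β : ℝ} (h0 : 0 < β) (h1 : β < 1) :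
    ∫ u in Set.Ioi (0 : ℝ), Real.log |1 - u| * u ^ (-1 - β) =
      Real.pi / β * Real.cot (Real.pi * β) := by
  set g : ℝ → ℝ := fun u => Real.log |1 - u| * u ^ (-1 - β) with hg
  have hgi : IntegrableOn g (Set.Ioi 0) := integrableOn_log_abs_one_sub h0 h1
  have hsplit : ∫ u in Set.Ioi (0 : ℝ), g u =
      (∫ u in Set.Ioo (0 : ℝ) 1, g u) + ∫ u in Set.Ioi (1 : ℝ), g u := by
    rw [← Set.Ioc_union_Ioi_eq_Ioi zero_le_one, setIntegral_union Set.Ioc_disjoint_Ioi_same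
      measurableSet_Ioi (hgi.mono_set Set.Ioc_subset_Ioi_self)
      (hgi.mono_set (Set.Ioi_subset_Ioi zero_le_one)), integral_Ioc_eq_integral_Ioo]
  have hfirst : ∫ u in Set.Ioo (0 : ℝ) 1, g u =
      -∫ u in Set.Ioo (0 : ℝ) 1, -Real.log (1 - u) * u ^ (-β - 1) := by
    rw [← integral_neg]
    refine setIntegral_congr_fun measurableSet_Ioo fun u hu => ?_
    simp only [hg]
    rw [abs_of_pos (show 0 < 1 - u by linarith [hu.2]), show -1 - β = -β - 1 by ring]
    ring
  have hint : IntegrableOn (fun u : ℝ => -Real.log (1 - u) * u ^ (β - 1)) (Set.Ioo 0 1) := by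
    have hb : IntegrableOn (fun u => -g u) (Set.Ioo 0 1) :=
      (hgi.mono_set Set.Ioo_subset_Ioi_self).neg
    refine hb.mono' (by fun_prop) ?_
    refine (ae_restrict_iff' measurableSet_Ioo).2 (Eventually.of_forall fun u hu => ?_)
    have hp : 0 < 1 - u := by linarith [hu.2]
    have hl : Real.log (1 - u) ≤ 0 := Real.log_nonpos hp.le (by linarith [hu.1])
    have hr : u ^ (β - 1) ≤ u ^ (-1 - β) :=
      Real.rpow_le_rpow_of_exponent_ge hu.1 hu.2.le (by linarith)
    have hr0 := Real.rpow_pos_of_pos hu.1 (β - 1)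
    simp only [hg]
    rw [abs_of_pos hp, Real.norm_of_nonneg (mul_nonneg (by linarith) hr0.le)]
    nlinarith
  obtain ⟨hli, hlv⟩ := integral_log_mul_rpow h0
  have hsecond : ∫ u in Set.Ioi (1 : ℝ), g u =
      -(∫ u in Set.Ioo (0 : ℝ) 1, -Real.log (1 - u) * u ^ (β - 1)) + 1 / β ^ 2 := by
    -- The inversion u = 1/t sends (1, ∞) to (0, 1), where log |1 - 1/t| = log (1 - t) - log t; the
    -- second logarithm produces 1/β².
    have hsub := integral_comp_rpow_Ioi ((Set.Ioi (1 : ℝ)).indicator g) (p := -1) (by norm_num)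
    rw [setIntegral_indicator measurableSet_Ioi, Set.inter_eq_right.2
      (Set.Ioi_subset_Ioi zero_le_one)] at hsub
    rw [← hsub]
    have e2 : ∀ x ∈ Set.Ioi (0 : ℝ), (|(-1 : ℝ)| * x ^ (-1 - 1 : ℝ)) •
        (Set.Ioi (1 : ℝ)).indicator g (x ^ (-1 : ℝ)) = (Set.Ioo (0 : ℝ) 1).indicator
        (fun t => -(-Real.log (1 - t) * t ^ (β - 1)) - Real.log t * t ^ (β - 1)) x := by
      intro x hx
      have hx0 : 0 < x := hx
      rw [Real.rpow_neg_one]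
      by_cases hx1 : x < 1
      · rw [Set.indicator_of_mem (show x⁻¹ ∈ Set.Ioi (1 : ℝ) from (one_lt_inv₀ hx0).2 hx1),
          Set.indicator_of_mem (show x ∈ Set.Ioo (0 : ℝ) 1 from ⟨hx0, hx1⟩)]
        simp only [hg]
        have ha : |1 - x⁻¹| = (1 - x) / x := by
          rw [abs_of_neg (by have := (one_lt_inv₀ hx0).2 hx1; linarith)]
          field_simp
          ring
        rw [ha, Real.log_div (by linarith) hx0.ne', Real.inv_rpow hx0.le, ← Real.rpow_neg hx0.le,
          smul_eq_mul, abs_neg, abs_one, one_mul,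
          show β - 1 = (-1 - 1) + (-(-1 - β)) by ring, Real.rpow_add hx0]
        ring
      · rw [Set.indicator_of_notMem, Set.indicator_of_notMem, smul_zero]
        · exact fun h => hx1 h.2
        · intro h
          exact hx1 ((one_lt_inv₀ hx0).1 h)
    rw [setIntegral_congr_fun measurableSet_Ioi e2, setIntegral_indicator measurableSet_Ioo,
      Set.inter_eq_right.2 Set.Ioo_subset_Ioi_self]
    rw [integral_sub (f := fun u => -(-Real.log (1 - u) * u ^ (β - 1))) hint.neg hli,
      integral_neg, hlv]
    ring
  have s1 := hasSum_integral_log_one_sub (s := -β) (by linarith)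
  have s2 := hasSum_integral_log_one_sub (s := β) (by linarith)
  -- Together the two series are the cotangent expansion, and the 1/β² from the inversion cancels
  -- its polar term.
  have s3 := (s2.add s1).neg.unique (pi_mul_cot_div h0 h1)
  rw [hsplit, hfirst, hsecond]
  linarith

/-! ### Scaling asymptotics of integrals against heavy-tailed densities -/

lemma IsTailFactor.exists_le {α c : ℝ} {v C : ℝ → ℝ} (h : IsTailFactor α c v C) :
    ∃ M, 0 < M ∧ ∀ y, 0 < y → C y ≤ M := by
  obtain ⟨M, hM⟩ := h.bounded
  exact ⟨M, (h.pos 0 le_rfl).trans_le (hM 0 le_rfl), fun y hy => hM y hy.le⟩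

lemma IsTailFactor.scaled_eq {α c : ℝ} {v C : ℝ → ℝ} (h : IsTailFactor α c v C) {x u : ℝ}
    (hx : 0 < x) (hu : 0 < u) : x ^ (1 + α) * v (x * u) = C (x * u) * u ^ (-1 - α) := by
  rw [h.eq_of_pos _ (mul_pos hx hu), Real.mul_rpow hx.le hu.le,
    show (-1 - α) = -(1 + α) by ring, Real.rpow_neg hx.le]
  have := Real.rpow_pos_of_pos hx (1 + α)
  field_simp

lemma integrableOn_scaled {α c : ℝ} {v C φ : ℝ → ℝ} (hv : Measurable v)
    (h : IsTailFactor α c v C) (hφ : Measurable φ)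
    (hi : IntegrableOn (fun u => φ u * u ^ (-1 - α)) (Set.Ioi 0)) {x : ℝ} (hx : 0 < x) :
    IntegrableOn (fun u => x ^ (1 + α) * v (x * u) * φ u) (Set.Ioi 0) := by
  obtain ⟨M, hM0, hM⟩ := h.exists_le
  refine (hi.norm.const_mul M).mono' (by fun_prop) ?_
  refine (ae_restrict_iff' measurableSet_Ioi).2 (Eventually.of_forall fun u hu => ?_)
  have hu : 0 < u := hu
  rw [h.scaled_eq hx hu, norm_mul, norm_mul, norm_mul,
    Real.norm_of_nonneg (h.pos _ (mul_pos hx hu).le).le, mul_assoc, mul_comm ‖φ u‖]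
  exact mul_le_mul_of_nonneg_right (hM _ (mul_pos hx hu)) (by positivity)

lemma integrableOn_comp_div {α c : ℝ} {v C φ : ℝ → ℝ} (hv : Measurable v)
    (h : IsTailFactor α c v C) (hφ : Measurable φ)
    (hi : IntegrableOn (fun u => φ u * u ^ (-1 - α)) (Set.Ioi 0)) {x : ℝ} (hx : 0 < x) :
    IntegrableOn (fun y => v y * φ (y / x)) (Set.Ioi 0) := by
  have := integrableOn_Ioi_comp_mul_left_iff (fun y => v y * φ (y / x)) 0 hx
  rw [mul_zero] at this
  rw [← this]
  have h1 := (integrableOn_scaled hv h hφ hi hx).const_mul (x ^ (1 + α))⁻¹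
  refine IntegrableOn.congr_fun h1 (fun u _ => ?_) measurableSet_Ioi
  have := Real.rpow_pos_of_pos hx (1 + α)
  simp only [mul_div_cancel_left₀ u hx.ne']
  field_simp

lemma rpow_mul_integral_comp_div {α : ℝ} (v φ : ℝ → ℝ) {x : ℝ} (hx : 0 < x) :
    x ^ α * ∫ y in Set.Ioi (0 : ℝ), v y * φ (y / x) =
      ∫ u in Set.Ioi (0 : ℝ), x ^ (1 + α) * v (x * u) * φ u := by
  have := integral_comp_mul_left_Ioi (fun y => v y * φ (y / x)) 0 hx
  rw [mul_zero] at this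
  simp only [mul_div_cancel_left₀ _ hx.ne', smul_eq_mul] at this
  simp only [mul_assoc]
  rw [integral_const_mul, this, Real.rpow_add hx, Real.rpow_one]
  field_simp

/-- The integral of `φ (y / x)` against a heavy-tailed density is of order `x ^ (-α)`. -/
lemma tendsto_integral_comp_div {α c : ℝ} {v C φ : ℝ → ℝ} (hv : Measurable v)
    (h : IsTailFactor α c v C) (hφ : Measurable φ)
    (hi : IntegrableOn (fun u => φ u * u ^ (-1 - α)) (Set.Ioi 0)) :
    Tendsto (fun x => x ^ α * ∫ y in Set.Ioi (0 : ℝ), v y * φ (y / x)) atTop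
      (𝓝 (c * ∫ u in Set.Ioi (0 : ℝ), φ u * u ^ (-1 - α))) := by
  obtain ⟨M, hM0, hM⟩ := h.exists_le
  rw [← integral_const_mul]
  have key : Tendsto (fun x => ∫ u in Set.Ioi (0 : ℝ), x ^ (1 + α) * v (x * u) * φ u) atTop
      (𝓝 (∫ u in Set.Ioi (0 : ℝ), c * (φ u * u ^ (-1 - α)))) := by
    -- After the substitution y = x u the density factor is C (x u), bounded by M and tending to c
    -- for each fixed u.
    refine tendsto_integral_filter_of_dominated_convergence
      (fun u => M * ‖φ u * u ^ (-1 - α)‖) ?_ ?_ (hi.norm.const_mul M) ?_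
    · exact Eventually.of_forall fun x => by fun_prop
    · filter_upwards [eventually_gt_atTop 0] with x hx
      refine (ae_restrict_iff' measurableSet_Ioi).2 (Eventually.of_forall fun u hu => ?_)
      have hu : 0 < u := hu
      rw [h.scaled_eq hx hu, norm_mul, norm_mul, norm_mul,
        Real.norm_of_nonneg (h.pos _ (mul_pos hx hu).le).le, mul_assoc, mul_comm ‖φ u‖]
      exact mul_le_mul_of_nonneg_right (hM _ (mul_pos hx hu)) (by positivity)
    · refine (ae_restrict_iff' measurableSet_Ioi).2 (Eventually.of_forall fun u hu => ?_)
      have hu : 0 < u := hu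
      have h1 : Tendsto (fun x => C (x * u)) atTop (𝓝 c) :=
        h.tendsto.comp (tendsto_id.atTop_mul_const hu)
      refine (h1.mul_const (φ u * u ^ (-1 - α))).congr' ?_
      filter_upwards [eventually_gt_atTop 0] with x hx
      rw [h.scaled_eq hx hu]
      ring
  refine key.congr' ?_
  filter_upwards [eventually_gt_atTop 0] with x hx
  rw [rpow_mul_integral_comp_div v φ hx]

/-- The asymptotic bound becomes one on all of (0, ∞): below the threshold Y, C is bounded and y ^
(-ε) is at least Y ^ (-ε). A smaller exponent ε is allowed so that integrability against u ^ (-1 - α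
- ε) can be retained later. -/
lemma IsTailFactor.exists_abs_sub_le {α c δ ε : ℝ} {v C : ℝ → ℝ} (h : IsTailFactor α c v C)
    (hO : (fun y => C y - c) =O[atTop] (fun y : ℝ => y ^ (-δ))) (hε : 0 < ε) (hεδ : ε ≤ δ) :
    ∃ A, ∀ y, 0 < y → |C y - c| ≤ A * y ^ (-ε) := by
  obtain ⟨M, hM0, hM⟩ := h.exists_le
  obtain ⟨K, hK0, hK⟩ := hO.exists_pos
  rw [Asymptotics.IsBigOWith_def, eventually_atTop] at hK
  obtain ⟨Y₀, hY⟩ := hK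
  set Y := max Y₀ 1 with hYdef
  have hY1 : 1 ≤ Y := le_max_right _ _
  have hY0 : 0 < Y := by linarith
  refine ⟨K + (M + |c|) * Y ^ ε, fun y hy => ?_⟩
  have hp := Real.rpow_pos_of_pos hy (-ε)
  have hYp := Real.rpow_pos_of_pos hY0 ε
  rcases le_or_gt Y y with hyY | hyY
  · have h1 := hY y ((le_max_left _ _).trans hyY)
    rw [Real.norm_eq_abs, Real.norm_of_nonneg (Real.rpow_nonneg hy.le _)] at h1
    have h2 : y ^ (-δ) ≤ y ^ (-ε) :=
      Real.rpow_le_rpow_of_exponent_le (hY1.trans hyY) (by linarith)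
    have h3 : 0 ≤ (M + |c|) * Y ^ ε := by positivity
    nlinarith
  · have h1 : |C y - c| ≤ M + |c| := by
      refine (abs_sub _ _).trans ?_
      rw [abs_of_pos (h.pos y hy.le)]
      linarith [hM y hy]
    have h2 : 1 ≤ Y ^ ε * y ^ (-ε) := by
      rw [Real.rpow_neg hy.le, ← div_eq_mul_inv, one_le_div (Real.rpow_pos_of_pos hy _)]
      exact Real.rpow_le_rpow hy.le hyY.le hε.le
    have h3 : 0 ≤ M + |c| := by positivity
    nlinarith [mul_le_mul_of_nonneg_left h2 h3, mul_pos hK0 hp]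

/-- The quantitative form of `tendsto_integral_comp_div`: the error C (x u) - c is at most A (x u) ^
(-ε), so x ^ (-ε) comes out and u ^ (-ε) joins the weight. -/
lemma exists_abs_integral_comp_div_sub_le {α c δ ε : ℝ} {v C φ : ℝ → ℝ} (hv : Measurable v)
    (h : IsTailFactor α c v C) (hφ : Measurable φ)
    (hO : (fun y => C y - c) =O[atTop] (fun y : ℝ => y ^ (-δ))) (hε : 0 < ε) (hεδ : ε ≤ δ)
    (hi : IntegrableOn (fun u => φ u * u ^ (-1 - α)) (Set.Ioi 0))
    (hi' : IntegrableOn (fun u => φ u * u ^ (-1 - (α + ε))) (Set.Ioi 0)) :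
    ∃ A, ∀ x, 0 < x → |x ^ α * (∫ y in Set.Ioi (0 : ℝ), v y * φ (y / x)) -
      c * ∫ u in Set.Ioi (0 : ℝ), φ u * u ^ (-1 - α)| ≤ A * x ^ (-ε) := by
  obtain ⟨A, hA⟩ := h.exists_abs_sub_le hO hε hεδ
  refine ⟨A * ∫ u in Set.Ioi (0 : ℝ), ‖φ u * u ^ (-1 - (α + ε))‖, fun x hx => ?_⟩
  rw [rpow_mul_integral_comp_div v φ hx, ← integral_const_mul,
    ← integral_sub (integrableOn_scaled hv h hφ hi hx) (hi.const_mul c), mul_right_comm,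
    ← integral_const_mul, ← Real.norm_eq_abs]
  refine norm_integral_le_of_norm_le (hi'.norm.const_mul _) ?_
  refine (ae_restrict_iff' measurableSet_Ioi).2 (Eventually.of_forall fun u hu => ?_)
  have hu : 0 < u := hu
  rw [h.scaled_eq hx hu, show C (x * u) * u ^ (-1 - α) * φ u - c * (φ u * u ^ (-1 - α)) =
    (C (x * u) - c) * (φ u * u ^ (-1 - α)) by ring, norm_mul, Real.norm_eq_abs]
  refine (mul_le_mul_of_nonneg_right (hA _ (mul_pos hx hu)) (norm_nonneg _)).trans_eq ?_
  rw [Real.mul_rpow hx.le hu.le, show (-1 - (α + ε)) = (-1 - α) + -ε by ring, Real.rpow_add hu,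
    norm_mul, norm_mul, norm_mul, Real.norm_of_nonneg (Real.rpow_pos_of_pos hu (-ε)).le]
  ring

/-! ### The one-step law -/

section Step

variable {S : Type*} [DecidableEq S]

lemma chi_pos (one : Finset S) (k : S) : 0 < chi one k := by
  unfold chi; split_ifs <;> norm_num

lemma chi_le_one (one : Finset S) (k : S) : chi one k ≤ 1 := by
  unfold chi; split_ifs <;> norm_num

lemma HeavyTailed.eq_zero {α c : ℝ} {v : ℝ → ℝ} (hv : HeavyTailed α c v) {y : ℝ} (hy : y ≤ 0) :
    v y = 0 := by
  obtain ⟨-, C, hC⟩ := hv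
  exact hC.eq_of_nonpos y hy

lemma HeavyTailed.pos {α c : ℝ} {v : ℝ → ℝ} (hv : HeavyTailed α c v) {y : ℝ} (hy : 0 < y) :
    0 < v y := by
  obtain ⟨-, C, hC⟩ := hv
  rw [hC.eq_of_pos y hy]
  exact mul_pos (hC.pos y hy.le) (Real.rpow_pos_of_pos hy _)

/-- Since v vanishes on (-∞, 0], both kinds of branch have the same form: a jump of size with
density v, directed inwards with probability χ and outwards with probability 1 - χ. -/
lemma increment_eq {α c : S → ℝ} {v : S → ℝ → ℝ} (hv : ∀ k, HeavyTailed (α k) (c k) (v k))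
    (one : Finset S) (k : S) (y : ℝ) :
    increment one v k y = chi one k * v k (-y) + (1 - chi one k) * v k y := by
  unfold increment chi
  split_ifs with h
  · ring
  · rcases le_total 0 y with hy | hy
    · rw [abs_of_nonneg hy, (hv k).eq_zero (show -y ≤ 0 by linarith)]; ring
    · rw [abs_of_nonpos hy, (hv k).eq_zero hy]; ring

variable [Fintype S]

/-- The law with density `v` on `(0, ∞)`. -/
noncomputable def jumpLaw (v : ℝ → ℝ) : Measure ℝ :=
  (volume.restrict (Set.Ioi 0)).withDensity fun y => ENNReal.ofReal (v y)

variable [MeasurableSpace S]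

/-- The law of the next state of the walk started from `(x, i)`. -/
noncomputable def stepMeasure (P : Matrix S S ℝ) (one : Finset S) (v : S → ℝ → ℝ)
    (x : ℝ) (i : S) : Measure (ℝ × S) :=
  ENNReal.ofReal (chi one i) • (((jumpLaw (v i)).restrict (Set.Iio x)).map (fun y => (x - y, i)) +
    ∑ j, ENNReal.ofReal (P i j) •
      ((jumpLaw (v i)).restrict (Set.Ici x)).map (fun y => (y - x, j))) +
  ENNReal.ofReal (1 - chi one i) • (jumpLaw (v i)).map (fun y => (x + y, i))

/-- The mean of `f` after one step from `(x, i)`, conditional on the size `y` of the increment. -/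
noncomputable def stepAverage (P : Matrix S S ℝ) (one : Finset S) (f : ℝ × S → ℝ)
    (x : ℝ) (i : S) (y : ℝ) : ℝ :=
  chi one i * (if y < x then f (x - y, i) else ∑ j, P i j * f (y - x, j)) +
    (1 - chi one i) * f (x + y, i)

lemma lintegral_jumpLaw {v : ℝ → ℝ} (hv : Measurable v) {g : ℝ → ENNReal} (hg : Measurable g) :
    ∫⁻ y, g y ∂jumpLaw v = ∫⁻ y in Set.Ioi 0, ENNReal.ofReal (v y) * g y :=
  lintegral_withDensity_eq_lintegral_mul _ hv.ennreal_ofReal hg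

lemma jumpLaw_apply {α c : ℝ} {v : ℝ → ℝ} (hv : HeavyTailed α c v) {E : Set ℝ}
    (hE : MeasurableSet E) : jumpLaw v E = ENNReal.ofReal (∫ y in E, v y) := by
  unfold jumpLaw
  rw [withDensity_apply _ hE, Measure.restrict_restrict hE,
    ofReal_integral_eq_lintegral_ofReal hv.1.integrable.integrableOn
      (Eventually.of_forall hv.1.nonneg), ← lintegral_indicator (hE.inter measurableSet_Ioi),
    ← lintegral_indicator hE]
  congr 1
  funext y
  by_cases h1 : y ∈ E <;> by_cases h2 : y ∈ Set.Ioi (0 : ℝ) <;> simp [h1, h2]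
  exact (hv.eq_zero (not_lt.1 h2)).le

lemma lintegral_stepMeasure (P : Matrix S S ℝ) (one : Finset S) (v : S → ℝ → ℝ)
    {f : ℝ × S → ENNReal} (hf : Measurable f) (x : ℝ) (i : S) :
    ∫⁻ p, f p ∂stepMeasure P one v x i = ENNReal.ofReal (chi one i) *
      ((∫⁻ y in Set.Iio x, f (x - y, i) ∂jumpLaw (v i)) + ∑ j, ENNReal.ofReal (P i j) *
        ∫⁻ y in Set.Ici x, f (y - x, j) ∂jumpLaw (v i)) +
      ENNReal.ofReal (1 - chi one i) * ∫⁻ y, f (x + y, i) ∂jumpLaw (v i) := by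
  unfold stepMeasure
  rw [lintegral_add_measure, lintegral_smul_measure, lintegral_smul_measure,
    lintegral_add_measure, lintegral_finsetSum_measure, lintegral_map hf (by fun_prop),
    lintegral_map hf (by fun_prop)]
  simp only [lintegral_smul_measure, smul_eq_mul]
  congr 4
  funext j
  rw [lintegral_map hf (by fun_prop)]

/-- This identifies the mixture of push-forwards with the prescribed kernel: its three parts are
translates or reflections of the integrals in `stepProb`, for jumps across the origin, inward jumps
falling short of it, and outward jumps. -/
lemma stepMeasure_prod_singleton [MeasurableSingletonClass S] {P : Matrix S S ℝ}
    (hP : ∀ i j, 0 ≤ P i j) (one : Finset S)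
    {α c : S → ℝ} {v : S → ℝ → ℝ} (hv : ∀ k, HeavyTailed (α k) (c k) (v k))
    {x : ℝ} (hx : 0 ≤ x) (i : S) {B : Set ℝ} (hB : MeasurableSet B) (hB0 : B ⊆ Set.Ici 0) (j : S) :
    stepMeasure P one v x i (B ×ˢ {j}) =
      ENNReal.ofReal (stepProb P (increment one v) x i B j) := by
  have hm := fun k => (hv k).1.measurable
  have hs := fun k => (hv k).1.nonneg
  have hint := (hv i).1.integrable
  have i1 : IntegrableOn (fun z => v i (z + x)) B := (hint.comp_add_right x).integrableOn
  have i2 : IntegrableOn (fun z => v i (x - z)) B := (hint.comp_sub_left x).integrableOn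
  have i3 : IntegrableOn (fun z => v i (z - x)) B := (hint.comp_sub_right x).integrableOn
  have hset : MeasurableSet (B ×ˢ ({j} : Set S)) := hB.prod (measurableSet_singleton j)
  have e1 : ∫ z in B, increment one v i (-z - x) = chi one i * ∫ z in B, v i (z + x) := by
    rw [← integral_const_mul]
    refine setIntegral_congr_fun hB fun z hz => ?_
    have hz0 : 0 ≤ z := hB0 hz
    rw [increment_eq hv, (hv i).eq_zero (show -z - x ≤ 0 by linarith)]
    ring_nf
  have e2 : ∫ z in B, increment one v i (z - x) = chi one i * (∫ z in B, v i (x - z)) +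
      (1 - chi one i) * ∫ z in B, v i (z - x) := by
    rw [← integral_const_mul, ← integral_const_mul,
      ← integral_add (i2.const_mul _) (i3.const_mul _)]
    refine setIntegral_congr_fun hB fun z hz => ?_
    rw [increment_eq hv, neg_sub]
  have a1 : jumpLaw (v i) (Set.Ici x ∩ (fun y => y - x) ⁻¹' B) =
      ENNReal.ofReal (∫ z in B, v i (z + x)) := by
    have hE : MeasurableSet ((fun y => y - x) ⁻¹' B) := hB.preimage (by fun_prop)
    have hsub : Set.Ici x ∩ (fun y => y - x) ⁻¹' B = (fun y => y - x) ⁻¹' B :=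
      Set.inter_eq_right.2 fun y hy => sub_nonneg.1 (Set.mem_Ici.1 (hB0 hy))
    rw [hsub, jumpLaw_apply (hv i) hE, ← integral_indicator hE, ← integral_indicator hB,
      ← integral_add_right_eq_self (((fun y => y - x) ⁻¹' B).indicator (v i)) x]
    refine congrArg _ (integral_congr_ae (Eventually.of_forall fun z => ?_))
    by_cases hz : z ∈ B <;> simp [hz]
  have a2 : jumpLaw (v i) (Set.Iio x ∩ (fun y => x - y) ⁻¹' B) =
      ENNReal.ofReal (∫ z in B, v i (x - z)) := by
    have hE : MeasurableSet ((fun y => x - y) ⁻¹' B) := hB.preimage (by fun_prop)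
    have hsub : Set.Iic x ∩ (fun y => x - y) ⁻¹' B = (fun y => x - y) ⁻¹' B :=
      Set.inter_eq_right.2 fun y hy => sub_nonneg.1 (Set.mem_Ici.1 (hB0 hy))
    -- The jump of size exactly x is null, so counting it with the crossings does no harm.
    have hae : (Set.Iio x ∩ (fun y => x - y) ⁻¹' B : Set ℝ) =ᵐ[volume]
        (Set.Iic x ∩ (fun y => x - y) ⁻¹' B : Set ℝ) := Iio_ae_eq_Iic.inter (ae_eq_refl _)
    rw [jumpLaw_apply (hv i) (measurableSet_Iio.inter hE), setIntegral_congr_set hae, hsub,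
      ← integral_indicator hE, ← integral_indicator hB,
        ← integral_sub_left_eq_self (((fun y => x - y) ⁻¹' B).indicator (v i)) volume x]
    refine congrArg _ (integral_congr_ae (Eventually.of_forall fun z => ?_))
    by_cases hz : z ∈ B <;> simp [hz]
  have a3 : jumpLaw (v i) ((fun y => x + y) ⁻¹' B) = ENNReal.ofReal (∫ z in B, v i (z - x)) := by
    have hE : MeasurableSet ((fun y => x + y) ⁻¹' B) := hB.preimage (by fun_prop)
    rw [jumpLaw_apply (hv i) hE, ← integral_indicator hE, ← integral_indicator hB,
      ← integral_sub_right_eq_self (((fun y => x + y) ⁻¹' B).indicator (v i)) x]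
    refine congrArg _ (integral_congr_ae (Eventually.of_forall fun z => ?_))
    by_cases hz : z ∈ B <;> simp [hz]
  have n1 : 0 ≤ ∫ z in B, v i (z + x) := integral_nonneg fun z => hs i _
  have n2 : 0 ≤ ∫ z in B, v i (x - z) := integral_nonneg fun z => hs i _
  have n3 : 0 ≤ ∫ z in B, v i (z - x) := integral_nonneg fun z => hs i _
  have hχ := (chi_pos one i).le
  have hχ' := sub_nonneg.2 (chi_le_one one i)
  rw [← lintegral_indicator_one hset, lintegral_stepMeasure P one v
    (measurable_one.indicator hset)]
  have ind : ∀ z k, (B ×ˢ ({j} : Set S)).indicator (1 : ℝ × S → ENNReal) (z, k) =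
      if k = j then B.indicator 1 z else 0 := by
    intro z k
    by_cases hz : z ∈ B <;> by_cases hk : k = j <;> simp [hz, hk]
  have b1 : ∀ k, ∫⁻ y in Set.Ici x, (if k = j then B.indicator 1 (y - x) else 0) ∂jumpLaw (v i) =
      if k = j then ENNReal.ofReal (∫ z in B, v i (z + x)) else 0 := by
    intro k
    split_ifs
    · rw [← a1, Set.inter_comm, ← Measure.restrict_apply (hB.preimage (by fun_prop)),
        ← lintegral_indicator_one (hB.preimage (by fun_prop))]
      rfl
    · simp
  have b2 : ∫⁻ y in Set.Iio x, (if i = j then B.indicator 1 (x - y) else 0) ∂jumpLaw (v i) =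
      if i = j then ENNReal.ofReal (∫ z in B, v i (x - z)) else 0 := by
    split_ifs
    · rw [← a2, Set.inter_comm, ← Measure.restrict_apply (hB.preimage (by fun_prop)),
        ← lintegral_indicator_one (hB.preimage (by fun_prop))]
      rfl
    · simp
  have b3 : ∫⁻ y, (if i = j then B.indicator 1 (x + y) else 0) ∂jumpLaw (v i) =
      if i = j then ENNReal.ofReal (∫ z in B, v i (z - x)) else 0 := by
    split_ifs
    · rw [← a3, ← lintegral_indicator_one (hB.preimage (by fun_prop))]
      rfl
    · simp
  simp only [ind, b1, b2, b3, mul_ite, mul_zero, Finset.sum_ite_eq', Finset.mem_univ, if_true]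
  unfold stepProb
  rw [e1, e2]
  have hPij := hP i j
  split_ifs
  · rw [ENNReal.ofReal_add (by positivity) (by positivity), ENNReal.ofReal_add (by positivity)
      (by positivity), ENNReal.ofReal_mul hPij, ENNReal.ofReal_mul hχ, ENNReal.ofReal_mul hχ,
      ENNReal.ofReal_mul hχ']
    ring
  · rw [add_zero, zero_add, add_zero, ENNReal.ofReal_mul hPij, ENNReal.ofReal_mul hχ]
    ring

lemma stepMeasure_Iio (P : Matrix S S ℝ) (one : Finset S) {α c : S → ℝ} {v : S → ℝ → ℝ}
    (hv : ∀ k, HeavyTailed (α k) (c k) (v k)) {x : ℝ} (hx : 0 ≤ x) (i : S) :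
    stepMeasure P one v x i (Set.Iio (0 : ℝ) ×ˢ (Set.univ : Set S)) = 0 := by
  have hneg : MeasurableSet (Set.Iio (0 : ℝ) ×ˢ (Set.univ : Set S)) :=
    measurableSet_Iio.prod MeasurableSet.univ
  have z3 : jumpLaw (v i) ((fun y => x + y) ⁻¹' Set.Iio 0) = 0 := by
    have hE : MeasurableSet ((fun y => x + y) ⁻¹' Set.Iio (0 : ℝ)) :=
      measurableSet_Iio.preimage (by fun_prop)
    rw [jumpLaw_apply (hv i) hE, setIntegral_eq_zero_of_forall_eq_zero,
      ENNReal.ofReal_zero]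
    intro y hy
    have hy' : x + y < 0 := hy
    exact (hv i).eq_zero (by linarith)
  rw [← lintegral_indicator_one hneg, lintegral_stepMeasure P one v
    (measurable_one.indicator hneg)]
  have ind : ∀ (z : ℝ) (k : S), (Set.Iio (0 : ℝ) ×ˢ (Set.univ : Set S)).indicator
      (1 : ℝ × S → ENNReal) (z, k) = (Set.Iio 0).indicator 1 z := by
    intro z k
    by_cases hz : z < 0 <;> simp [hz]
  simp only [ind]
  have z1 : ∫⁻ y in Set.Iio x, (Set.Iio (0 : ℝ)).indicator 1 (x - y) ∂jumpLaw (v i) =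
      0 := by
    rw [setLIntegral_congr_fun (g := fun _ => 0) measurableSet_Iio, lintegral_zero]
    intro y hy
    have : y < x := hy
    simp [this.le]
  have z2 : ∫⁻ y in Set.Ici x, (Set.Iio (0 : ℝ)).indicator 1 (y - x) ∂jumpLaw (v i) =
      0 := by
    rw [setLIntegral_congr_fun (g := fun _ => 0) measurableSet_Ici, lintegral_zero]
    intro y hy
    have : x ≤ y := hy
    simp [this]
  have z4 : ∫⁻ y, (Set.Iio (0 : ℝ)).indicator 1 (x + y) ∂jumpLaw (v i) = 0 := by
    rw [← z3, ← lintegral_indicator_one (measurableSet_Iio.preimage (by fun_prop))]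
    rfl
  rw [z1, z4]
  simp [z2]

lemma measurable_lintegral_stepMeasure [MeasurableSingletonClass S] (P : Matrix S S ℝ)
    (one : Finset S) (v : S → ℝ → ℝ)
    {f : ℝ × S → ENNReal} (hf : Measurable f) :
    Measurable fun p : ℝ × S => ∫⁻ q, f q ∂stepMeasure P one v p.1 p.2 := by
  refine measurable_from_prod_countable_left fun i => ?_
  have hsf : SFinite (jumpLaw (v i)) := by unfold jumpLaw; infer_instance
  simp only [lintegral_stepMeasure P one v hf]
  have m1 : Measurable fun x => ∫⁻ y in Set.Iio x, f (x - y, i) ∂jumpLaw (v i) := by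
    have : ∀ x, ∫⁻ y in Set.Iio x, f (x - y, i) ∂jumpLaw (v i) =
        ∫⁻ y, {p : ℝ × ℝ | p.2 < p.1}.indicator (fun p => f (p.1 - p.2, i)) (x, y)
          ∂jumpLaw (v i) := by
      intro x
      rw [← lintegral_indicator measurableSet_Iio]
      rfl
    simp only [this]
    refine Measurable.lintegral_prod_right' (f := {p : ℝ × ℝ | p.2 < p.1}.indicator
      (fun p => f (p.1 - p.2, i))) ?_
    exact Measurable.indicator (by fun_prop) (measurableSet_lt measurable_snd measurable_fst)
  have m2 : ∀ j, Measurable fun x => ∫⁻ y in Set.Ici x, f (y - x, j) ∂jumpLaw (v i) := by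
    intro j
    have : ∀ x, ∫⁻ y in Set.Ici x, f (y - x, j) ∂jumpLaw (v i) =
        ∫⁻ y, {p : ℝ × ℝ | p.1 ≤ p.2}.indicator (fun p => f (p.2 - p.1, j)) (x, y)
          ∂jumpLaw (v i) := by
      intro x
      rw [← lintegral_indicator measurableSet_Ici]
      rfl
    simp only [this]
    refine Measurable.lintegral_prod_right' (f := {p : ℝ × ℝ | p.1 ≤ p.2}.indicator
      (fun p => f (p.2 - p.1, j))) ?_
    exact Measurable.indicator (by fun_prop) (measurableSet_le measurable_fst measurable_snd)
  have m3 : Measurable fun x => ∫⁻ y, f (x + y, i) ∂jumpLaw (v i) :=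
    Measurable.lintegral_prod_right' (f := fun p : ℝ × ℝ => f (p.1 + p.2, i)) (by fun_prop)
  exact ((m1.add (Finset.measurable_sum _ fun j _ => (m2 j).const_mul _)).const_mul _).add
    (m3.const_mul _)

/-- Criterion for a nonnegative function not to increase on average in one step. -/
lemma lintegral_stepMeasure_le {P : Matrix S S ℝ} (hP : ∀ i j, 0 ≤ P i j) (one : Finset S)
    {α c : S → ℝ} {v : S → ℝ → ℝ} (hv : ∀ k, HeavyTailed (α k) (c k) (v k))
    {f : ℝ × S → ℝ} (hf : Measurable f) (hf0 : ∀ p, 0 ≤ f p) {x : ℝ} {i : S} {ψ : ℝ → ℝ}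
    (hψ : IntegrableOn (fun y => v i y * ψ y) (Set.Ioi 0))
    (hle : ∀ y, 0 < y → y ≠ x → stepAverage P one f x i y - f (x, i) ≤ ψ y)
    (hneg : ∫ y in Set.Ioi (0 : ℝ), v i y * ψ y ≤ 0) :
    ∫⁻ q, ENNReal.ofReal (f q) ∂stepMeasure P one v x i ≤ ENNReal.ofReal (f (x, i)) := by
  have hm := fun k => (hv k).1.measurable
  have hχ := (chi_pos one i).le
  have hχ' := sub_nonneg.2 (chi_le_one one i)
  have havg : ∀ y, 0 ≤ stepAverage P one f x i y := by
    intro y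
    refine add_nonneg (mul_nonneg hχ ?_) (mul_nonneg hχ' (hf0 _))
    split_ifs
    · exact hf0 _
    · exact Finset.sum_nonneg fun j _ => mul_nonneg (hP i j) (hf0 _)
  have e0 : ∫⁻ q, ENNReal.ofReal (f q) ∂stepMeasure P one v x i =
      ∫⁻ y in Set.Ioi 0, ENNReal.ofReal (v i y * stepAverage P one f x i y) := by
    rw [lintegral_stepMeasure P one v hf.ennreal_ofReal]
    simp only [ENNReal.ofReal_mul ((hv i).1.nonneg _)]
    have h1 : Measurable fun y => ENNReal.ofReal (f (x - y, i)) := by fun_prop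
    have h2 : ∀ j, Measurable fun y => ENNReal.ofReal (f (y - x, j)) := fun j => by fun_prop
    have h3 : Measurable fun y => ENNReal.ofReal (f (x + y, i)) := by fun_prop
    have h4 : Measurable fun y => if y < x then ENNReal.ofReal (f (x - y, i)) else
        ∑ j, ENNReal.ofReal (P i j) * ENNReal.ofReal (f (y - x, j)) :=
      Measurable.ite measurableSet_Iio h1
        (Finset.measurable_sum _ fun j _ => (h2 j).const_mul _)
    have h5 : ∀ y, ENNReal.ofReal (stepAverage P one f x i y) = ENNReal.ofReal (chi one i) *
        (if y < x then ENNReal.ofReal (f (x - y, i)) else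
        ∑ j, ENNReal.ofReal (P i j) * ENNReal.ofReal (f (y - x, j))) +
        ENNReal.ofReal (1 - chi one i) * ENNReal.ofReal (f (x + y, i)) := by
      intro y
      have hsum : 0 ≤ ∑ j, P i j * f (y - x, j) :=
        Finset.sum_nonneg fun j _ => mul_nonneg (hP i j) (hf0 _)
      unfold stepAverage
      rw [ENNReal.ofReal_add (mul_nonneg hχ (by split_ifs; exacts [hf0 _, hsum]))
        (mul_nonneg hχ' (hf0 _)), ENNReal.ofReal_mul hχ, ENNReal.ofReal_mul hχ']
      congr 2
      split_ifs
      · rfl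
      · rw [ENNReal.ofReal_sum_of_nonneg fun j _ => mul_nonneg (hP i j) (hf0 _)]
        simp only [ENNReal.ofReal_mul (hP i _)]
    have h6 : ∫⁻ y, (if y < x then ENNReal.ofReal (f (x - y, i)) else
        ∑ j, ENNReal.ofReal (P i j) * ENNReal.ofReal (f (y - x, j))) ∂jumpLaw (v i) =
        (∫⁻ y in Set.Iio x, ENNReal.ofReal (f (x - y, i)) ∂jumpLaw (v i)) +
        ∑ j, ENNReal.ofReal (P i j) *
          ∫⁻ y in Set.Ici x, ENNReal.ofReal (f (y - x, j)) ∂jumpLaw (v i) := by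
      rw [← lintegral_add_compl _ (measurableSet_Iio (a := x)), Set.compl_Iio]
      congr 1
      · exact setLIntegral_congr_fun measurableSet_Iio fun y hy =>
          if_pos (show y < x from hy)
      · rw [setLIntegral_congr_fun (g := fun y => ∑ j, ENNReal.ofReal (P i j) *
          ENNReal.ofReal (f (y - x, j))) measurableSet_Ici fun y hy => if_neg (not_lt.2 hy),
          lintegral_finsetSum _ fun j _ => (h2 j).const_mul _]
        exact Finset.sum_congr rfl fun j _ => lintegral_const_mul _ (h2 j)
    simp only [h5]
    rw [← lintegral_jumpLaw (hm i) (g := fun y => ENNReal.ofReal (chi one i) *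
        (if y < x then ENNReal.ofReal (f (x - y, i)) else
        ∑ j, ENNReal.ofReal (P i j) * ENNReal.ofReal (f (y - x, j))) +
        ENNReal.ofReal (1 - chi one i) * ENNReal.ofReal (f (x + y, i)))
        ((h4.const_mul _).add (h3.const_mul _)),
      lintegral_add_left (h4.const_mul _), lintegral_const_mul _ h4, lintegral_const_mul _ h3, h6]
  have hvi : IntegrableOn (fun y => v i y * f (x, i)) (Set.Ioi 0) :=
    ((hv i).1.integrable.mul_const _).integrableOn
  -- The bound may fail at y = x, where logarithmic profiles are singular; this point is null.
  have hae : ∀ᵐ y ∂volume.restrict (Set.Ioi (0 : ℝ)),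
      v i y * stepAverage P one f x i y ≤ v i y * f (x, i) + v i y * ψ y := by
    refine (ae_restrict_iff' measurableSet_Ioi).2 ?_
    filter_upwards [compl_mem_ae_iff.2 (measure_singleton (μ := volume) x)] with y hy hy0
    rw [← mul_add]
    exact mul_le_mul_of_nonneg_left (by linarith [hle y hy0 hy]) ((hv i).1.nonneg y)
  have htot : ∫ y in Set.Ioi (0 : ℝ), v i y = 1 := by
    rw [← (hv i).1.integral_eq_one]
    refine setIntegral_eq_integral_of_forall_compl_eq_zero fun y hy => ?_
    exact (hv i).eq_zero (not_lt.1 hy)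
  rw [e0]
  calc ∫⁻ y in Set.Ioi 0, ENNReal.ofReal (v i y * stepAverage P one f x i y)
      ≤ ∫⁻ y in Set.Ioi 0, ENNReal.ofReal (v i y * f (x, i) + v i y * ψ y) := by
        refine lintegral_mono_ae ?_
        filter_upwards [hae] with y hy using ENNReal.ofReal_le_ofReal hy
    _ = ENNReal.ofReal (∫ y in Set.Ioi 0, (v i y * f (x, i) + v i y * ψ y)) := by
        refine (ofReal_integral_eq_lintegral_ofReal
          (f := fun y => v i y * f (x, i) + v i y * ψ y) (hvi.add hψ) ?_).symm
        filter_upwards [hae] with y hy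
        exact (mul_nonneg ((hv i).1.nonneg y) (havg y)).trans hy
    _ ≤ _ := by
        refine ENNReal.ofReal_le_ofReal ?_
        rw [integral_add hvi hψ, integral_mul_const, htot]
        linarith

end Step

/-! ### The Markov property in integrated form -/

section Walk

variable {Ω S : Type*} [MeasurableSpace S]

lemma history_mono (X : ℕ → Ω → ℝ) (ξ : ℕ → Ω → S) : Monotone (history X ξ) := fun _ _ hnm =>
  biSup_mono fun _ hk => hk.trans hnm

lemma measurable_history (X : ℕ → Ω → ℝ) (ξ : ℕ → Ω → S) {m n : ℕ} (hmn : m ≤ n) :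
    Measurable[history X ξ n] fun ω => (X m ω, ξ m ω) :=
  Measurable.mono (comap_measurable _) (le_iSup₂_of_le m hmn le_rfl) le_rfl

lemma measurable_history_fst (X : ℕ → Ω → ℝ) (ξ : ℕ → Ω → S) {m n : ℕ} (hmn : m ≤ n) :
    Measurable[history X ξ n] (X m) :=
  measurable_fst.comp (measurable_history X ξ hmn)

variable [MeasurableSpace Ω] [DecidableEq S]

lemma IsWalk.history_le {P : Matrix S S ℝ} {w : S → ℝ → ℝ} {Pr : Measure Ω} {X : ℕ → Ω → ℝ}
    {ξ : ℕ → Ω → S} (h : IsWalk P w Pr X ξ) (n : ℕ) :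
    history X ξ n ≤ (inferInstance : MeasurableSpace Ω) :=
  iSup₂_le fun m _ => ((h.measurable_fst m).prodMk (h.measurable_snd m)).comap_le

lemma IsWalk.measurable_pair {P : Matrix S S ℝ} {w : S → ℝ → ℝ} {Pr : Measure Ω}
    {X : ℕ → Ω → ℝ} {ξ : ℕ → Ω → S} (h : IsWalk P w Pr X ξ) (n : ℕ) :
    Measurable fun ω => (X n ω, ξ n ω) :=
  (h.measurable_fst n).prodMk (h.measurable_snd n)

variable [Fintype S] [MeasurableSingletonClass S]

lemma measurable_stepMeasure (P : Matrix S S ℝ) (one : Finset S) (v : S → ℝ → ℝ) :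
    Measurable fun p : ℝ × S => stepMeasure P one v p.1 p.2 := by
  refine Measure.measurable_of_measurable_coe _ fun s hs => ?_
  have := measurable_lintegral_stepMeasure P one v (f := s.indicator 1)
    (measurable_one.indicator hs)
  simpa only [lintegral_indicator_one hs] using this

lemma IsWalk.measurable_stepMeasure {Q : Matrix S S ℝ} {w : S → ℝ → ℝ} {Pr : Measure Ω}
    {X : ℕ → Ω → ℝ} {ξ : ℕ → Ω → S} (h : IsWalk Q w Pr X ξ) (P : Matrix S S ℝ) (one : Finset S)
    (v : S → ℝ → ℝ) (n : ℕ) :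
    Measurable fun ω => stepMeasure P one v (X n ω) (ξ n ω) := by
  have h1 := HalfLineWalk.measurable_stepMeasure P one v
  have h2 := h.measurable_pair n
  have h3 := h1.comp h2
  simpa only [Function.comp_def] using h3

/-- The defining property of conditional expectation, integrated over a past event A, turns the
transition hypothesis into an equality of measures. -/
lemma IsWalk.map_prod_singleton_of_subset {P : Matrix S S ℝ} (hP : ∀ i j, 0 ≤ P i j) {one : Finset S}
    {α c : S → ℝ} {v : S → ℝ → ℝ} (hv : ∀ k, HeavyTailed (α k) (c k) (v k))
    {Pr : Measure Ω} [IsProbabilityMeasure Pr] {X : ℕ → Ω → ℝ} {ξ : ℕ → Ω → S}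
    (h : IsWalk P (increment one v) Pr X ξ) (n : ℕ) {A : Set Ω}
    (hA : MeasurableSet[history X ξ n] A)
    {B : Set ℝ} (hB : MeasurableSet B) (hB0 : B ⊆ Set.Ici 0) (j : S) :
    (Pr.restrict A).map (fun ω => (X (n + 1) ω, ξ (n + 1) ω)) (B ×ˢ {j}) =
      (Pr.restrict A).bind (fun ω => stepMeasure P one v (X n ω) (ξ n ω)) (B ×ˢ {j}) := by
  have hXm := h.measurable_pair
  have hKω := h.measurable_stepMeasure P one v n
  have hset : MeasurableSet (B ×ˢ ({j} : Set S)) := hB.prod (measurableSet_singleton j)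
  have hE : MeasurableSet {ω | X (n + 1) ω ∈ B ∧ ξ (n + 1) ω = j} := hXm (n + 1) hset
  rw [Measure.map_apply (hXm _) hset, Measure.bind_apply hset hKω.aemeasurable]
  simp only [stepMeasure_prod_singleton hP one hv (h.nonneg n _) _ hB hB0 j]
  have htr := h.transition n B j hB hB0
  have hint : Integrable (fun ω => stepProb P (increment one v) (X n ω) (ξ n ω) B j) Pr :=
    integrable_condExp.congr htr
  have hpos : 0 ≤ᵐ[Pr] fun ω => stepProb P (increment one v) (X n ω) (ξ n ω) B j := by
    filter_upwards [htr, condExp_nonneg (μ := Pr) (m := history X ξ n) (f :=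
      {ω | X (n + 1) ω ∈ B ∧ ξ (n + 1) ω = j}.indicator fun _ => (1 : ℝ))
      (Eventually.of_forall fun ω => Set.indicator_nonneg (fun _ _ => zero_le_one) ω)]
      with ω h1 h2
    rw [← h1]; exact h2
  rw [← ofReal_integral_eq_lintegral_ofReal hint.integrableOn (ae_restrict_of_ae hpos),
    ← integral_congr_ae (ae_restrict_of_ae htr), setIntegral_condExp (h.history_le n)
    ((integrable_const (1 : ℝ)).indicator hE) hA, integral_indicator hE, setIntegral_const,
    smul_eq_mul,
    mul_one, measureReal_restrict_apply hE, Measure.restrict_apply (hXm _ hset),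
    ofReal_measureReal]
  rfl

/-- The restriction to subsets of [0, ∞) is removed because neither side charges the negative
half-line. -/
lemma IsWalk.map_prod_singleton {P : Matrix S S ℝ} (hP : ∀ i j, 0 ≤ P i j) {one : Finset S}
    {α c : S → ℝ} {v : S → ℝ → ℝ} (hv : ∀ k, HeavyTailed (α k) (c k) (v k))
    {Pr : Measure Ω} [IsProbabilityMeasure Pr] {X : ℕ → Ω → ℝ} {ξ : ℕ → Ω → S}
    (h : IsWalk P (increment one v) Pr X ξ) (n : ℕ) {A : Set Ω}
    (hA : MeasurableSet[history X ξ n] A)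
    {B : Set ℝ} (hB : MeasurableSet B) (j : S) :
    (Pr.restrict A).map (fun ω => (X (n + 1) ω, ξ (n + 1) ω)) (B ×ˢ {j}) =
      (Pr.restrict A).bind (fun ω => stepMeasure P one v (X n ω) (ξ n ω)) (B ×ˢ {j}) := by
  have hXm := h.measurable_pair
  have hKω := h.measurable_stepMeasure P one v n
  have hset : MeasurableSet (B ×ˢ ({j} : Set S)) := hB.prod (measurableSet_singleton j)
  have hset' : MeasurableSet ((B ∩ Set.Ici 0) ×ˢ ({j} : Set S)) :=
    (hB.inter measurableSet_Ici).prod (measurableSet_singleton j)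
  have hneg : MeasurableSet (Set.Iio (0 : ℝ) ×ˢ (Set.univ : Set S)) :=
    measurableSet_Iio.prod MeasurableSet.univ
  have := h.map_prod_singleton_of_subset hP hv n hA (hB.inter measurableSet_Ici)
    Set.inter_subset_right j
  have l1 : (Pr.restrict A).map (fun ω => (X (n + 1) ω, ξ (n + 1) ω)) (B ×ˢ {j}) =
      (Pr.restrict A).map (fun ω => (X (n + 1) ω, ξ (n + 1) ω)) ((B ∩ Set.Ici 0) ×ˢ {j}) := by
    rw [Measure.map_apply (hXm _) hset, Measure.map_apply (hXm _) hset']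
    congr 1
    ext ω
    simp [h.nonneg]
  have l2 : ∀ x i, 0 ≤ x → stepMeasure P one v x i (B ×ˢ {j}) =
      stepMeasure P one v x i ((B ∩ Set.Ici 0) ×ˢ {j}) := by
    intro x i hx
    refine measure_congr (Filter.eventuallyEq_set.2 ?_)
    have hz := stepMeasure_Iio P one hv hx i
    have hae : ∀ᵐ p ∂stepMeasure P one v x i,
        p ∉ (Set.Iio (0 : ℝ) ×ˢ (Set.univ : Set S)) := by
      rw [ae_iff]
      simpa only [not_not, Set.ofPred_mem_eq] using hz
    filter_upwards [hae] with p hp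
    have : 0 ≤ p.1 := by simpa using hp
    simp [this]
  rw [l1, this, Measure.bind_apply hset' hKω.aemeasurable,
    Measure.bind_apply hset hKω.aemeasurable]
  simp only [l2 _ _ (h.nonneg n _)]

lemma IsWalk.map_eq_bind {P : Matrix S S ℝ} (hP : ∀ i j, 0 ≤ P i j) {one : Finset S}
    {α c : S → ℝ} {v : S → ℝ → ℝ} (hv : ∀ k, HeavyTailed (α k) (c k) (v k))
    {Pr : Measure Ω} [IsProbabilityMeasure Pr] {X : ℕ → Ω → ℝ} {ξ : ℕ → Ω → S}
    (h : IsWalk P (increment one v) Pr X ξ) (n : ℕ) {A : Set Ω}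
    (hA : MeasurableSet[history X ξ n] A) :
    (Pr.restrict A).map (fun ω => (X (n + 1) ω, ξ (n + 1) ω)) =
      (Pr.restrict A).bind fun ω => stepMeasure P one v (X n ω) (ξ n ω) := by
  refine Measure.ext fun s hs => ?_
  -- As S is finite with measurable points, every measurable set is a countable disjoint union of
  -- slices B j × {j}.
  obtain ⟨B, hB, rfl⟩ : ∃ B : S → Set ℝ, (∀ j, MeasurableSet (B j)) ∧
      s = ⋃ j, B j ×ˢ ({j} : Set S) := by
    refine ⟨fun j => (fun z => (z, j)) ⁻¹' s, fun j => hs.preimage (by fun_prop), ?_⟩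
    ext ⟨z, k⟩
    simp
  have hdisj : Pairwise (Function.onFun Disjoint
      fun j : S => B j ×ˢ ({j} : Set S)) := by
    intro j k hjk
    refine Set.disjoint_left.2 ?_
    rintro ⟨z, l⟩ h1 h2
    exact hjk (h1.2.symm.trans h2.2)
  rw [measure_iUnion hdisj fun j => (hB j).prod (measurableSet_singleton j),
    measure_iUnion hdisj fun j => (hB j).prod (measurableSet_singleton j)]
  exact tsum_congr fun j => h.map_prod_singleton hP hv n hA (hB j) j

/-- The Markov property, integrated over an event of the past. -/
lemma IsWalk.setLIntegral_succ {P : Matrix S S ℝ} (hP : ∀ i j, 0 ≤ P i j) {one : Finset S}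
    {α c : S → ℝ} {v : S → ℝ → ℝ} (hv : ∀ k, HeavyTailed (α k) (c k) (v k))
    {Pr : Measure Ω} [IsProbabilityMeasure Pr] {X : ℕ → Ω → ℝ} {ξ : ℕ → Ω → S}
    (h : IsWalk P (increment one v) Pr X ξ) (n : ℕ) {A : Set Ω}
    (hA : MeasurableSet[history X ξ n] A)
    {f : ℝ × S → ENNReal} (hf : Measurable f) :
    ∫⁻ ω in A, f (X (n + 1) ω, ξ (n + 1) ω) ∂Pr =
      ∫⁻ ω in A, ∫⁻ q, f q ∂stepMeasure P one v (X n ω) (ξ n ω) ∂Pr := by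
  rw [← lintegral_map hf (h.measurable_pair _), h.map_eq_bind hP hv n hA,
    Measure.lintegral_bind (h.measurable_stepMeasure P one v n).aemeasurable hf.aemeasurable]

end Walk

/-! ### Foster–Lyapunov criteria -/

section Recurrence

variable {Ω S : Type*} [MeasurableSpace Ω] [Fintype S] [DecidableEq S] [MeasurableSpace S]
  [MeasurableSingletonClass S] {P : Matrix S S ℝ} {one : Finset S} {α c : S → ℝ} {v : S → ℝ → ℝ}
  {Pr : Measure Ω} [IsProbabilityMeasure Pr] {X : ℕ → Ω → ℝ} {ξ : ℕ → Ω → S}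

lemma IsWalk.setLIntegral_succ_le (hP : ∀ i j, 0 ≤ P i j)
    (hv : ∀ k, HeavyTailed (α k) (c k) (v k)) (h : IsWalk P (increment one v) Pr X ξ)
    {f : ℝ × S → ENNReal} (hf : Measurable f) {a : ℝ}
    (hdrift : ∀ x i, a < x → ∫⁻ q, f q ∂stepMeasure P one v x i ≤ f (x, i)) (n : ℕ) {B : Set Ω}
    (hB : MeasurableSet[history X ξ n] B) (hBa : ∀ ω ∈ B, a < X n ω) :
    ∫⁻ ω in B, f (X (n + 1) ω, ξ (n + 1) ω) ∂Pr ≤ ∫⁻ ω in B, f (X n ω, ξ n ω) ∂Pr := by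
  rw [h.setLIntegral_succ hP hv n hB hf]
  exact setLIntegral_mono' (h.history_le n _ hB) fun ω hω => hdrift _ _ (hBa ω hω)

/-- The event that the walk stays above `a` at the times `N, …, N + n`. -/
def stayAbove (X : ℕ → Ω → ℝ) (a : ℝ) (N n : ℕ) : Set Ω :=
  {ω | ∀ k, N ≤ k → k ≤ N + n → a < X k ω}

omit [MeasurableSpace Ω] in
lemma stayAbove_succ (X : ℕ → Ω → ℝ) (a : ℝ) (N n : ℕ) :
    stayAbove X a N (n + 1) = stayAbove X a N n ∩ {ω | a < X (N + n + 1) ω} := by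
  ext ω
  constructor
  · intro hω
    exact ⟨fun k hk hk' => hω k hk (by omega), hω _ (by omega) (by omega)⟩
  · rintro ⟨h1, h2⟩ k hk hk'
    rcases Nat.lt_or_ge k (N + n + 1) with hlt | hge
    · exact h1 k hk (by omega)
    · obtain rfl : k = N + n + 1 := by omega
      exact h2

omit [MeasurableSpace Ω] [Fintype S] [DecidableEq S] [MeasurableSingletonClass S] in
lemma measurableSet_stayAbove (X : ℕ → Ω → ℝ) (ξ : ℕ → Ω → S) (a : ℝ) (N n : ℕ) :
    MeasurableSet[history X ξ (N + n)] (stayAbove X a N n) := by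
  have : stayAbove X a N n = ⋂ k ∈ Finset.Icc N (N + n), {ω | a < X k ω} := by
    ext ω
    simp [stayAbove]
  rw [this]
  exact Finset.measurableSet_biInter _ fun k hk =>
    measurable_history_fst X ξ (Finset.mem_Icc.1 hk).2 measurableSet_Ioi

/-- A nonnegative function that does not increase on average far out and tends to infinity
prevents the walk from tending to infinity. -/
lemma IsWalk.ae_not_tendsto_atTop (hP : ∀ i j, 0 ≤ P i j)
    (hv : ∀ k, HeavyTailed (α k) (c k) (v k)) (h : IsWalk P (increment one v) Pr X ξ)
    {f : ℝ × S → ENNReal} (hf : Measurable f) (hfin : ∀ p, f p ≠ ⊤) {a : ℝ}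
    (hdrift : ∀ x i, a < x → ∫⁻ q, f q ∂stepMeasure P one v x i ≤ f (x, i))
    (htop : ∀ i, Tendsto (fun x => f (x, i)) atTop (𝓝 ⊤)) :
    ∀ᵐ ω ∂Pr, ¬ Tendsto (fun n => X n ω) atTop atTop := by
  have hfm : ∀ n, Measurable fun ω => f (X n ω, ξ n ω) := fun n => hf.comp (h.measurable_pair n)
  have key : ∀ N m : ℕ, ∀ᵐ ω ∂Pr, (f (X N ω, ξ N ω) ≤ m ∧ ∀ k, N ≤ k → a < X k ω) →
      liminf (fun n => f (X (N + n) ω, ξ (N + n) ω)) atTop < ⊤ := by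
    intro N m
    -- No integrability of f at the initial time is known; localizing to f ≤ m at time N replaces
    -- it.
    set A : Set Ω := {ω | f (X N ω, ξ N ω) ≤ m} with hAdef
    have hA : MeasurableSet[history X ξ N] A :=
      (hf.comp (measurable_history X ξ le_rfl)) measurableSet_Iic
    have hAB : ∀ n, MeasurableSet[history X ξ (N + n)] (A ∩ stayAbove X a N n) := fun n =>
      (history_mono X ξ (Nat.le_add_right N n) _ hA).inter (measurableSet_stayAbove X ξ a N n)
    have hbound : ∀ n, ∫⁻ ω in A ∩ stayAbove X a N n, f (X (N + n) ω, ξ (N + n) ω) ∂Pr ≤ m := by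
      intro n
      induction n with
      | zero =>
        calc _ ≤ ∫⁻ ω in A ∩ stayAbove X a N 0, (m : ENNReal) ∂Pr :=
              setLIntegral_mono' (h.history_le _ _ (hAB 0)) fun ω hω => hω.1
          _ = m * Pr (A ∩ stayAbove X a N 0) := setLIntegral_const _ _
          _ ≤ m := mul_le_of_le_one_right' prob_le_one
      | succ n ih =>
        refine le_trans (lintegral_mono_set ?_) ((h.setLIntegral_succ_le hP hv hf hdrift (N + n)
          (hAB n) fun ω hω => hω.2 _ (by omega) le_rfl).trans ih)
        rw [stayAbove_succ]
        exact Set.inter_subset_inter_right _ Set.inter_subset_left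
    set B : Set Ω := ⋂ n, A ∩ stayAbove X a N n with hBdef
    have hB : MeasurableSet B := MeasurableSet.iInter fun n => h.history_le _ _ (hAB n)
    -- By Fatou, f along the walk has finite lower limit almost surely on the event of staying above
    -- a forever, which is incompatible with X → ∞.
    have hfatou : ∫⁻ ω in B, liminf (fun n => f (X (N + n) ω, ξ (N + n) ω)) atTop ∂Pr ≤ m := by
      refine (lintegral_liminf_le fun n => hfm (N + n)).trans ?_
      refine (liminf_le_liminf (v := fun _ => (m : ENNReal)) (Eventually.of_forall fun n =>
        (lintegral_mono_set (Set.iInter_subset _ n)).trans (hbound n))).trans ?_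
      simp
    have hae := ae_lt_top (Measurable.liminf fun n => hfm (N + n))
      (hfatou.trans_lt (ENNReal.natCast_lt_top m)).ne
    rw [ae_restrict_iff' hB] at hae
    filter_upwards [hae] with ω hω hω'
    exact hω (Set.mem_iInter.2 fun n => ⟨hω'.1, fun k hk _ => hω'.2 k hk⟩)
  have key' : ∀ᵐ ω ∂Pr, ∀ N m : ℕ, (f (X N ω, ξ N ω) ≤ m ∧ ∀ k, N ≤ k → a < X k ω) →
      liminf (fun n => f (X (N + n) ω, ξ (N + n) ω)) atTop < ⊤ :=
    ae_all_iff.2 fun N => ae_all_iff.2 fun m => key N m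
  filter_upwards [key'] with ω hω ht
  obtain ⟨N, hN⟩ := eventually_atTop.1 (ht.eventually_gt_atTop a)
  obtain ⟨m, hm⟩ := ENNReal.exists_nat_gt (hfin (X N ω, ξ N ω))
  have hlim : Tendsto (fun n => f (X (N + n) ω, ξ (N + n) ω)) atTop (𝓝 ⊤) := by
    rw [ENNReal.tendsto_nhds_top_iff_nat]
    intro M
    have h1 : ∀ᶠ x in atTop, ∀ i, (M : ENNReal) < f (x, i) :=
      eventually_all.2 fun i => ENNReal.tendsto_nhds_top_iff_nat.1 (htop i) M
    have h2 : Tendsto (fun n => X (N + n) ω) atTop atTop :=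
      ht.comp (tendsto_atTop_mono (fun n => Nat.le_add_left n N) tendsto_id)
    filter_upwards [h2.eventually h1] with n hn using hn _
  have := hω N m ⟨hm.le, hN⟩
  rw [hlim.liminf_eq] at this
  exact lt_irrefl _ this

/-- A maximal inequality: the process f (X, ξ), stopped on entering [0, a], is a supermartingale
from time N, and f is at least m at the moment of entry. -/
lemma IsWalk.mul_measure_hit_le (hP : ∀ i j, 0 ≤ P i j)
    (hv : ∀ k, HeavyTailed (α k) (c k) (v k)) (h : IsWalk P (increment one v) Pr X ξ)
    {f : ℝ × S → ENNReal} (hf : Measurable f) {a : ℝ}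
    (hdrift : ∀ x i, a < x → ∫⁻ q, f q ∂stepMeasure P one v x i ≤ f (x, i)) {m : ENNReal}
    (hm : ∀ x i, 0 ≤ x → x ≤ a → m ≤ f (x, i)) (N : ℕ) {A : Set Ω}
    (hA : MeasurableSet[history X ξ N] A) :
    m * Pr (A ∩ {ω | ∃ k, N ≤ k ∧ X k ω ≤ a}) ≤ ∫⁻ ω in A, f (X N ω, ξ N ω) ∂Pr := by
  set B : ℕ → Set Ω := fun n => A ∩ stayAbove X a N n with hBdef
  have hAm : MeasurableSet A := h.history_le _ _ hA
  have hBh : ∀ n, MeasurableSet[history X ξ (N + n)] (B n) := fun n =>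
      (history_mono X ξ (Nat.le_add_right N n) _ hA).inter (measurableSet_stayAbove X ξ a N n)
  have hB : ∀ n, MeasurableSet (B n) := fun n => h.history_le _ _ (hBh n)
  have hsucc : ∀ n, B (n + 1) ⊆ B n := by
    intro n
    simp only [hBdef, stayAbove_succ]
    exact Set.inter_subset_inter_right _ Set.inter_subset_left
  have hlow : ∀ n (E : Set Ω), MeasurableSet E → (∀ ω ∈ E, X n ω ≤ a) →
      m * Pr E ≤ ∫⁻ ω in E, f (X n ω, ξ n ω) ∂Pr := by
    intro n E hE hEa
    rw [← setLIntegral_const]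
    exact setLIntegral_mono' hE fun ω hω => hm _ _ (h.nonneg n ω) (hEa ω hω)
  have hsplit : ∀ (n : ℕ) (D E : Set Ω), MeasurableSet D → E ⊆ D → MeasurableSet E →
      ∫⁻ ω in D, f (X n ω, ξ n ω) ∂Pr =
      (∫⁻ ω in E, f (X n ω, ξ n ω) ∂Pr) + ∫⁻ ω in D \ E, f (X n ω, ξ n ω) ∂Pr := by
    intro n D E hD hED hE
    rw [← lintegral_union (hD.diff hE) Set.disjoint_sdiff_right, Set.union_sdiff_cancel hED]
  -- The stopped mean splits into the paths still above a and those already stopped, each of the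
  -- latter weighing at least m.
  have hu : ∀ n, (∫⁻ ω in B n, f (X (N + n) ω, ξ (N + n) ω) ∂Pr) + m * Pr (A \ B n) ≤
      ∫⁻ ω in A, f (X N ω, ξ N ω) ∂Pr := by
    intro n
    induction n with
    | zero =>
      rw [hsplit N A (B 0) hAm Set.inter_subset_left (hB 0)]
      refine add_le_add le_rfl (hlow N _ (hAm.diff (hB 0)) fun ω hω => ?_)
      by_contra hcon
      refine hω.2 ⟨hω.1, fun k hk hk' => ?_⟩
      obtain rfl : k = N := by omega
      exact not_le.1 hcon
    | succ n ih =>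
      refine le_trans ?_ ih
      have h1 := h.setLIntegral_succ_le hP hv hf hdrift (N + n) (hBh n)
        fun ω hω => hω.2 _ (by omega) le_rfl
      rw [hsplit (N + n + 1) (B n) (B (n + 1)) (hB n) (hsucc n) (hB (n + 1))] at h1
      have h2 := hlow (N + n + 1) (B n \ B (n + 1)) ((hB n).diff (hB (n + 1))) (by
        intro ω hω
        by_contra hcon
        refine hω.2 ?_
        simp only [hBdef, stayAbove_succ]
        exact ⟨hω.1.1, hω.1.2, not_le.1 hcon⟩)
      have h3 : Pr (A \ B (n + 1)) ≤ Pr (A \ B n) + Pr (B n \ B (n + 1)) := by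
        refine (measure_mono ?_).trans (measure_union_le _ _)
        intro ω hω
        by_cases hωB : ω ∈ B n
        · exact Or.inr ⟨hωB, hω.2⟩
        · exact Or.inl ⟨hω.1, hωB⟩
      calc _ ≤ (∫⁻ ω in B (n + 1), f (X (N + n + 1) ω, ξ (N + n + 1) ω) ∂Pr) +
            m * (Pr (A \ B n) + Pr (B n \ B (n + 1))) := by gcongr; rfl
        _ = ((∫⁻ ω in B (n + 1), f (X (N + n + 1) ω, ξ (N + n + 1) ω) ∂Pr) +
            m * Pr (B n \ B (n + 1))) + m * Pr (A \ B n) := by ring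
        _ ≤ _ := by
          gcongr
          exact (add_le_add le_rfl h2).trans h1
  have hU : A ∩ {ω | ∃ k, N ≤ k ∧ X k ω ≤ a} ⊆ ⋃ n, A \ B n := by
    rintro ω ⟨hωA, k, hk, hka⟩
    refine Set.mem_iUnion.2 ⟨k - N, hωA, fun hω => ?_⟩
    exact absurd (hω.2 k hk (by omega)) (not_lt.2 hka)
  have hmono : Monotone fun n => A \ B n :=
    monotone_nat_of_le_succ fun n => Set.sdiff_subset_sdiff_right (hsucc n)
  calc _ ≤ m * Pr (⋃ n, A \ B n) := by gcongr
    _ = ⨆ n, m * Pr (A \ B n) := by rw [hmono.measure_iUnion, ENNReal.mul_iSup]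
    _ ≤ _ := iSup_le fun n => le_trans (le_add_left le_rfl) (hu n)

/-- A positive function that does not increase on average far out and tends to zero makes the
walk, once it is known to be unbounded, leave every bounded set. -/
lemma IsWalk.ae_eventually_gt (hP : ∀ i j, 0 ≤ P i j)
    (hv : ∀ k, HeavyTailed (α k) (c k) (v k)) (h : IsWalk P (increment one v) Pr X ξ)
    {f : ℝ × S → ENNReal} (hf : Measurable f) {a : ℝ}
    (hdrift : ∀ x i, a < x → ∫⁻ q, f q ∂stepMeasure P one v x i ≤ f (x, i)) {m : ENNReal}
    (hm0 : m ≠ 0) (hm : ∀ x i, 0 ≤ x → x ≤ a → m ≤ f (x, i))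
    (hzero : ∀ i, Tendsto (fun x => f (x, i)) atTop (𝓝 0)) :
    ∀ᵐ ω ∂Pr, (∀ R : ℝ, ∃ n, R < X n ω) → ∀ᶠ n in atTop, a < X n ω := by
  rw [ae_iff]
  set E : Set Ω := {ω | ¬((∀ R : ℝ, ∃ n, R < X n ω) → ∀ᶠ n in atTop, a < X n ω)} with hE
  have key : ∀ η : ENNReal, 0 < η → m * Pr E ≤ η := by
    intro η hη
    have h1 : ∀ᶠ x in atTop, ∀ i, f (x, i) < η :=
      eventually_all.2 fun i => (tendsto_order.1 (hzero i)).2 η hη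
    obtain ⟨R, hR⟩ := eventually_atTop.1 h1
    -- The event that N is the first time above R. These events are disjoint, and f < η at that
    -- moment, so a later return to [0, a] is unlikely uniformly in N.
    set A : ℕ → Set Ω := fun N => {ω | R < X N ω} ∩ ⋂ k ∈ Finset.range N, {ω | X k ω ≤ R}
      with hAdef
    have hA : ∀ N, MeasurableSet[history X ξ N] (A N) := fun N =>
      (measurable_history_fst X ξ le_rfl measurableSet_Ioi).inter
        (Finset.measurableSet_biInter _ fun k hk =>
          measurable_history_fst X ξ (Finset.mem_range.1 hk).le measurableSet_Iic)
    have hdisj : Pairwise (Function.onFun Disjoint A) := by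
      have hlt : ∀ i j, i < j → Disjoint (A i) (A j) := by
        intro i j hij
        refine Set.disjoint_left.2 fun ω hi hj => ?_
        have := Set.mem_iInter₂.1 hj.2 i (Finset.mem_range.2 hij)
        have h2 : R < X i ω := hi.1
        exact absurd h2 (not_lt.2 this)
      intro i j hij
      rcases lt_or_gt_of_ne hij with hl | hl
      · exact hlt i j hl
      · exact (hlt j i hl).symm
    have hsub : E ⊆ ⋃ N, A N ∩ {ω | ∃ k, N ≤ k ∧ X k ω ≤ a} := by
      intro ω hω
      simp only [hE, Set.mem_ofPred_eq, Classical.not_imp] at hω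
      obtain ⟨h2, h3⟩ := hω
      classical
      refine Set.mem_iUnion.2 ⟨Nat.find (h2 R), ⟨Nat.find_spec (h2 R), ?_⟩, ?_⟩
      · exact Set.mem_iInter₂.2 fun k hk => not_lt.1 (Nat.find_min (h2 R) (Finset.mem_range.1 hk))
      · rw [not_eventually, frequently_atTop] at h3
        obtain ⟨k, hk, hk'⟩ := h3 (Nat.find (h2 R))
        exact ⟨k, hk, not_lt.1 hk'⟩
    calc m * Pr E ≤ m * ∑' N, Pr (A N ∩ {ω | ∃ k, N ≤ k ∧ X k ω ≤ a}) := by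
          gcongr
          exact (measure_mono hsub).trans (measure_iUnion_le _)
      _ = ∑' N, m * Pr (A N ∩ {ω | ∃ k, N ≤ k ∧ X k ω ≤ a}) := ENNReal.tsum_mul_left.symm
      _ ≤ ∑' N, η * Pr (A N) := by
          refine ENNReal.tsum_le_tsum fun N => ?_
          refine (h.mul_measure_hit_le hP hv hf hdrift hm N (hA N)).trans ?_
          rw [← setLIntegral_const]
          exact setLIntegral_mono' (h.history_le _ _ (hA N)) fun ω hω => (hR _ hω.1.le _).le
      _ = η * Pr (⋃ N, A N) := by
          rw [ENNReal.tsum_mul_left, measure_iUnion hdisj fun N => h.history_le _ _ (hA N)]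
      _ ≤ η := mul_le_of_le_one_right' prob_le_one
  have hz : m * Pr E = 0 := by
    by_contra hne
    obtain ⟨η, hη0, hη⟩ := exists_between (pos_iff_ne_zero.2 hne)
    exact absurd (key η hη0) (not_le.2 hη)
  exact (mul_eq_zero.1 hz).resolve_left hm0

/-- If a Borel set is reached in one step with probability bounded below from `[0, R]`, then it is
visited infinitely often whenever `[0, R]` is. -/
lemma IsWalk.ae_frequently_mem (h : IsWalk P (increment one v) Pr X ξ)
    {R q : ℝ} (hq : 0 < q) {D : Set ℝ} (hD : MeasurableSet D) (hD0 : D ⊆ Set.Ici 0)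
    (hlow : ∀ x i, 0 ≤ x → x ≤ R → q ≤ ∑ j, stepProb P (increment one v) x i D j) :
    ∀ᵐ ω ∂Pr, (∃ᶠ n in atTop, X n ω ≤ R) → ∃ᶠ n in atTop, X n ω ∈ D := by
  let ℱ : Filtration ℕ (inferInstance : MeasurableSpace Ω) :=
    ⟨history X ξ, history_mono X ξ, h.history_le⟩
  set s : ℕ → Set Ω := fun n => {ω | X n ω ∈ D} with hs
  have hsm : ∀ n, MeasurableSet[ℱ n] (s n) := fun n => measurable_history_fst X ξ le_rfl hD
  have hcond : ∀ n, Pr[(s (n + 1)).indicator (1 : Ω → ℝ) | ℱ n] =ᵐ[Pr]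
      fun ω => ∑ j, stepProb P (increment one v) (X n ω) (ξ n ω) D j := by
    intro n
    have hE : ∀ j, MeasurableSet {ω | X (n + 1) ω ∈ D ∧ ξ (n + 1) ω = j} := fun j =>
      h.measurable_pair (n + 1) (hD.prod (measurableSet_singleton j))
    have hsum : (s (n + 1)).indicator (1 : Ω → ℝ) =
        ∑ j, {ω | X (n + 1) ω ∈ D ∧ ξ (n + 1) ω = j}.indicator fun _ => (1 : ℝ) := by
      funext ω
      have hind : ∀ j, {ω | X (n + 1) ω ∈ D ∧ ξ (n + 1) ω = j}.indicator (fun _ => (1 : ℝ)) ω =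
          if ξ (n + 1) ω = j then (s (n + 1)).indicator (1 : Ω → ℝ) ω else 0 := by
        intro j
        by_cases hω : X (n + 1) ω ∈ D <;> by_cases hj : ξ (n + 1) ω = j <;> simp [hs, hω, hj]
      rw [Finset.sum_apply, Finset.sum_congr rfl fun j _ => hind j, Finset.sum_ite_eq,
        if_pos (Finset.mem_univ _)]
    rw [hsum]
    refine (condExp_finsetSum (fun j _ => (integrable_const (1 : ℝ)).indicator (hE j)) _).trans ?_
    have hall : ∀ᵐ ω ∂Pr, ∀ j, (Pr⟦{ω | X (n + 1) ω ∈ D ∧ ξ (n + 1) ω = j} | history X ξ n⟧) ω =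
        stepProb P (increment one v) (X n ω) (ξ n ω) D j :=
      ae_all_iff.2 fun j => h.transition n D j hD hD0
    filter_upwards [hall] with ω hω
    rw [Finset.sum_apply]
    exact Finset.sum_congr rfl fun j _ => hω j
  have hnn : ∀ᵐ ω ∂Pr, ∀ n, 0 ≤ (Pr[(s (n + 1)).indicator (1 : Ω → ℝ) | ℱ n]) ω :=
    ae_all_iff.2 fun n => condExp_nonneg (Eventually.of_forall fun ω =>
      Set.indicator_nonneg (fun _ _ => zero_le_one) ω)
  filter_upwards [ae_mem_limsup_atTop_iff Pr hsm, ae_all_iff.2 hcond, hnn] with ω h1 h2 h3 hR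
  have hmem : ω ∈ limsup s atTop := by
    -- Lévy's conditional Borel–Cantelli lemma: D is visited infinitely often exactly when the
    -- conditional probabilities have infinite sum. Each visit to [0, R] contributes at least q.
    rw [h1]
    have hR' : ω ∈ limsup (fun n => {ω | X n ω ≤ R}) atTop := mem_limsup_iff_frequently_mem.2 hR
    rw [Set.limsup_eq_tendsto_sum_indicator_atTop hq] at hR'
    refine tendsto_atTop_mono (fun n => Finset.sum_le_sum fun k _ => ?_) hR'
    by_cases hk : X k ω ≤ R
    · rw [Set.indicator_of_mem (show ω ∈ {ω | X k ω ≤ R} from hk), h2 k]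
      exact hlow _ _ (h.nonneg k ω) hk
    · rw [Set.indicator_of_notMem (show ω ∉ {ω | X k ω ≤ R} from hk)]
      exact h3 k
  exact mem_limsup_iff_frequently_mem.1 hmem

omit [MeasurableSpace S] [MeasurableSingletonClass S] in
-- Only jumps across the origin are kept; summing over the target branch removes the routing matrix.
lemma chi_mul_integral_le_sum_stepProb (hP : P ∈ Matrix.rowStochastic ℝ S)
    (hv : ∀ k, HeavyTailed (α k) (c k) (v k)) {x : ℝ} (hx : 0 ≤ x) (i : S) {D : Set ℝ}
    (hD : MeasurableSet D) (hD0 : D ⊆ Set.Ici 0) :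
    chi one i * ∫ z in D, v i (z + x) ≤ ∑ j, stepProb P (increment one v) x i D j := by
  have e1 : ∫ z in D, increment one v i (-z - x) = chi one i * ∫ z in D, v i (z + x) := by
    rw [← integral_const_mul]
    refine setIntegral_congr_fun hD fun z hz => ?_
    have hz0 : 0 ≤ z := hD0 hz
    rw [increment_eq hv, (hv i).eq_zero (show -z - x ≤ 0 by linarith)]
    ring_nf
  have e2 : 0 ≤ ∫ z in D, increment one v i (z - x) := by
    refine integral_nonneg fun z => ?_
    change 0 ≤ increment one v i (z - x)
    rw [increment_eq hv]
    exact add_nonneg (mul_nonneg (chi_pos one i).le ((hv i).1.nonneg _))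
      (mul_nonneg (sub_nonneg.2 (chi_le_one one i)) ((hv i).1.nonneg _))
  unfold stepProb
  rw [Finset.sum_add_distrib, ← Finset.sum_mul, e1, Finset.sum_ite_eq, if_pos (Finset.mem_univ i),
    Matrix.sum_row_of_mem_rowStochastic hP, one_mul]
  linarith

omit [MeasurableSpace S] [MeasurableSingletonClass S] in
-- The density is positive on (0, ∞), so a jump across the origin into the interval has positive
-- probability, continuous in the starting point. Compactness of [0, R] and finiteness of S make the
-- bound uniform.
lemma exists_pos_le_sum_stepProb [Nonempty S] (hP : P ∈ Matrix.rowStochastic ℝ S)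
    (hv : ∀ k, HeavyTailed (α k) (c k) (v k)) (R : ℝ) {b ε : ℝ} (hb : 0 ≤ b) (hε : 0 < ε) :
    ∃ q, 0 < q ∧ ∀ x i, 0 ≤ x → x ≤ R →
      q ≤ ∑ j, stepProb P (increment one v) x i (Set.Ioo b (b + ε)) j := by
  have hi : ∀ i, ∃ q, 0 < q ∧ ∀ x, 0 ≤ x → x ≤ R → q ≤ ∫ z in Set.Ioo b (b + ε), v i (z + x) := by
    intro i
    have hint := (hv i).1.integrable
    have heq : ∀ x, ∫ z in Set.Ioo b (b + ε), v i (z + x) =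
        ∫ y in (b + x)..(b + ε + x), v i y := by
      intro x
      rw [← integral_Ioc_eq_integral_Ioo, ← intervalIntegral.integral_of_le (by linarith),
        intervalIntegral.integral_comp_add_right (fun y => v i y)]
    have hcont : Continuous fun x => ∫ y in (b + x)..(b + ε + x), v i y := by
      have hF : Continuous fun b => ∫ y in (0 : ℝ)..b, v i y :=
        intervalIntegral.continuous_primitive (fun _ _ => hint.intervalIntegrable) 0
      have : (fun x => ∫ y in (b + x)..(b + ε + x), v i y) = fun x =>
          (∫ y in (0 : ℝ)..(b + ε + x), v i y) - ∫ y in (0 : ℝ)..(b + x), v i y := by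
        funext x
        rw [intervalIntegral.integral_interval_sub_left hint.intervalIntegrable
          hint.intervalIntegrable]
      rw [this]
      exact (hF.comp (continuous_const.add continuous_id)).sub
        (hF.comp (continuous_const.add continuous_id))
    rcases lt_or_ge R 0 with hR | hR
    · exact ⟨1, one_pos, fun x hx hx' => absurd hx' (by linarith)⟩
    obtain ⟨x₀, hx₀, hmin⟩ := (isCompact_Icc (a := (0 : ℝ)) (b := R)).exists_isMinOn
      ⟨0, le_rfl, hR⟩ hcont.continuousOn
    refine ⟨∫ y in (b + x₀)..(b + ε + x₀), v i y, ?_, fun x hx hx' => ?_⟩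
    · refine intervalIntegral.intervalIntegral_pos_of_pos_on hint.intervalIntegrable
        (fun y hy => (hv i).pos ?_) (by linarith)
      have := hx₀.1
      have := hy.1
      linarith
    · rw [heq]
      exact hmin ⟨hx, hx'⟩
  choose q hq0 hq using hi
  obtain ⟨i₀, -, hi₀⟩ := Finset.exists_min_image Finset.univ (fun i => chi one i * q i)
    Finset.univ_nonempty
  refine ⟨chi one i₀ * q i₀, mul_pos (chi_pos one i₀) (hq0 i₀), fun x i hx hx' => ?_⟩
  refine (hi₀ i (Finset.mem_univ i)).trans (le_trans ?_ (chi_mul_integral_le_sum_stepProb hP hv hx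
    i measurableSet_Ioo fun z hz => hb.trans hz.1.le))
  exact mul_le_mul_of_nonneg_left (hq i x hx hx') (chi_pos one i).le

lemma IsWalk.ae_frequently_Ioo [Nonempty S] (hP : P ∈ Matrix.rowStochastic ℝ S)
    (hv : ∀ k, HeavyTailed (α k) (c k) (v k)) (h : IsWalk P (increment one v) Pr X ξ)
    (R : ℝ) {b ε : ℝ} (hb : 0 ≤ b) (hε : 0 < ε) :
    ∀ᵐ ω ∂Pr, (∃ᶠ n in atTop, X n ω ≤ R) → ∃ᶠ n in atTop, X n ω ∈ Set.Ioo b (b + ε) := by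
  obtain ⟨q, hq, hlow⟩ := exists_pos_le_sum_stepProb (one := one) hP hv R hb hε
  exact h.ae_frequently_mem hq measurableSet_Ioo (fun z hz => hb.trans hz.1.le) hlow

/-- Foster-type criterion for recurrence. -/
theorem IsWalk.isRecurrent [Nonempty S] (hP : P ∈ Matrix.rowStochastic ℝ S)
    (hv : ∀ k, HeavyTailed (α k) (c k) (v k)) (h : IsWalk P (increment one v) Pr X ξ)
    {f : ℝ × S → ℝ} (hf : Measurable f) {a : ℝ}
    (hdrift : ∀ x i, a < x →
      ∫⁻ q, ENNReal.ofReal (f q) ∂stepMeasure P one v x i ≤ ENNReal.ofReal (f (x, i)))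
    (htop : ∀ i, Tendsto (fun x => f (x, i)) atTop atTop) : IsRecurrent Pr X := by
  have h1 := h.ae_not_tendsto_atTop hP.1 hv hf.ennreal_ofReal (fun p => ENNReal.ofReal_ne_top)
    hdrift fun i => ENNReal.tendsto_ofReal_atTop.comp (htop i)
  have h2 : ∀ᵐ ω ∂Pr, ∀ R k : ℕ, (∃ᶠ n in atTop, X n ω ≤ R) →
      ∃ᶠ n in atTop, X n ω ∈ Set.Ioo (0 : ℝ) (0 + 1 / ((k : ℝ) + 1)) :=
    ae_all_iff.2 fun R => ae_all_iff.2 fun k =>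
      h.ae_frequently_Ioo hP hv R le_rfl (by positivity)
  filter_upwards [h1, h2] with ω hω1 hω2
  have hnn : ∀ n, (0 : EReal) ≤ (X n ω : EReal) := fun n => EReal.coe_nonneg.2 (h.nonneg n ω)
  refine le_antisymm ?_ (le_liminf_of_le (by isBoundedDefault) (Eventually.of_forall hnn))
  -- Not tending to infinity means returning infinitely often to some bounded interval, and from
  -- there to each (0, 1/(k+1)).
  obtain ⟨R, hR⟩ : ∃ R : ℕ, ∃ᶠ n in atTop, X n ω ≤ R := by
    by_contra hcon
    push Not at hcon
    refine hω1 (tendsto_atTop.2 fun M => ?_)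
    obtain ⟨R, hR⟩ := exists_nat_ge M
    filter_upwards [hcon R] with n hn using hR.trans hn.le
  refine le_of_forall_gt fun e he => ?_
  obtain ⟨r, hr0, hre⟩ := EReal.lt_iff_exists_real_btwn.1 he
  obtain ⟨k, hk⟩ := exists_nat_one_div_lt (EReal.coe_pos.1 hr0)
  refine lt_of_le_of_lt (liminf_le_of_frequently_le ((hω2 R k hR).mono fun n hn => ?_)) hre
  refine EReal.coe_le_coe_iff.2 ?_
  have := hn.2
  linarith

/-- Foster-type criterion for transience. -/
theorem IsWalk.isTransient [Nonempty S] (hP : P ∈ Matrix.rowStochastic ℝ S)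
    (hv : ∀ k, HeavyTailed (α k) (c k) (v k)) (h : IsWalk P (increment one v) Pr X ξ)
    {f : ℝ × S → ℝ} (hf : Measurable f) {a : ℝ}
    (hdrift : ∀ x i, a < x →
      ∫⁻ q, ENNReal.ofReal (f q) ∂stepMeasure P one v x i ≤ ENNReal.ofReal (f (x, i)))
    (hm : ∀ b : ℝ, ∃ m, 0 < m ∧ ∀ x i, 0 ≤ x → x ≤ b → m ≤ f (x, i))
    (hzero : ∀ i, Tendsto (fun x => f (x, i)) atTop (𝓝 0)) : IsTransient Pr X := by
  have h1 : ∀ᵐ ω ∂Pr, ∀ k : ℕ, (∀ R : ℝ, ∃ n, R < X n ω) →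
      ∀ᶠ n in atTop, max a k < X n ω := by
    -- The drift condition survives raising the level a to max a k, so escape is obtained above
    -- every level.
    refine ae_all_iff.2 fun k => ?_
    obtain ⟨m, hm0, hm'⟩ := hm (max a k)
    exact h.ae_eventually_gt hP.1 hv hf.ennreal_ofReal
      (fun x i hx => hdrift x i ((le_max_left _ _).trans_lt hx))
      (ENNReal.ofReal_pos.2 hm0).ne' (fun x i hx hx' => ENNReal.ofReal_le_ofReal (hm' x i hx hx'))
      fun i => by simpa using ENNReal.tendsto_ofReal (hzero i)
  have h2 : ∀ᵐ ω ∂Pr, ∀ k : ℕ, (∃ᶠ n in atTop, X n ω ≤ k) →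
      ∃ᶠ n in atTop, X n ω ∈ Set.Ioo (k : ℝ) (k + 1) :=
    ae_all_iff.2 fun k => h.ae_frequently_Ioo hP hv k k.cast_nonneg one_pos
  filter_upwards [h1, h2] with ω hω1 hω2
  have hunb : ∀ R : ℝ, ∃ n, R < X n ω := by
    intro R
    obtain ⟨k, hk⟩ := exists_nat_ge R
    -- Unboundedness: a walk that is at most k infinitely often also visits (k, k + 1); otherwise it
    -- already exceeds k.
    by_cases hfr : ∃ᶠ n in atTop, X n ω ≤ k
    · obtain ⟨n, hn⟩ := (hω2 k hfr).exists
      exact ⟨n, hk.trans_lt hn.1⟩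
    · obtain ⟨n, hn⟩ := (not_frequently.1 hfr).exists
      exact ⟨n, hk.trans_lt (not_le.1 hn)⟩
  refine tendsto_atTop.2 fun M => ?_
  obtain ⟨k, hk⟩ := exists_nat_ge M
  filter_upwards [hω1 k hunb] with n hn
  exact hk.trans ((le_max_right _ _).trans hn.le)

end Recurrence

/-! ### The Poisson equation on the branches -/

section Poisson

variable {S : Type*} {P : Matrix S S ℝ}

/-- The form in which irreducibility is used: a property that propagates along edges and holds at
one state holds at all. -/
lemma _root_.Matrix.IsIrreducible.forall_of_step (hirr : P.IsIrreducible) {T : S → Prop}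
    (hT : ∀ i j, T i → 0 < P i j → T j) {i : S} (hi : T i) (j : S) : T j := by
  let : Quiver S := P.toQuiver
  obtain ⟨p, -⟩ := hirr.connected i j
  induction p with
  | nil => exact hi
  | cons q e ih => exact hT _ _ ih e.down

variable [Fintype S] {μ : S → ℝ}

lemma IsInvariantLaw.sum_mul_eq (hμ : IsInvariantLaw P μ) (k : S) : ∑ j, μ j * P j k = μ k :=
  sub_eq_zero.1 (hμ.2.2 k)

lemma IsInvariantLaw.pos (hirr : P.IsIrreducible) (hμ : IsInvariantLaw P μ) (k : S) : 0 < μ k := by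
  obtain ⟨i, hi⟩ : ∃ i, 0 < μ i := by
    by_contra hcon
    push Not at hcon
    have : ∑ k, μ k ≤ 0 := Finset.sum_nonpos fun k _ => hcon k
    rw [hμ.2.1] at this
    exact absurd this (by norm_num)
  refine hirr.forall_of_step (T := fun i => 0 < μ i) (fun i j hi hij => ?_) hi k
  rw [← hμ.sum_mul_eq j]
  exact (mul_pos hi hij).trans_le (Finset.single_le_sum (f := fun i => μ i * P i j)
    (fun l _ => mul_nonneg (hμ.1 l) (hirr.nonneg l j)) (Finset.mem_univ i))

variable [DecidableEq S]

/-- Maximum principle: where a harmonic function is maximal, it is maximal at all successors. -/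
lemma eq_of_sum_mul_eq [Nonempty S] (hP : P ∈ Matrix.rowStochastic ℝ S)
    (hirr : P.IsIrreducible) {θ : S → ℝ} (hθ : ∀ i, ∑ j, P i j * θ j = θ i) :
    ∃ t, ∀ i, θ i = t := by
  obtain ⟨i₀, -, hmax⟩ := Finset.exists_max_image Finset.univ θ Finset.univ_nonempty
  refine ⟨θ i₀, fun k => hirr.forall_of_step (T := fun i => θ i = θ i₀) (fun i j hi hij => ?_)
    rfl k⟩
  by_contra hne
  have hlt : θ j < θ i₀ := lt_of_le_of_ne (hmax j (Finset.mem_univ j)) hne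
  have h1 : ∑ l, P i l * θ l < ∑ l, P i l * θ i₀ :=
    Finset.sum_lt_sum (fun l _ => mul_le_mul_of_nonneg_left (hmax l (Finset.mem_univ l))
      (hirr.nonneg i l)) ⟨j, Finset.mem_univ j, mul_lt_mul_of_pos_left hlt hij⟩
  rw [hθ i, ← Finset.sum_mul, Matrix.sum_row_of_mem_rowStochastic hP, one_mul, hi] at h1
  exact lt_irrefl _ h1

/-- The Poisson equation for a finite irreducible stochastic matrix. -/
theorem exists_poisson_solution [Nonempty S] (hP : P ∈ Matrix.rowStochastic ℝ S)
    (hirr : P.IsIrreducible) (hμ : IsInvariantLaw P μ) (b : S → ℝ) :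
    ∃ θ : S → ℝ, ∀ i, b i + (∑ j, P i j * θ j - θ i) = ∑ k, μ k * b k := by
  set L : (S → ℝ) →ₗ[ℝ] (S → ℝ) := Matrix.toLin' P - LinearMap.id with hL
  set M : (S → ℝ) →ₗ[ℝ] ℝ := ∑ k, μ k • LinearMap.proj k with hM
  have hLa : ∀ θ i, L θ i = ∑ j, P i j * θ j - θ i := by
    intro θ i
    simp [hL, Matrix.mulVec, dotProduct]
  have hMa : ∀ w, M w = ∑ k, μ k * w k := by
    intro w
    simp [hM]
  have hker : Module.finrank ℝ (LinearMap.ker L) ≤ 1 := by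
    have hle : LinearMap.ker L ≤ Submodule.span ℝ {(1 : S → ℝ)} := by
      intro θ hθ
      obtain ⟨t, ht⟩ := eq_of_sum_mul_eq hP hirr (θ := θ) fun i => by
        have := congrFun (LinearMap.mem_ker.1 hθ) i
        rw [hLa] at this
        exact sub_eq_zero.1 this
      refine Submodule.mem_span_singleton.2 ⟨t, ?_⟩
      funext i
      simp [ht i]
    exact (Submodule.finrank_mono hle).trans (finrank_span_singleton one_ne_zero).le
  have hMsurj : LinearMap.range M = ⊤ := by
    refine LinearMap.range_eq_top.2 fun t => ⟨fun _ => t, ?_⟩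
    rw [hMa, ← Finset.sum_mul, hμ.2.1, one_mul]
  have hr1 := LinearMap.finrank_range_add_finrank_ker L
  have hr2 := LinearMap.finrank_range_add_finrank_ker M
  rw [hMsurj, finrank_top, Module.finrank_self] at hr2
  have hsub : LinearMap.range L ≤ LinearMap.ker M := by
    rintro _ ⟨θ, rfl⟩
    rw [LinearMap.mem_ker, hMa]
    simp only [hLa, mul_sub, Finset.sum_sub_distrib, Finset.mul_sum]
    rw [Finset.sum_comm, sub_eq_zero]
    refine Finset.sum_congr rfl fun j _ => ?_
    rw [← hμ.sum_mul_eq j, Finset.sum_mul]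
    exact Finset.sum_congr rfl fun i _ => by ring
  -- The Fredholm alternative by counting dimensions: the kernel of P - 1 is at most a line, so its
  -- range has codimension at most one, and it lies in the hyperplane of functions with zero μ-mean.
  have heq : LinearMap.range L = LinearMap.ker M :=
    Submodule.eq_of_le_of_finrank_le hsub (by omega)
  have hmem : (fun i => ∑ k, μ k * b k - b i) ∈ LinearMap.range L := by
    rw [heq, LinearMap.mem_ker, hMa]
    simp only [mul_sub, Finset.sum_sub_distrib, ← Finset.sum_mul, hμ.2.1, one_mul, sub_self]
  obtain ⟨θ, hθ⟩ := hmem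
  refine ⟨θ, fun i => ?_⟩
  have := congrFun hθ i
  rw [hLa] at this
  linarith

end Poisson

/-! ### Drift profiles and their Mellin integrals -/

section Profiles

/-- All the profiles without a power singularity at u = 1 grow at most like the square of log |1 -
u|, which any negative power at 1 and any positive power at ∞ dominates. -/
lemma integrableOn_mul_rpow_of_log_bounds {φ : ℝ → ℝ} (hφ : Measurable φ) {β p A : ℝ}
    (hβ : 0 < β) (hp : β < p) (h0 : ∀ u, 0 < u → u ≤ 1 / 2 → |φ u| ≤ A * u ^ p)
    (h1 : ∀ u, 1 / 2 < u → u ≠ 1 → |φ u| ≤ A * (1 + |(Real.log |1 - u|)|) ^ 2) :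
    IntegrableOn (fun u => φ u * u ^ (-1 - β)) (Set.Ioi 0) := by
  have hA : 0 ≤ A := by
    have h2 := (abs_nonneg _).trans (h0 (1 / 2) (by norm_num) le_rfl)
    exact nonneg_of_mul_nonneg_left h2 (by positivity)
  have hle : ∀ a b : ℝ, 0 ≤ a → 0 ≤ b → a ≤ a + a * b := fun a b ha hb =>
    le_add_of_nonneg_right (mul_nonneg ha hb)
  refine integrableOn_mul_rpow_of_bounds (p := p) (q := β / 2)
    (A := A * (25 + (1 + 4 / β) ^ 2)) hφ hp (by linarith) ?_ ?_ ?_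
  · intro u hu hu'
    refine (h0 u hu hu').trans (mul_le_mul_of_nonneg_right ?_ (Real.rpow_nonneg hu.le _))
    nlinarith [sq_nonneg (1 + 4 / β)]
  · intro u hu hu' hu1
    have hy : 0 < |1 - u| := abs_pos.2 (sub_ne_zero.2 hu1.symm)
    have hy1 : |1 - u| ≤ 1 := by rw [abs_le]; constructor <;> linarith
    have hl := abs_log_le_rpow hy.le hy1
    set w := |1 - u| ^ (-(1 / 4) : ℝ) with hw
    have hw1 : 1 ≤ w := Real.one_le_rpow_of_pos_of_le_one_of_nonpos hy hy1 (by norm_num)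
    have hw3 : |1 - u| ^ (-(3 / 4) : ℝ) = w ^ 3 := by
      rw [hw, ← Real.rpow_natCast, ← Real.rpow_mul hy.le]
      norm_num
    rw [hw3]
    refine (h1 u hu hu1).trans ?_
    rw [mul_assoc]
    refine mul_le_mul_of_nonneg_left ?_ hA
    -- Here |log| ≤ 4 w with w ≥ 1, hence the factor 5.
    calc (1 + |(Real.log |1 - u|)|) ^ 2 ≤ (5 * w) ^ 2 := by
          gcongr
          linarith
      _ = 25 * w ^ 2 * 1 := by ring
      _ ≤ 25 * w ^ 2 * w := by gcongr
      _ = 25 * w ^ 3 := by ring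
      _ ≤ _ := by
          gcongr
          exact le_add_of_nonneg_right (sq_nonneg _)
  · intro u hu
    have hu0 : 0 < u := by linarith
    have hu1 : u ≠ 1 := by linarith
    refine (h1 u (by linarith) hu1).trans ?_
    rw [mul_assoc]
    refine mul_le_mul_of_nonneg_left ?_ hA
    have hlog : |(Real.log |1 - u|)| ≤ u ^ (β / 4) / (β / 4) := by
      rw [abs_of_neg (show 1 - u < 0 by linarith), abs_of_nonneg (Real.log_nonneg (by linarith))]
      exact (Real.log_le_log (by linarith) (by linarith)).trans
        (Real.log_le_rpow_div hu0.le (by linarith))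
    have hone : 1 ≤ u ^ (β / 4) := Real.one_le_rpow (by linarith) (by linarith)
    have hsq : u ^ (β / 2) = (u ^ (β / 4)) ^ 2 := by
      rw [← Real.rpow_natCast, ← Real.rpow_mul hu0.le]
      congr 1
      push_cast
      ring
    rw [hsq]
    have hdiv : u ^ (β / 4) / (β / 4) = 4 / β * u ^ (β / 4) := by field_simp
    rw [hdiv] at hlog
    calc (1 + |(Real.log |1 - u|)|) ^ 2 ≤ ((1 + 4 / β) * u ^ (β / 4)) ^ 2 := by
          gcongr
          nlinarith
      _ = (1 + 4 / β) ^ 2 * (u ^ (β / 4)) ^ 2 := by ring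
      _ ≤ _ := by
          gcongr
          linarith

/-- The rescaled mean increment of the logarithm. -/
noncomputable def driftProfile (χ d u : ℝ) : ℝ :=
  χ * Real.log |1 - u| + (1 - χ) * Real.log (1 + u) + χ * d * (Set.Ici (1 : ℝ)).indicator 1 u

/-- The correction accounting for jumps close to the origin. -/
noncomputable def originProfile (u : ℝ) : ℝ :=
  {u : ℝ | |1 - u| < 1 / 2}.indicator
    (fun u => |(Real.log |1 - u|)| * |1 - u| ^ (-(1 / 2) : ℝ)) u

/-- A bound for the rescaled mean square increment of the logarithm. -/
noncomputable def squareProfile (χ D u : ℝ) : ℝ :=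
  χ * (2 * Real.log |1 - u| ^ 2 + D * (Set.Ici (1 : ℝ)).indicator 1 u) +
    (1 - χ) * Real.log (1 + u) ^ 2

@[fun_prop]
lemma measurable_driftProfile (χ d : ℝ) : Measurable (driftProfile χ d) := by
  unfold driftProfile
  have : Measurable ((Set.Ici (1 : ℝ)).indicator (1 : ℝ → ℝ)) :=
    measurable_one.indicator measurableSet_Ici
  fun_prop

@[fun_prop]
lemma measurable_originProfile : Measurable originProfile := by
  unfold originProfile
  refine Measurable.indicator (by fun_prop) ?_
  exact measurableSet_lt (by fun_prop) measurable_const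

@[fun_prop]
lemma measurable_squareProfile (χ D : ℝ) : Measurable (squareProfile χ D) := by
  unfold squareProfile
  have : Measurable ((Set.Ici (1 : ℝ)).indicator (1 : ℝ → ℝ)) :=
    measurable_one.indicator measurableSet_Ici
  fun_prop

lemma log_one_add_le {u : ℝ} (hu : 1 / 2 < u) :
    |Real.log (1 + u)| ≤ 2 * (1 + |(Real.log |1 - u|)|) := by
  rw [abs_of_nonneg (Real.log_nonneg (by linarith))]
  have hL := abs_nonneg (Real.log |1 - u|)
  have h3 : Real.log 3 ≤ 2 := by
    have := Real.log_le_sub_one_of_pos (show (0 : ℝ) < 3 by norm_num)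
    linarith
  rcases le_total u 2 with h2 | h2
  · have : Real.log (1 + u) ≤ Real.log 3 := Real.log_le_log (by linarith) (by linarith)
    linarith
  · have h1 : Real.log (1 + u) ≤ Real.log (3 * (u - 1)) :=
      Real.log_le_log (by linarith) (by linarith)
    rw [Real.log_mul (by norm_num) (by linarith)] at h1
    have h4 : Real.log (u - 1) ≤ |(Real.log |1 - u|)| := by
      rw [abs_of_nonpos (show 1 - u ≤ 0 by linarith), neg_sub]
      exact le_abs_self _
    linarith

lemma abs_indicator_le (s : Set ℝ) (f : ℝ → ℝ) (u : ℝ) : |s.indicator f u| ≤ |f u| :=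
  norm_indicator_le_norm_self f u

lemma abs_indicator_Ici_one_le (u : ℝ) : |(Set.Ici (1 : ℝ)).indicator (1 : ℝ → ℝ) u| ≤ 1 := by
  by_cases h : u ∈ Set.Ici (1 : ℝ) <;> simp [h]

lemma abs_driftProfile_le {χ : ℝ} (h0 : 0 ≤ χ) (h1 : χ ≤ 1) (d : ℝ) {u : ℝ} (hu : 1 / 2 < u) :
    |driftProfile χ d u| ≤ (2 + |d|) * (1 + |(Real.log |1 - u|)|) ^ 2 := by
  have hL := abs_nonneg (Real.log |1 - u|)
  set L := |(Real.log |1 - u|)| with hLdef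
  have a1 : |χ * (Real.log |1 - u|)| ≤ χ * (2 * (1 + L)) := by
    rw [abs_mul, abs_of_nonneg h0]
    exact mul_le_mul_of_nonneg_left (by linarith) h0
  have a2 : |(1 - χ) * Real.log (1 + u)| ≤ (1 - χ) * (2 * (1 + L)) := by
    rw [abs_mul, abs_of_nonneg (sub_nonneg.2 h1)]
    exact mul_le_mul_of_nonneg_left (log_one_add_le hu) (sub_nonneg.2 h1)
  have a3 : |χ * d * (Set.Ici (1 : ℝ)).indicator 1 u| ≤ |d| := by
    rw [abs_mul, abs_mul, abs_of_nonneg h0]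
    calc χ * |d| * |(Set.Ici (1 : ℝ)).indicator 1 u| ≤ 1 * |d| * 1 := by
          gcongr
          exact abs_indicator_Ici_one_le u
      _ = |d| := by ring
  have h3 : |driftProfile χ d u| ≤ _ := (abs_add_le _ _).trans (add_le_add (abs_add_le _ _) le_rfl)
  have hd := abs_nonneg d
  nlinarith [mul_nonneg hd hL, mul_nonneg hd (sq_nonneg L)]

lemma driftProfile_one_of_lt {d u : ℝ} (hu : u < 1) :
    driftProfile 1 d u = Real.log (1 - u) := by
  simp [driftProfile, hu, abs_of_pos (show 0 < 1 - u by linarith)]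

/-- On a symmetric branch the first-order effects of inward and outward jumps cancel, leaving order
u². -/
lemma driftProfile_half_of_lt {d u : ℝ} (h0 : 0 < u) (hu : u < 1) :
    driftProfile (1 / 2) d u = 1 / 2 * Real.log (1 - u ^ 2) := by
  have h2 : (1 : ℝ) - u ^ 2 = (1 - u) * (1 + u) := by ring
  rw [h2, Real.log_mul (by linarith) (by linarith)]
  simp only [driftProfile, abs_of_pos (show 0 < 1 - u by linarith)]
  rw [Set.indicator_of_notMem (by simpa using hu)]
  ring

/-- The order 1/χ at the origin, being 1 or 2, is the source of the threshold χα = 1: against u ^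
(-1 - α) the profile is integrable at 0 precisely when α < 1/χ. -/
lemma abs_driftProfile_le_rpow {χ : ℝ} (hχ : χ = 1 ∨ χ = 1 / 2) (d : ℝ) {u : ℝ} (h0 : 0 < u)
    (h1 : u ≤ 1 / 2) : |driftProfile χ d u| ≤ 2 * u ^ (1 / χ) := by
  rcases hχ with rfl | rfl
  · rw [driftProfile_one_of_lt (by linarith), div_one, Real.rpow_one]
    exact abs_log_one_sub_le h0.le h1
  · rw [driftProfile_half_of_lt h0 (by linarith), one_div_one_div, Real.rpow_two, abs_mul]
    have := abs_log_one_sub_le (sq_nonneg u) (by nlinarith)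
    rw [abs_of_pos (by norm_num : (0 : ℝ) < 1 / 2)]
    nlinarith [sq_nonneg u]

lemma driftProfile_le_neg_rpow {χ : ℝ} (hχ : χ = 1 ∨ χ = 1 / 2) (d : ℝ) {u : ℝ} (h0 : 0 < u)
    (h1 : u < 1) : driftProfile χ d u ≤ -(1 / 2 * u ^ (1 / χ)) := by
  rcases hχ with rfl | rfl
  · rw [driftProfile_one_of_lt h1, div_one, Real.rpow_one]
    have := Real.log_le_sub_one_of_pos (show 0 < 1 - u by linarith)
    linarith
  · rw [driftProfile_half_of_lt h0 h1, one_div_one_div, Real.rpow_two]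
    have := Real.log_le_sub_one_of_pos (show 0 < 1 - u ^ 2 by nlinarith)
    linarith

lemma mul_lt_one_iff_lt_one_div {χ β : ℝ} (hχ : χ = 1 ∨ χ = 1 / 2) : χ * β < 1 ↔ β < 1 / χ := by
  rcases hχ with rfl | rfl
  · simp
  · constructor <;> intro h <;> norm_num at h ⊢ <;> linarith

lemma integrableOn_driftProfile {χ β : ℝ} (hχ : χ = 1 ∨ χ = 1 / 2) (hβ : 0 < β) (h : χ * β < 1)
    (d : ℝ) : IntegrableOn (fun u => driftProfile χ d u * u ^ (-1 - β)) (Set.Ioi 0) := by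
  refine integrableOn_mul_rpow_of_log_bounds (p := 1 / χ) (A := 2 + |d|) (by fun_prop) hβ
    ((mul_lt_one_iff_lt_one_div hχ).1 h) (fun u hu hu' => ?_) (fun u hu _ => ?_)
  · refine (abs_driftProfile_le_rpow hχ d hu hu').trans ?_
    gcongr
    linarith [abs_nonneg d]
  · exact abs_driftProfile_le (by rcases hχ with rfl | rfl <;> norm_num)
      (by rcases hχ with rfl | rfl <;> norm_num) d hu

/-- With the origin cut off, no upper restriction on β is needed; the factor η ^ (-(β + 1))
compensates for u ^ (β + 1) on u ≥ η. -/
lemma integrableOn_indicator_driftProfile {χ β η : ℝ} (hχ : χ = 1 ∨ χ = 1 / 2) (hβ : 0 < β)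
    (hη : 0 < η) (d : ℝ) : IntegrableOn
      (fun u => (Set.Ici η).indicator (driftProfile χ d) u * u ^ (-1 - β)) (Set.Ioi 0) := by
  have hp : 0 < η ^ (-(β + 1)) := Real.rpow_pos_of_pos hη _
  refine integrableOn_mul_rpow_of_log_bounds (p := β + 1) (A := (2 + |d|) + 2 * η ^ (-(β + 1)))
    ((measurable_driftProfile χ d).indicator measurableSet_Ici) hβ (by linarith)
    (fun u hu hu' => ?_) (fun u hu _ => ?_)
  · by_cases hηu : η ≤ u
    · rw [Set.indicator_of_mem (show u ∈ Set.Ici η from hηu)]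
      refine (abs_driftProfile_le_rpow hχ d hu hu').trans ?_
      have h1 : u ^ (1 / χ) ≤ 1 := Real.rpow_le_one hu.le (by linarith)
        (by rcases hχ with rfl | rfl <;> norm_num)
      have h2 : 1 ≤ η ^ (-(β + 1)) * u ^ (β + 1) := by
        rw [Real.rpow_neg hη.le, mul_comm, ← div_eq_mul_inv, one_le_div (by positivity)]
        exact Real.rpow_le_rpow hη.le hηu (by linarith)
      have h3 : 0 ≤ (2 + |d|) * u ^ (β + 1) := by positivity
      nlinarith
    · rw [Set.indicator_of_notMem (show u ∉ Set.Ici η from hηu), abs_zero]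
      positivity
  · refine (abs_indicator_le _ _ _).trans ((abs_driftProfile_le
      (by rcases hχ with rfl | rfl <;> norm_num)
      (by rcases hχ with rfl | rfl <;> norm_num) d hu).trans ?_)
    exact mul_le_mul_of_nonneg_right (by linarith) (by positivity)

lemma integrableOn_originProfile {β : ℝ} (hβ : 0 < β) :
    IntegrableOn (fun u => originProfile u * u ^ (-1 - β)) (Set.Ioi 0) := by
  refine integrableOn_mul_rpow_of_bounds (p := β + 1) (q := 0) (A := 4) (by fun_prop)
    (by linarith) hβ (fun u hu hu' => ?_) (fun u hu hu' hu1 => ?_) (fun u hu => ?_)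
  · rw [originProfile, Set.indicator_of_notMem, abs_zero]
    · positivity
    · simp only [Set.mem_ofPred_eq, not_lt]
      rw [abs_of_pos] <;> linarith
  · refine (abs_indicator_le _ _ _).trans ?_
    have hy : 0 < |1 - u| := abs_pos.2 (sub_ne_zero.2 hu1.symm)
    have hy1 : |1 - u| ≤ 1 := by rw [abs_le]; constructor <;> linarith
    have hl := abs_log_le_rpow hy.le hy1
    -- The quarter power bounding the logarithm and the half power in the profile add up to 3/4,
    -- still integrable at u = 1.
    rw [abs_mul, abs_abs, abs_of_nonneg (Real.rpow_nonneg hy.le _),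
      show (-(3 / 4) : ℝ) = -(1 / 4) + -(1 / 2) by norm_num, Real.rpow_add hy, ← mul_assoc]
    exact mul_le_mul_of_nonneg_right hl (Real.rpow_nonneg hy.le _)
  · rw [originProfile, Set.indicator_of_notMem, abs_zero]
    · positivity
    · simp only [Set.mem_ofPred_eq, not_lt]
      rw [abs_of_neg] <;> linarith

lemma integrableOn_squareProfile {χ β : ℝ} (hχ : χ = 1 ∨ χ = 1 / 2) (hβ : 0 < β) (hβ2 : β < 2)
    {D : ℝ} (hD : 0 ≤ D) :
    IntegrableOn (fun u => squareProfile χ D u * u ^ (-1 - β)) (Set.Ioi 0) := by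
  have h0 : 0 ≤ χ := by rcases hχ with rfl | rfl <;> norm_num
  have h1 : χ ≤ 1 := by rcases hχ with rfl | rfl <;> norm_num
  have hnn : ∀ u, 0 ≤ squareProfile χ D u := by
    intro u
    have : 0 ≤ (Set.Ici (1 : ℝ)).indicator (1 : ℝ → ℝ) u :=
      Set.indicator_nonneg (fun _ _ => zero_le_one) u
    have := sub_nonneg.2 h1
    unfold squareProfile
    positivity
  refine integrableOn_mul_rpow_of_log_bounds (p := 2) (A := 8 + D) (by fun_prop) hβ hβ2
    (fun u hu hu' => ?_) (fun u hu _ => ?_)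
  · rw [abs_of_nonneg (hnn u), squareProfile, Set.indicator_of_notMem (by
      simp only [Set.mem_Ici, not_le]; linarith), Real.rpow_two,
      abs_of_pos (show 0 < 1 - u by linarith)]
    have a1 : Real.log (1 - u) ^ 2 ≤ (2 * u) ^ 2 := by
      rw [← sq_abs]
      have := abs_log_one_sub_le hu.le hu'
      gcongr
    have a2 : Real.log (1 + u) ^ 2 ≤ u ^ 2 := by
      have b1 := Real.log_nonneg (show 1 ≤ 1 + u by linarith)
      have b2 := Real.log_le_sub_one_of_pos (show 0 < 1 + u by linarith)
      have : Real.log (1 + u) ≤ u := by linarith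
      gcongr
    have a3 : 0 ≤ D * u ^ 2 := by positivity
    nlinarith [sq_nonneg u, sq_nonneg (Real.log (1 - u)), sq_nonneg (Real.log (1 + u))]
  · rw [abs_of_nonneg (hnn u), squareProfile]
    have hL := abs_nonneg (Real.log |1 - u|)
    have a1 : Real.log |1 - u| ^ 2 ≤ (1 + |(Real.log |1 - u|)|) ^ 2 := by
      rw [← sq_abs (Real.log |1 - u|)]
      gcongr
      linarith
    have a2 : Real.log (1 + u) ^ 2 ≤ 4 * (1 + |(Real.log |1 - u|)|) ^ 2 := by
      rw [← sq_abs (Real.log (1 + u)), show (4 : ℝ) * (1 + |(Real.log |1 - u|)|) ^ 2 =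
        (2 * (1 + |(Real.log |1 - u|)|)) ^ 2 by ring]
      have := log_one_add_le hu
      gcongr
    have a3 : (Set.Ici (1 : ℝ)).indicator (1 : ℝ → ℝ) u ≤ 1 :=
      (le_abs_self _).trans (abs_indicator_Ici_one_le u)
    have a4 : 1 ≤ (1 + |(Real.log |1 - u|)|) ^ 2 := one_le_pow₀ (by linarith)
    set W := (1 + |(Real.log |1 - u|)|) ^ 2
    have a5 : D * (Set.Ici (1 : ℝ)).indicator (1 : ℝ → ℝ) u ≤ D * W :=
      mul_le_mul_of_nonneg_left (a3.trans a4) hD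
    have a6 : χ * (2 * Real.log |1 - u| ^ 2 + D * (Set.Ici (1 : ℝ)).indicator 1 u) ≤
        χ * (2 * W + D * W) := mul_le_mul_of_nonneg_left (by linarith) h0
    have a7 : (1 - χ) * Real.log (1 + u) ^ 2 ≤ (1 - χ) * (4 * W) :=
      mul_le_mul_of_nonneg_left a2 (sub_nonneg.2 h1)
    have a8 : χ * (D * W) ≤ 1 * (D * W) := by gcongr
    nlinarith

lemma integrableOn_indicator_Ici {β K : ℝ} (hβ : 0 < β) (hK : 1 ≤ K) :
    IntegrableOn (fun u => (Set.Ici K).indicator 1 u * u ^ (-1 - β)) (Set.Ioi (0 : ℝ)) ∧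
    ∫ u in Set.Ioi (0 : ℝ), (Set.Ici K).indicator 1 u * u ^ (-1 - β) = K ^ (-β) / β := by
  have hK0 : 0 < K := by linarith
  have heq : (fun u : ℝ => (Set.Ici K).indicator 1 u * u ^ (-1 - β)) =
      (Set.Ici K).indicator fun u : ℝ => u ^ (-1 - β) := by
    funext u
    by_cases h : u ∈ Set.Ici K <;> simp [h]
  have hi : IntegrableOn (fun u : ℝ => u ^ (-1 - β)) (Set.Ici K) :=
    (integrableOn_Ioi_rpow_of_lt (by linarith) hK0).congr_set_ae Ioi_ae_eq_Ici.symm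
  rw [heq]
  refine ⟨((integrable_indicator_iff measurableSet_Ici).2 hi).integrableOn, ?_⟩
  have hsub : Set.Ici K ⊆ Set.Ioi 0 := fun u hu => hK0.trans_le hu
  rw [setIntegral_indicator measurableSet_Ici, Set.inter_eq_right.2 hsub, integral_Ici_eq_integral_Ioi,
    integral_Ioi_rpow_of_lt (by linarith) hK0]
  rw [show -1 - β + 1 = -β by ring, neg_div_neg_eq]

/-- The substitution s = u² halves the exponent, and with it the argument of the cotangent. -/
lemma integral_log_abs_one_sub_sq {β : ℝ} (h0 : 0 < β) (h1 : β < 2) :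
    ∫ u in Set.Ioi (0 : ℝ), Real.log |1 - u ^ 2| * u ^ (-1 - β) =
      Real.pi / β * Real.cot (1 / 2 * Real.pi * β) := by
  have h := integral_comp_rpow_Ioi_of_pos
    (g := fun s : ℝ => Real.log |1 - s| * s ^ (-1 - β / 2)) (p := 2) two_pos
  rw [integral_log_abs_one_sub (by linarith) (by linarith)] at h
  have hc : ∀ u ∈ Set.Ioi (0 : ℝ), (2 * u ^ ((2 : ℝ) - 1)) •
      (Real.log |1 - u ^ (2 : ℝ)| * (u ^ (2 : ℝ)) ^ (-1 - β / 2)) =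
      2 * (Real.log |1 - u ^ 2| * u ^ (-1 - β)) := by
    intro u hu
    have hu : 0 < u := hu
    rw [← Real.rpow_mul hu.le, Real.rpow_two, smul_eq_mul,
      show -1 - β = (2 - 1) + 2 * (-1 - β / 2) by ring, Real.rpow_add hu]
    ring
  rw [setIntegral_congr_fun measurableSet_Ioi hc, integral_const_mul] at h
  rw [show 1 / 2 * Real.pi * β = Real.pi * (β / 2) by ring]
  have : Real.pi / (β / 2) = 2 * (Real.pi / β) := by field_simp
  rw [this] at h
  linarith

/-- The Mellin transform of the drift profile. -/
lemma integral_driftProfile {χ β : ℝ} (hχ : χ = 1 ∨ χ = 1 / 2) (hβ : 0 < β) (h : χ * β < 1)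
    (d : ℝ) : ∫ u in Set.Ioi (0 : ℝ), driftProfile χ d u * u ^ (-1 - β) =
      χ / β * (Real.pi * Real.cot (χ * Real.pi * β) + d) := by
  obtain ⟨hi, hv⟩ := integrableOn_indicator_Ici hβ le_rfl
  rw [Real.one_rpow] at hv
  have hp := integrableOn_driftProfile hχ hβ h 0
  have hsplit : ∫ u in Set.Ioi (0 : ℝ), driftProfile χ d u * u ^ (-1 - β) =
      (∫ u in Set.Ioi (0 : ℝ), driftProfile χ 0 u * u ^ (-1 - β)) + χ * d * (1 / β) := by
    rw [← hv, ← integral_const_mul, ← integral_add hp (hi.const_mul _)]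
    refine setIntegral_congr_fun measurableSet_Ioi fun u _ => ?_
    simp only [driftProfile]
    ring
  have hmain : ∫ u in Set.Ioi (0 : ℝ), driftProfile χ 0 u * u ^ (-1 - β) =
      χ / β * (Real.pi * Real.cot (χ * Real.pi * β)) := by
    rcases hχ with rfl | rfl
    · have he : ∀ u ∈ Set.Ioi (0 : ℝ), driftProfile 1 0 u * u ^ (-1 - β) =
          Real.log |1 - u| * u ^ (-1 - β) := fun u _ => by simp [driftProfile]
      rw [setIntegral_congr_fun measurableSet_Ioi he,
        integral_log_abs_one_sub hβ (by linarith), one_mul]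
      field_simp
    · have he : ∀ᵐ u ∂volume, u ∈ Set.Ioi (0 : ℝ) → driftProfile (1 / 2) 0 u * u ^ (-1 - β) =
          1 / 2 * (Real.log |1 - u ^ 2| * u ^ (-1 - β)) := by
        filter_upwards [compl_mem_ae_iff.2 (measure_singleton (μ := volume) 1)] with u hu1 hu
        have hu : 0 < u := hu
        have hne : |1 - u| ≠ 0 := abs_ne_zero.2 (sub_ne_zero.2 (Ne.symm hu1))
        rw [show 1 - u ^ 2 = (1 - u) * (1 + u) by ring, abs_mul,
          abs_of_pos (show 0 < 1 + u by linarith), Real.log_mul hne (by linarith)]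
        simp only [driftProfile]
        ring
      rw [setIntegral_congr_ae measurableSet_Ioi he, integral_const_mul,
        integral_log_abs_one_sub_sq hβ (by linarith)]
      field_simp
  rw [hsplit, hmain]
  ring

/-- When `1 ≤ χ * β`, the drift profile has total mass `-∞` near the origin. -/
lemma exists_integral_indicator_driftProfile_neg {χ β : ℝ} (hχ : χ = 1 ∨ χ = 1 / 2) (hβ : 0 < β)
    (h : 1 ≤ χ * β) (d : ℝ) : ∃ η, 0 < η ∧ η < 1 ∧
      ∫ u in Set.Ioi (0 : ℝ), (Set.Ici η).indicator (driftProfile χ d) u * u ^ (-1 - β) < 0 := by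
  set I : ℝ := ∫ u in Set.Ioi (0 : ℝ),
    (Set.Ici (1 / 2)).indicator (driftProfile χ d) u * u ^ (-1 - β) with hI
  -- Chosen so that half the integral of 1/u over (η, 1/2) is |I| + 1, which outweighs the part I
  -- from beyond 1/2.
  set η : ℝ := 1 / 2 * Real.exp (-(2 * |I| + 2)) with hη
  have he1 : Real.exp (-(2 * |I| + 2)) < 1 := by
    rw [Real.exp_lt_one_iff]
    linarith [abs_nonneg I]
  have he0 := Real.exp_pos (-(2 * |I| + 2))
  have hη0 : 0 < η := by positivity
  have hη1 : η < 1 / 2 := by rw [hη]; linarith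
  refine ⟨η, hη0, by linarith, ?_⟩
  have hlog : ∫ u in η..(1 / 2), u⁻¹ = 2 * |I| + 2 := by
    rw [integral_inv_of_pos hη0 (by norm_num), hη]
    rw [show (1 / 2 : ℝ) / (1 / 2 * Real.exp (-(2 * |I| + 2))) =
      Real.exp (2 * |I| + 2) by rw [Real.exp_neg]; field_simp, Real.log_exp]
  have hinv : IntegrableOn (fun u : ℝ => (Set.Ioc η (1 / 2)).indicator (fun u => u⁻¹) u)
      (Set.Ioi 0) := by
    refine ((integrable_indicator_iff measurableSet_Ioc).2 ?_).integrableOn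
    refine (intervalIntegrable_iff_integrableOn_Ioc_of_le hη1.le).1 ?_
    refine (ContinuousOn.inv₀ continuousOn_id fun u hu => ?_).intervalIntegrable
    rw [Set.uIcc_of_le hη1.le] at hu
    exact (hη0.trans_le hu.1).ne'
  have hinvval : ∫ u in Set.Ioi (0 : ℝ), (Set.Ioc η (1 / 2)).indicator (fun u => u⁻¹) u =
      2 * |I| + 2 := by
    rw [setIntegral_indicator measurableSet_Ioc, Set.inter_eq_right.2 fun u hu =>
      Set.mem_Ioi.2 (hη0.trans hu.1), ← intervalIntegral.integral_of_le hη1.le, hlog]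
  have hle : ∫ u in Set.Ioi (0 : ℝ), (Set.Ici η).indicator (driftProfile χ d) u * u ^ (-1 - β) ≤
      ∫ u in Set.Ioi (0 : ℝ), ((Set.Ici (1 / 2)).indicator (driftProfile χ d) u * u ^ (-1 - β) -
        1 / 2 * (Set.Ioc η (1 / 2)).indicator (fun u => u⁻¹) u) := by
    refine setIntegral_mono_on_ae (integrableOn_indicator_driftProfile hχ hβ hη0 d)
      ((integrableOn_indicator_driftProfile hχ hβ (by norm_num) d).sub (hinv.const_mul _))
      measurableSet_Ioi ?_
    filter_upwards [compl_mem_ae_iff.2 (measure_singleton (μ := volume) η),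
      compl_mem_ae_iff.2 (measure_singleton (μ := volume) (1 / 2 : ℝ))] with u hu1 hu2 hu
    have hu0 : 0 < u := hu
    rcases lt_or_ge u η with h1 | h1
    · rw [Set.indicator_of_notMem (by simpa using h1),
        Set.indicator_of_notMem (by simp only [Set.mem_Ici, not_le]; linarith),
        Set.indicator_of_notMem (fun h => absurd h.1 (not_lt.2 h1.le))]
      simp
    have h1' : η < u := lt_of_le_of_ne h1 (Ne.symm hu1)
    rcases lt_or_ge u (1 / 2) with h2 | h2
    · rw [Set.indicator_of_mem (show u ∈ Set.Ici η from h1),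
        Set.indicator_of_notMem (by simpa using h2),
        Set.indicator_of_mem (show u ∈ Set.Ioc η (1 / 2) from ⟨h1', h2.le⟩), zero_mul, zero_sub]
      have h3 := driftProfile_le_neg_rpow hχ d hu0 (by linarith)
      -- This is where χβ ≥ 1 enters: 1/χ ≤ β, so the integrand is at least as singular as 1/u.
      have h4 : u⁻¹ ≤ u ^ (1 / χ) * u ^ (-1 - β) := by
        rw [← Real.rpow_add hu0, ← Real.rpow_neg_one]
        refine Real.rpow_le_rpow_of_exponent_ge hu0 (by linarith) ?_
        have := not_lt.1 (mt (mul_lt_one_iff_lt_one_div hχ).2 (not_lt.2 h))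
        linarith
      have h5 := mul_le_mul_of_nonneg_right h3 (Real.rpow_pos_of_pos hu0 (-1 - β)).le
      linarith
    · have h2' : 1 / 2 < u := lt_of_le_of_ne h2 (Ne.symm hu2)
      rw [Set.indicator_of_mem (show u ∈ Set.Ici η from h1),
        Set.indicator_of_mem (show u ∈ Set.Ici (1 / 2 : ℝ) from h2),
        Set.indicator_of_notMem (fun h => absurd h.2 (not_le.2 h2'))]
      simp
  rw [integral_sub (integrableOn_indicator_driftProfile hχ hβ (by norm_num) d)
    (hinv.const_mul _), integral_const_mul, hinvval, ← hI] at hle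
  linarith [le_abs_self I]

end Profiles

/-! ### One-step drift of the height and of its transforms -/

section Drift

lemma integral_mul_linear_combination {v φ₁ φ₂ φ₃ : ℝ → ℝ} {s : Set ℝ}
    (h₁ : IntegrableOn (fun y => v y * φ₁ y) s) (h₂ : IntegrableOn (fun y => v y * φ₂ y) s)
    (h₃ : IntegrableOn (fun y => v y * φ₃ y) s) (a₁ a₂ a₃ : ℝ) :
    IntegrableOn (fun y => v y * (a₁ * φ₁ y + a₂ * φ₂ y + a₃ * φ₃ y)) s ∧
    ∫ y in s, v y * (a₁ * φ₁ y + a₂ * φ₂ y + a₃ * φ₃ y) =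
      a₁ * (∫ y in s, v y * φ₁ y) + a₂ * (∫ y in s, v y * φ₂ y) +
        a₃ * ∫ y in s, v y * φ₃ y := by
  have he : (fun y => v y * (a₁ * φ₁ y + a₂ * φ₂ y + a₃ * φ₃ y)) = fun y =>
      a₁ * (v y * φ₁ y) + a₂ * (v y * φ₂ y) + a₃ * (v y * φ₃ y) := by
    funext y
    ring
  have g₁ : IntegrableOn (fun y => a₁ * (v y * φ₁ y)) s := h₁.const_mul a₁
  have g₂ : IntegrableOn (fun y => a₂ * (v y * φ₂ y)) s := h₂.const_mul a₂
  have g₃ : IntegrableOn (fun y => a₃ * (v y * φ₃ y)) s := h₃.const_mul a₃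
  have g₁₂ : IntegrableOn (fun y => a₁ * (v y * φ₁ y) + a₂ * (v y * φ₂ y)) s := g₁.add g₂
  refine ⟨he ▸ g₁₂.add g₃, ?_⟩
  rw [he, integral_add g₁₂ g₃, integral_add g₁ g₂, integral_const_mul, integral_const_mul,
    integral_const_mul]

lemma log_abs_one_sub_div {x y : ℝ} (hx : 0 < x) (hxy : y ≠ x) :
    Real.log |1 - y / x| = Real.log |x - y| - Real.log x := by
  rw [← Real.log_div (abs_ne_zero.2 (sub_ne_zero.2 hxy.symm)) hx.ne']
  congr 1
  rw [show 1 - y / x = (x - y) / x by field_simp, abs_div, abs_of_pos hx]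

lemma log_one_add_div {x y : ℝ} (hx : 0 < x) (hy : 0 < y) :
    Real.log (1 + y / x) = Real.log (x + y) - Real.log x := by
  rw [← Real.log_div (by linarith) hx.ne']
  congr 1
  field_simp

lemma log_le_posLog_sub {x y : ℝ} (hx : 0 < x) (hxy : y ≠ x) :
    Real.log |1 - y / x| ≤ Real.posLog |x - y| - Real.log x := by
  rw [log_abs_one_sub_div hx hxy]
  have : Real.log |x - y| ≤ Real.posLog |x - y| := le_max_right _ _
  linarith

lemma abs_posLog_sub_le {x y : ℝ} (hx : 1 ≤ x) (hxy : y ≠ x) :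
    |Real.posLog |x - y| - Real.log x| ≤ |(Real.log |1 - y / x|)| := by
  have hlx := Real.log_nonneg hx
  rw [log_abs_one_sub_div (by linarith) hxy]
  rcases le_total 0 (Real.log |x - y|) with h | h
  · rw [Real.posLog, max_eq_right h]
  · rw [Real.posLog, max_eq_left h, zero_sub, abs_neg, abs_of_nonneg hlx,
      abs_of_nonpos (by linarith)]
    linarith

/-- Replacing log by log⁺ costs something only when the walk lands within distance 1 of the origin.
That cost is absorbed by `originProfile` with a factor x ^ (-1/2), hence is negligible after
scaling. -/
lemma posLog_sub_le {x y : ℝ} (hx : 2 ≤ x) (hxy : y ≠ x) :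
    Real.posLog |x - y| - Real.log x ≤
      Real.log |1 - y / x| + x ^ (-(1 / 2) : ℝ) * originProfile (y / x) := by
  have hx0 : 0 < x := by linarith
  have ho : 0 ≤ originProfile (y / x) := by
    unfold originProfile
    exact Set.indicator_nonneg (fun u _ => mul_nonneg (abs_nonneg _)
      (Real.rpow_nonneg (abs_nonneg _) _)) _
  have hxp := Real.rpow_pos_of_pos hx0 (-(1 / 2))
  rcases le_total 0 (Real.log |x - y|) with h | h
  · rw [log_abs_one_sub_div hx0 hxy, Real.posLog, max_eq_right h]
    have := mul_nonneg hxp.le ho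
    linarith
  · have hpos : 0 < |x - y| := abs_pos.2 (sub_ne_zero.2 hxy.symm)
    have hle : |x - y| ≤ 1 := by
      by_contra hcon
      exact absurd (Real.log_pos (not_le.1 hcon)) (not_lt.2 h)
    have hdiv : |1 - y / x| = |x - y| / x := by
      rw [show 1 - y / x = (x - y) / x by field_simp, abs_div, abs_of_pos hx0]
    rcases eq_or_lt_of_le hle with h1 | h1
    · rw [log_abs_one_sub_div hx0 hxy, h1]
      have := mul_nonneg hxp.le ho
      simp only [Real.posLog_one, Real.log_one]
      linarith
    have hmem : |1 - y / x| < 1 / 2 := by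
      rw [hdiv, div_lt_iff₀ hx0]
      linarith
    have hval : originProfile (y / x) =
        |(Real.log |1 - y / x|)| * |1 - y / x| ^ (-(1 / 2) : ℝ) := by
      unfold originProfile
      rw [Set.indicator_of_mem (show y / x ∈ {u : ℝ | |1 - u| < 1 / 2} from hmem)]
    have hlx := Real.log_nonneg (show 1 ≤ x by linarith)
    rw [hval, log_abs_one_sub_div hx0 hxy, hdiv, Real.posLog, max_eq_left h,
      abs_of_nonpos (show Real.log |x - y| - Real.log x ≤ 0 by linarith)]
    -- The product equals |x - y| ^ (-1/2), and |x - y| ≤ 1.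
    have hone : 1 ≤ x ^ (-(1 / 2) : ℝ) * (|x - y| / x) ^ (-(1 / 2) : ℝ) := by
      rw [← Real.mul_rpow hx0.le (by positivity), mul_div_cancel₀ _ hx0.ne']
      exact Real.one_le_rpow_of_pos_of_le_one_of_nonpos hpos hle (by norm_num)
    have := mul_le_mul_of_nonneg_left hone
      (show 0 ≤ -(Real.log |x - y| - Real.log x) by linarith)
    linarith

lemma tendsto_log_mul_rpow_neg {ε : ℝ} (hε : 0 < ε) (t : ℝ) :
    Tendsto (fun x : ℝ => (t + Real.log x) * x ^ (-ε)) atTop (𝓝 0) := by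
  have h1 := (tendsto_rpow_neg_atTop hε).const_mul t
  have h2 : Tendsto (fun x : ℝ => Real.log x * x ^ (-ε)) atTop (𝓝 0) := by
    refine ((isLittleO_log_rpow_atTop hε).tendsto_div_nhds_zero).congr' ?_
    filter_upwards [eventually_gt_atTop 0] with x hx
    rw [Real.rpow_neg hx.le, div_eq_mul_inv]
  have := h1.add h2
  simp only [mul_zero, add_zero] at this
  exact this.congr fun x => by ring

variable {S : Type*} [Fintype S] [DecidableEq S] {P : Matrix S S ℝ} {one : Finset S}

omit [Fintype S] in
lemma chi_eq (one : Finset S) (k : S) : chi one k = 1 ∨ chi one k = 1 / 2 := by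
  unfold chi
  split_ifs <;> simp

lemma stepAverage_mono (hP : ∀ i j, 0 ≤ P i j) {f g : ℝ × S → ℝ} (hfg : ∀ q, f q ≤ g q) (x : ℝ)
    (i : S) (y : ℝ) : stepAverage P one f x i y ≤ stepAverage P one g x i y := by
  unfold stepAverage
  refine add_le_add (mul_le_mul_of_nonneg_left ?_ (chi_pos one i).le)
    (mul_le_mul_of_nonneg_left (hfg _) (sub_nonneg.2 (chi_le_one one i)))
  split_ifs
  · exact hfg _
  · exact Finset.sum_le_sum fun j _ => mul_le_mul_of_nonneg_left (hfg _) (hP i j)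

lemma stepAverage_affine (hP : P ∈ Matrix.rowStochastic ℝ S) (f g : ℝ × S → ℝ) (a b d x : ℝ)
    (i : S) (y : ℝ) : stepAverage P one (fun q => a + b * f q + d * g q) x i y =
      a + b * stepAverage P one f x i y + d * stepAverage P one g x i y := by
  unfold stepAverage
  split_ifs
  · ring
  · have : ∑ j, P i j * (a + b * f (y - x, j) + d * g (y - x, j)) =
        a + b * (∑ j, P i j * f (y - x, j)) + d * ∑ j, P i j * g (y - x, j) := by
      simp only [mul_add, Finset.sum_add_distrib, Finset.mul_sum]
      rw [← Finset.sum_mul, Matrix.sum_row_of_mem_rowStochastic hP, one_mul]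
      simp only [mul_left_comm]
    rw [this]
    ring

/-- The logarithm of the distance to the origin, corrected by a function of the branch. -/
noncomputable def logHeight (θ : S → ℝ) (K : ℝ) (p : ℝ × S) : ℝ := K + Real.posLog p.1 + θ p.2

omit [Fintype S] [DecidableEq S] in
lemma logHeight_of_one_le (θ : S → ℝ) (K : ℝ) {x : ℝ} (hx : 1 ≤ x) (i : S) :
    logHeight θ K (x, i) = K + Real.log x + θ i := by
  simp only [logHeight]
  rw [Real.posLog_eq_log (hx.trans (le_abs_self x))]

omit [DecidableEq S] in
lemma measurable_logHeight [MeasurableSpace S] [MeasurableSingletonClass S] (θ : S → ℝ) (K : ℝ) :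
    Measurable (logHeight θ K) := by
  have h1 : Measurable fun p : ℝ × S => θ p.2 := (measurable_of_finite θ).comp measurable_snd
  have h2 : Measurable fun p : ℝ × S => Real.posLog p.1 :=
    Real.continuous_posLog.measurable.comp measurable_fst
  exact (h2.const_add K).add h1

lemma mem_Ici_one_div_iff {x y : ℝ} (hx : 0 < x) : y / x ∈ Set.Ici (1 : ℝ) ↔ ¬ y < x := by
  rw [Set.mem_Ici, one_le_div hx, not_lt]

/-- The branch changes only when the jump reaches the origin, that is for y / x ≥ 1, so θ enters
solely through the indicator. -/
lemma stepAverage_logHeight_sub (hP : P ∈ Matrix.rowStochastic ℝ S) (θ : S → ℝ) (K : ℝ) {x y : ℝ}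
    (hx : 1 ≤ x) (hy : 0 < y) (i : S) :
    stepAverage P one (logHeight θ K) x i y - logHeight θ K (x, i) =
      chi one i * (Real.posLog |x - y| - Real.log x) + (1 - chi one i) * Real.log (1 + y / x) +
      chi one i * (∑ j, P i j * θ j - θ i) * (Set.Ici (1 : ℝ)).indicator 1 (y / x) := by
  have hx0 : 0 < x := by linarith
  rw [logHeight_of_one_le θ K hx, log_one_add_div hx0 hy]
  unfold stepAverage
  rw [logHeight_of_one_le θ K (show 1 ≤ x + y by linarith)]
  by_cases hyx : y < x
  · rw [if_pos hyx, Set.indicator_of_notMem (by rw [mem_Ici_one_div_iff hx0]; simpa using hyx)]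
    simp only [logHeight, Real.posLog_abs]
    ring
  · rw [if_neg hyx, Set.indicator_of_mem ((mem_Ici_one_div_iff hx0).2 hyx)]
    have : ∑ j, P i j * logHeight θ K (y - x, j) =
        K + Real.posLog |x - y| + ∑ j, P i j * θ j := by
      simp only [logHeight, mul_add, Finset.sum_add_distrib]
      rw [← Finset.sum_mul, ← Finset.sum_mul, Matrix.sum_row_of_mem_rowStochastic hP, one_mul,
        one_mul, abs_sub_comm, Real.posLog_abs]
    rw [this, Pi.one_apply]
    ring

lemma stepAverage_logHeight_sub_le (hP : P ∈ Matrix.rowStochastic ℝ S) (θ : S → ℝ) (K : ℝ)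
    {x y : ℝ} (hx : 2 ≤ x) (hy : 0 < y) (hxy : y ≠ x) (i : S) :
    stepAverage P one (logHeight θ K) x i y - logHeight θ K (x, i) ≤
      driftProfile (chi one i) (∑ j, P i j * θ j - θ i) (y / x) +
        x ^ (-(1 / 2) : ℝ) * originProfile (y / x) := by
  rw [stepAverage_logHeight_sub hP θ K (by linarith) hy]
  have h1 := posLog_sub_le hx hxy
  have h2 := log_le_posLog_sub (show 0 < x by linarith) hxy
  have h3 := chi_pos one i
  have h4 := chi_le_one one i
  unfold driftProfile
  nlinarith

lemma driftProfile_le_stepAverage_logHeight_sub (hP : P ∈ Matrix.rowStochastic ℝ S) (θ : S → ℝ)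
    (K : ℝ) {x y : ℝ} (hx : 1 ≤ x) (hy : 0 < y) (hxy : y ≠ x) (i : S) :
    driftProfile (chi one i) (∑ j, P i j * θ j - θ i) (y / x) ≤
      stepAverage P one (logHeight θ K) x i y - logHeight θ K (x, i) := by
  rw [stepAverage_logHeight_sub hP θ K hx hy]
  have h2 := mul_le_mul_of_nonneg_left (log_le_posLog_sub (show 0 < x by linarith) hxy)
    (chi_pos one i).le
  unfold driftProfile
  linarith

/-- By (p + q)² ≤ 2p² + 2q², where the change q of θ is at most 2Θ; this gives 8Θ². -/
lemma stepAverage_sq_logHeight_sub_le (hP : P ∈ Matrix.rowStochastic ℝ S) {θ : S → ℝ} (K : ℝ)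
    {Θ : ℝ} (hθ : ∀ j, |θ j| ≤ Θ) {x y : ℝ} (hx : 1 ≤ x) (hy : 0 < y) (hxy : y ≠ x) (i : S) :
    stepAverage P one (fun q => (logHeight θ K q - logHeight θ K (x, i)) ^ 2) x i y ≤
      squareProfile (chi one i) (8 * Θ ^ 2) (y / x) := by
  have hx0 : 0 < x := by linarith
  have hδ : (Real.posLog |x - y| - Real.log x) ^ 2 ≤ Real.log |1 - y / x| ^ 2 :=
    sq_le_sq.2 (abs_posLog_sub_le hx hxy)
  unfold stepAverage squareProfile
  refine add_le_add (mul_le_mul_of_nonneg_left ?_ (chi_pos one i).le)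
    (mul_le_mul_of_nonneg_left (le_of_eq ?_) (sub_nonneg.2 (chi_le_one one i)))
  · rw [logHeight_of_one_le θ K hx]
    by_cases hyx : y < x
    · rw [if_pos hyx, Set.indicator_of_notMem (by rw [mem_Ici_one_div_iff hx0]; simpa using hyx)]
      simp only [logHeight]
      rw [← Real.posLog_abs, show K + Real.posLog |x - y| + θ i - (K + Real.log x + θ i) =
        Real.posLog |x - y| - Real.log x by ring]
      nlinarith [sq_nonneg (Real.log |1 - y / x|)]
    · rw [if_neg hyx, Set.indicator_of_mem ((mem_Ici_one_div_iff hx0).2 hyx), Pi.one_apply]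
      have hterm : ∀ j, (logHeight θ K (y - x, j) - (K + Real.log x + θ i)) ^ 2 ≤
          2 * Real.log |1 - y / x| ^ 2 + 8 * Θ ^ 2 * 1 := by
        intro j
        simp only [logHeight]
        rw [← Real.posLog_abs, abs_sub_comm y x,
          show K + Real.posLog |x - y| + θ j - (K + Real.log x + θ i) =
          (Real.posLog |x - y| - Real.log x) + (θ j - θ i) by ring]
        have hd : (θ j - θ i) ^ 2 ≤ (2 * Θ) ^ 2 := by
          have h1 := abs_le.1 (hθ j)
          have h2 := abs_le.1 (hθ i)
          refine sq_le_sq' ?_ ?_ <;> linarith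
        nlinarith [sq_nonneg ((Real.posLog |x - y| - Real.log x) - (θ j - θ i))]
      calc _ ≤ ∑ j, P i j * (2 * Real.log |1 - y / x| ^ 2 + 8 * Θ ^ 2 * 1) :=
            Finset.sum_le_sum fun j _ => mul_le_mul_of_nonneg_left (hterm j) (hP.1 i j)
        _ = _ := by rw [← Finset.sum_mul, Matrix.sum_row_of_mem_rowStochastic hP, one_mul]
  · simp only []
    rw [logHeight_of_one_le θ K (show 1 ≤ x + y by linarith), logHeight_of_one_le θ K hx,
      log_one_add_div hx0 hy]
    ring

variable [MeasurableSpace S] [MeasurableSingletonClass S]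
  {α c : S → ℝ} {v : S → ℝ → ℝ}

/-- The logarithm does not increase on average when its rescaled drift is negative. -/
lemma eventually_lintegral_logHeight_le (hP : P ∈ Matrix.rowStochastic ℝ S)
    (hc : ∀ k, 0 < c k) (hv : ∀ k, HeavyTailed (α k) (c k) (v k)) {θ : S → ℝ} {K : ℝ}
    (hK : ∀ p, 0 ≤ logHeight θ K p) (hα : ∀ k, 0 < α k) (i : S) {φ : ℝ → ℝ} (hφ : Measurable φ)
    (hφi : IntegrableOn (fun u => φ u * u ^ (-1 - α i)) (Set.Ioi 0))
    (hle : ∀ u, 0 < u → driftProfile (chi one i) (∑ j, P i j * θ j - θ i) u ≤ φ u)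
    (hneg : ∫ u in Set.Ioi (0 : ℝ), φ u * u ^ (-1 - α i) < 0) :
    ∀ᶠ x in atTop, ∫⁻ q, ENNReal.ofReal (logHeight θ K q) ∂stepMeasure P one v x i ≤
      ENNReal.ofReal (logHeight θ K (x, i)) := by
  obtain ⟨hd, C, hC⟩ := hv i
  have hm := hd.measurable
  have hoi := integrableOn_originProfile (hα i)
  have t1 := tendsto_integral_comp_div hm hC hφ hφi
  have t2 := (tendsto_rpow_neg_atTop (show (0 : ℝ) < 1 / 2 by norm_num)).mul
    (tendsto_integral_comp_div hm hC measurable_originProfile hoi)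
  have t3 := t1.add t2
  rw [zero_mul, add_zero] at t3
  filter_upwards [t3.eventually_lt_const (mul_neg_of_pos_of_neg (hc i) hneg),
    eventually_ge_atTop 2] with x hx hx2
  have hx0 : 0 < x := by linarith
  have i1 := integrableOn_comp_div hm hC hφ hφi hx0
  have i2 := integrableOn_comp_div hm hC measurable_originProfile hoi hx0
  -- Two terms suffice here; the third coefficient is set to 0.
  obtain ⟨hint, hval⟩ := integral_mul_linear_combination i1 i2 i2 1 (x ^ (-(1 / 2) : ℝ)) 0
  refine lintegral_stepMeasure_le hP.1 one hv (measurable_logHeight θ K) hK hint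
    (fun y hy hyx => ?_) ?_
  · have h1 := stepAverage_logHeight_sub_le (one := one) hP θ K hx2 hy hyx i
    have h2 := hle (y / x) (by positivity)
    linarith
  · rw [hval]
    have hxa := Real.rpow_pos_of_pos hx0 (α i)
    by_contra hcon
    have := mul_pos hxa (not_le.1 hcon)
    linarith

/-- The square root of the logarithm does not increase on average when the rescaled drift of the
logarithm vanishes and the tails are regular. -/
lemma eventually_lintegral_sqrt_logHeight_le (hP : P ∈ Matrix.rowStochastic ℝ S)
    (hc : ∀ k, 0 < c k) (hv : ∀ k, HeavyTailed (α k) (c k) (v k)) {θ : S → ℝ} {K Θ : ℝ}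
    (hθ : ∀ j, |θ j| ≤ Θ) (hK : 1 + Θ ≤ K) (hα : ∀ k, 0 < α k) (i : S)
    (hplus : HeavyTailedPlus (α i) (c i) (v i)) (hχ : chi one i * α i < 1)
    (hcrit : Real.pi * Real.cot (chi one i * Real.pi * α i) + (∑ j, P i j * θ j - θ i) = 0) :
    ∀ᶠ x in atTop,
      ∫⁻ q, ENNReal.ofReal (Real.sqrt (logHeight θ K q)) ∂stepMeasure P one v x i ≤
        ENNReal.ofReal (Real.sqrt (logHeight θ K (x, i))) := by
  obtain ⟨hd, C, hC, δ, hδ, hO⟩ := hplus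
  have hm := hd.measurable
  have hχeq := chi_eq one i
  have hχ0 := chi_pos one i
  have hαi := hα i
  have hΘ : 0 ≤ Θ := (abs_nonneg _).trans (hθ i)
  set d := ∑ j, P i j * θ j - θ i with hddef
  have hα1 := (mul_lt_one_iff_lt_one_div hχeq).1 hχ
  -- At most half the gap between α and 1/χ, so that the profile stays integrable against u ^ (-1 -
  -- (α + ε)).
  obtain ⟨ε, hε, hεδ, hεα⟩ : ∃ ε, 0 < ε ∧ ε ≤ δ ∧ chi one i * (α i + ε) < 1 := by
    refine ⟨min δ ((1 / chi one i - α i) / 2), lt_min hδ (by linarith), min_le_left _ _, ?_⟩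
    rw [mul_lt_one_iff_lt_one_div hχeq]
    have := min_le_right δ ((1 / chi one i - α i) / 2)
    linarith
  -- A jump y ≥ R x crosses the origin and lands beyond e ^ (2Θ + 1) x, so the height rises by at
  -- least 1 even if θ drops by 2Θ.
  set R := 1 + Real.exp (2 * Θ + 1) with hR
  have hR1 : 1 ≤ R := by
    have := Real.exp_pos (2 * Θ + 1)
    linarith
  have hpi := integrableOn_driftProfile hχeq hαi hχ d
  have hpi' := integrableOn_driftProfile hχeq (by linarith) hεα d
  have hoi := integrableOn_originProfile hαi
  obtain ⟨hri, hrv⟩ := integrableOn_indicator_Ici hαi hR1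
  have hrm : Measurable ((Set.Ici R).indicator (1 : ℝ → ℝ)) :=
    measurable_one.indicator measurableSet_Ici
  have hpm := measurable_driftProfile (chi one i) d
  obtain ⟨A, hA⟩ := exists_abs_integral_comp_div_sub_le hm hC hpm hO hε hεδ hpi hpi'
  rw [integral_driftProfile hχeq hαi hχ d, hcrit, mul_zero, mul_zero] at hA
  simp only [sub_zero] at hA
  set t := K + θ i with ht
  -- Everything is multiplied by x ^ α and by the height t + log x, which cancels the 1/a in the
  -- concavity gain. The drift and origin terms then vanish in the limit, since a power beats the
  -- logarithm, and only the strictly negative gain remains.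
  have t1 : Tendsto (fun x => (t + Real.log x) * (x ^ α i *
      ∫ y in Set.Ioi (0 : ℝ), v i y * driftProfile (chi one i) d (y / x))) atTop (𝓝 0) := by
    refine squeeze_zero_norm' ?_
      (by simpa using ((tendsto_log_mul_rpow_neg hε t).norm.mul_const A))
    filter_upwards [eventually_gt_atTop 0] with x hx
    rw [norm_mul, abs_of_nonneg (Real.rpow_nonneg hx.le (-ε)), mul_assoc, mul_comm _ A]
    exact mul_le_mul_of_nonneg_left ((Real.norm_eq_abs _).trans_le (hA x hx)) (norm_nonneg _)
  have t2 := (tendsto_log_mul_rpow_neg (show (0 : ℝ) < 1 / 2 by norm_num) t).mul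
    (tendsto_integral_comp_div hm hC measurable_originProfile hoi)
  have t3 := (tendsto_integral_comp_div hm hC hrm hri).const_mul (-(chi one i / 16))
  have t4 := (t1.add t2).add t3
  rw [zero_mul, zero_add, zero_add, hrv] at t4
  have hlim : -(chi one i / 16) * (c i * (R ^ (-α i) / α i)) < 0 := by
    have := hc i
    have : 0 < R ^ (-α i) := Real.rpow_pos_of_pos (by linarith) _
    have : 0 < chi one i / 16 * (c i * (R ^ (-α i) / α i)) := by positivity
    linarith
  filter_upwards [t4.eventually_lt_const hlim, eventually_ge_atTop 2] with x hx hx2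
  have hx0 : 0 < x := by linarith
  have hlogx := Real.log_nonneg (show 1 ≤ x by linarith)
  have hGnn : ∀ p, 1 ≤ logHeight θ K p := by
    intro p
    have h1 := abs_le.1 (hθ p.2)
    have h2 : 0 ≤ Real.posLog p.1 := Real.posLog_nonneg
    unfold logHeight
    linarith
  set a := logHeight θ K (x, i) with ha
  have ha1 : 1 ≤ a := hGnn _
  have haval : a = t + Real.log x := by
    rw [ha, logHeight_of_one_le θ K (by linarith), ht]
    ring
  have hsa : 0 < Real.sqrt a := Real.sqrt_pos.2 (by linarith)
  have hsq : Real.sqrt a * Real.sqrt a = a := Real.mul_self_sqrt (by linarith)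
  have i1 := integrableOn_comp_div hm hC hpm hpi hx0
  have i2 := integrableOn_comp_div hm hC measurable_originProfile hoi hx0
  have i3 := integrableOn_comp_div hm hC hrm hri hx0
  set k := 1 / (2 * Real.sqrt a) with hk
  have hk0 : 0 < k := by positivity
  obtain ⟨hint, hval⟩ := integral_mul_linear_combination i1 i2 i3 k (k * x ^ (-(1 / 2) : ℝ))
    (k * (-(chi one i / (16 * a))))
  refine lintegral_stepMeasure_le hP.1 one hv (measurable_logHeight θ K).sqrt
    (fun p => Real.sqrt_nonneg _) hint (fun y hy hyx => ?_) ?_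
  · set r : ℝ × S → ℝ := fun q => (Real.sqrt (logHeight θ K q) - Real.sqrt a) ^ 2 with hr
    -- The exact second-order expansion √b = √a/2 + b/(2√a) - (√b - √a)²/(2√a); the square is the
    -- concavity gain.
    have hexp : (fun q => Real.sqrt (logHeight θ K q)) =
        fun q => Real.sqrt a / 2 + k * logHeight θ K q + -k * r q := by
      funext q
      have hb : Real.sqrt (logHeight θ K q) * Real.sqrt (logHeight θ K q) = logHeight θ K q :=
        Real.mul_self_sqrt (by linarith [hGnn q])
      simp only [hr, hk]
      field_simp
      rw [sq, sq]
      linear_combination hb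
    have hrlow : chi one i / (16 * a) * (Set.Ici R).indicator 1 (y / x) ≤
        stepAverage P one r x i y := by
      have hr0 : ∀ q, 0 ≤ r q := fun q => sq_nonneg _
      have hbase : chi one i * (if y < x then r (x - y, i) else ∑ j, P i j * r (y - x, j)) ≤
          stepAverage P one r x i y :=
        le_add_of_nonneg_right (mul_nonneg (sub_nonneg.2 (chi_le_one one i)) (hr0 _))
      refine le_trans ?_ hbase
      rw [div_eq_mul_one_div, mul_assoc]
      refine mul_le_mul_of_nonneg_left ?_ hχ0.le
      by_cases hmem : y / x ∈ Set.Ici R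
      · rw [Set.indicator_of_mem hmem, Pi.one_apply, mul_one]
        have hyR : R * x ≤ y := (le_div_iff₀ hx0).1 hmem
        have hnlt : ¬ y < x := by
          rw [not_lt]
          nlinarith
        rw [if_neg hnlt]
        have hterm : ∀ j, 1 / (16 * a) ≤ r (y - x, j) := by
          intro j
          have h1 : Real.exp (2 * Θ + 1) * x ≤ y - x := by
            rw [hR] at hyR
            linarith
          have h2 : 2 * Θ + 1 + Real.log x ≤ Real.posLog (y - x) := by
            refine le_trans ?_ (le_max_right _ _)
            rw [← Real.log_exp (2 * Θ + 1), ← Real.log_mul (Real.exp_pos _).ne' hx0.ne']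
            exact Real.log_le_log (by positivity) h1
          have h3 : a + 1 ≤ logHeight θ K (y - x, j) := by
            have b1 := abs_le.1 (hθ j)
            have b2 := abs_le.1 (hθ i)
            rw [haval, ht]
            simp only [logHeight]
            linarith
          -- A rise of the height by 1 lifts its root by 1/(4√a), because (√a + 1/(4√a))² = a + 1/2
          -- + 1/(16a) and a ≥ 1.
          have h4 : Real.sqrt a + 1 / (4 * Real.sqrt a) ≤
              Real.sqrt (logHeight θ K (y - x, j)) := by
            refine Real.le_sqrt_of_sq_le (le_trans (le_of_eq ?_) (h3.trans' (?_ :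
              a + 1 / 2 + 1 / (16 * a) ≤ a + 1)))
            · rw [add_sq, div_pow, mul_pow, sq, hsq]
              field_simp
              ring
            · have : 1 / (16 * a) ≤ 1 / 16 := by
                apply one_div_le_one_div_of_le <;> linarith
              linarith
          have h5 : 1 / (16 * a) = (1 / (4 * Real.sqrt a)) ^ 2 := by
            rw [div_pow, mul_pow, sq (Real.sqrt a), hsq]
            norm_num
          rw [h5]
          have : 0 ≤ 1 / (4 * Real.sqrt a) := by positivity
          simp only [hr]
          gcongr
          linarith
        calc 1 / (16 * a) = ∑ j, P i j * (1 / (16 * a)) := by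
              rw [← Finset.sum_mul, Matrix.sum_row_of_mem_rowStochastic hP, one_mul]
          _ ≤ _ := Finset.sum_le_sum fun j _ => mul_le_mul_of_nonneg_left (hterm j) (hP.1 i j)
      · rw [Set.indicator_of_notMem hmem, mul_zero]
        split_ifs
        · exact hr0 _
        · exact Finset.sum_nonneg fun j _ => mul_nonneg (hP.1 i j) (hr0 _)
    have hup := stepAverage_logHeight_sub_le (one := one) hP θ K hx2 hy hyx i
    rw [hexp, stepAverage_affine hP]
    have hka : k * a = Real.sqrt a / 2 := by
      rw [hk]
      field_simp
      linarith
    have h1 := mul_le_mul_of_nonneg_left hup hk0.le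
    have h2 := mul_le_mul_of_nonneg_left hrlow hk0.le
    rw [← ha, ← hddef, mul_sub, hka] at h1
    linarith
  · rw [hval]
    have hxa := Real.rpow_pos_of_pos hx0 (α i)
    rw [← haval] at hx
    have ha0 : 0 < a := by linarith
    -- Multiplying by x ^ α · a / k turns the integral into the quantity whose negativity is `hx`.
    by_contra hcon
    have h1 := mul_pos (mul_pos hxa (div_pos ha0 hk0)) (not_le.1 hcon)
    refine absurd h1 (not_lt.2 (le_trans (le_of_eq ?_) hx.le))
    field_simp

/-- The reciprocal of the logarithm does not increase on average when the rescaled drift of the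
logarithm is positive. -/
lemma exists_eventually_lintegral_inv_logHeight_le (hP : P ∈ Matrix.rowStochastic ℝ S)
    (hc : ∀ k, 0 < c k) (hv : ∀ k, HeavyTailed (α k) (c k) (v k)) {θ : S → ℝ} {Θ : ℝ}
    (hθ : ∀ j, |θ j| ≤ Θ) (hα : ∀ k, 0 < α k) (i : S) (hχ : chi one i * α i < 1)
    (hpos : 0 < Real.pi * Real.cot (chi one i * Real.pi * α i) + (∑ j, P i j * θ j - θ i)) :
    ∃ B₀ : ℝ, ∀ B, B₀ ≤ B → 0 < B → ∀ᶠ x in atTop,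
      ∫⁻ q, ENNReal.ofReal (logHeight θ (B + Θ) q)⁻¹ ∂stepMeasure P one v x i ≤
        ENNReal.ofReal (logHeight θ (B + Θ) (x, i))⁻¹ := by
  obtain ⟨hd, C, hC⟩ := hv i
  have hm := hd.measurable
  have hχeq := chi_eq one i
  have hαi := hα i
  have hΘ : 0 ≤ Θ := (abs_nonneg _).trans (hθ i)
  set d := ∑ j, P i j * θ j - θ i with hddef
  have hα2 : α i < 2 := by
    rcases hχeq with h | h <;> rw [h] at hχ <;> linarith
  have hpi := integrableOn_driftProfile hχeq hαi hχ d
  have hsi := integrableOn_squareProfile hχeq hαi hα2 (show 0 ≤ 8 * Θ ^ 2 by positivity)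
  have hpm := measurable_driftProfile (chi one i) d
  have hsm := measurable_squareProfile (chi one i) (8 * Θ ^ 2)
  have hI : 0 < ∫ u in Set.Ioi (0 : ℝ), driftProfile (chi one i) d u * u ^ (-1 - α i) := by
    rw [integral_driftProfile hχeq hαi hχ d]
    have := chi_pos one i
    positivity
  set I := ∫ u in Set.Ioi (0 : ℝ), driftProfile (chi one i) d u * u ^ (-1 - α i) with hIdef
  set J := ∫ u in Set.Ioi (0 : ℝ), squareProfile (chi one i) (8 * Θ ^ 2) u * u ^ (-1 - α i)
    with hJdef
  -- The scaled drift of the reciprocal is proportional to -I + J / B, negative once B > J / I. The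
  -- claim covers all larger B because a single constant must serve every branch.
  refine ⟨J / I + 1, fun B hB hB0 => ?_⟩
  have hJB : J < B * I := by
    have : J / I < B := by linarith
    rwa [div_lt_iff₀ hI] at this
  have t := ((tendsto_integral_comp_div hm hC hpm hpi).const_mul (-1)).add
    ((tendsto_integral_comp_div hm hC hsm hsi).const_mul (1 / B))
  rw [← hIdef, ← hJdef] at t
  have hlim : -1 * (c i * I) + 1 / B * (c i * J) < 0 := by
    have h1 : 1 / B * (c i * J) < 1 / B * (c i * (B * I)) := by
      have := hc i
      gcongr
    have h2 : 1 / B * (c i * (B * I)) = c i * I := by field_simp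
    linarith
  filter_upwards [t.eventually_lt_const hlim, eventually_ge_atTop 2] with x hx hx2
  have hx0 : 0 < x := by linarith
  have hGB : ∀ p, B ≤ logHeight θ (B + Θ) p := by
    intro p
    have h1 := abs_le.1 (hθ p.2)
    have h2 : 0 ≤ Real.posLog p.1 := Real.posLog_nonneg
    unfold logHeight
    linarith
  set a := logHeight θ (B + Θ) (x, i) with ha
  have ha0 : 0 < a := hB0.trans_le (hGB _)
  have i1 := integrableOn_comp_div hm hC hpm hpi hx0
  have i2 := integrableOn_comp_div hm hC hsm hsi hx0
  obtain ⟨hint, hval⟩ := integral_mul_linear_combination i1 i2 i2 (-(1 / a ^ 2))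
    (1 / (a ^ 2 * B)) 0
  refine lintegral_stepMeasure_le hP.1 one hv
    (f := fun q => (logHeight θ (B + Θ) q)⁻¹) (measurable_logHeight θ _).inv
    (fun p => inv_nonneg.2 (hB0.le.trans (hGB p))) hint (fun y hy hyx => ?_) ?_
  · have hbd : ∀ q, (logHeight θ (B + Θ) q)⁻¹ ≤ 2 / a + -(1 / a ^ 2) * logHeight θ (B + Θ) q +
        1 / (a ^ 2 * B) * (logHeight θ (B + Θ) q - logHeight θ (B + Θ) (x, i)) ^ 2 := by
      intro q
      rw [← ha]
      set b := logHeight θ (B + Θ) q with hb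
      have hb0 : 0 < b := hB0.trans_le (hGB _)
      -- The exact expansion of 1/b at a. The remaining b in the denominator is bounded below by the
      -- additive constant B, so smallness comes from B and not from x.
      have h1 : b⁻¹ = 2 / a + -(1 / a ^ 2) * b + 1 / (a ^ 2 * b) * (b - a) ^ 2 := by
        field_simp
        ring
      rw [h1]
      have h2 : 1 / (a ^ 2 * b) ≤ 1 / (a ^ 2 * B) := by
        have := hGB q
        gcongr
      gcongr
    have h1 := stepAverage_mono (one := one) hP.1 hbd x i y
    rw [stepAverage_affine hP (logHeight θ (B + Θ))
      (fun q => (logHeight θ (B + Θ) q - logHeight θ (B + Θ) (x, i)) ^ 2)] at h1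
    have h2 := driftProfile_le_stepAverage_logHeight_sub (one := one) hP θ (B + Θ)
      (show 1 ≤ x by linarith) hy hyx i
    have h3 := stepAverage_sq_logHeight_sub_le (one := one) hP (B + Θ) hθ
      (show 1 ≤ x by linarith) hy hyx i
    have h4 := mul_le_mul_of_nonneg_left h2 (show 0 ≤ 1 / a ^ 2 by positivity)
    have h5 := mul_le_mul_of_nonneg_left h3 (show 0 ≤ 1 / (a ^ 2 * B) by positivity)
    rw [mul_sub, ← ha] at h4
    have h6 : 1 / a ^ 2 * a = a⁻¹ := by field_simp
    have h7 : 2 / a = 2 * a⁻¹ := by field_simp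
    rw [h7] at h1
    rw [h6] at h4
    rw [← hddef] at h4
    simp only [← ha] at h1 h5 ⊢
    linarith
  · rw [hval]
    have hxa := Real.rpow_pos_of_pos hx0 (α i)
    by_contra hcon
    have h1 := mul_pos (mul_pos hxa (pow_pos ha0 2)) (not_le.1 hcon)
    refine absurd h1 (not_lt.2 (le_trans (le_of_eq ?_) hx.le))
    field_simp
    ring

end Drift

/-! ### Assembling the recurrence classification -/

section Classification

variable {S : Type*} [Fintype S] [Nonempty S] [DecidableEq S]
  [MeasurableSpace S] [MeasurableSingletonClass S]
  {P : Matrix S S ℝ} {μ : S → ℝ} {one : Finset S} {α c : S → ℝ} {v : S → ℝ → ℝ}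
  {Ω : Type*} [MeasurableSpace Ω] {Pr : Measure Ω} [IsProbabilityMeasure Pr]
  {X : ℕ → Ω → ℝ} {ξ : ℕ → Ω → S}

omit [Nonempty S] [DecidableEq S] [MeasurableSpace S] [MeasurableSingletonClass S] in
lemma abs_le_sum_abs (θ : S → ℝ) (j : S) : |θ j| ≤ ∑ k, |θ k| :=
  Finset.single_le_sum (f := fun k => |θ k|) (fun _ _ => abs_nonneg _) (Finset.mem_univ j)

omit [Fintype S] [Nonempty S] [DecidableEq S] [MeasurableSpace S] [MeasurableSingletonClass S] in
lemma tendsto_logHeight (θ : S → ℝ) (K : ℝ) (i : S) :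
    Tendsto (fun x => logHeight θ K (x, i)) atTop atTop := by
  refine (tendsto_atTop_add_const_right _ (θ i)
    (tendsto_atTop_add_const_left _ K Real.tendsto_log_atTop)).congr' ?_
  filter_upwards [eventually_ge_atTop 1] with x hx
  rw [logHeight_of_one_le θ K hx]

omit [Nonempty S] [DecidableEq S] [MeasurableSingletonClass S] [MeasurableSpace S] in
lemma exists_forall_of_eventually {p : ℝ → S → Prop} (h : ∀ i, ∀ᶠ x in atTop, p x i) :
    ∃ a, ∀ x i, a < x → p x i := by
  obtain ⟨a, ha⟩ := eventually_atTop.1 (eventually_all.2 h)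
  exact ⟨a, fun x i hx => ha x hx.le i⟩

/-- Recurrence when the branch drifts, replaced by arbitrary numbers on the branches whose
drift is `-∞`, have a negative stationary mean. -/
lemma IsWalk.isRecurrent_of_sum_neg (hP : P ∈ Matrix.rowStochastic ℝ S) (hirr : P.IsIrreducible)
    (hμ : IsInvariantLaw P μ) (hα : ∀ k, 0 < α k) (hc : ∀ k, 0 < c k)
    (hv : ∀ k, HeavyTailed (α k) (c k) (v k)) (hX : IsWalk P (increment one v) Pr X ξ)
    (b : S → ℝ)
    (hb : ∀ k, chi one k * α k < 1 → b k = Real.pi * Real.cot (chi one k * Real.pi * α k))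
    (hneg : ∑ k, μ k * b k < 0) : IsRecurrent Pr X := by
  obtain ⟨θ, hθ⟩ := exists_poisson_solution hP hirr hμ b
  have hK : ∀ p, 0 ≤ logHeight θ (∑ k, |θ k|) p := by
    intro p
    have h1 := (abs_le.1 (abs_le_sum_abs θ p.2)).1
    have h2 : 0 ≤ Real.posLog p.1 := Real.posLog_nonneg
    unfold logHeight
    linarith
  have hev : ∀ i, ∀ᶠ x in atTop,
      ∫⁻ q, ENNReal.ofReal (logHeight θ (∑ k, |θ k|) q) ∂stepMeasure P one v x i ≤
        ENNReal.ofReal (logHeight θ (∑ k, |θ k|) (x, i)) := by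
    intro i
    rcases lt_or_ge (chi one i * α i) 1 with h | h
    · refine eventually_lintegral_logHeight_le hP hc hv hK hα i (measurable_driftProfile _ _)
        (integrableOn_driftProfile (chi_eq one i) (hα i) h _) (fun u _ => le_rfl) ?_
      rw [integral_driftProfile (chi_eq one i) (hα i) h, ← hb i h, hθ i]
      exact mul_neg_of_pos_of_neg (div_pos (chi_pos one i) (hα i)) hneg
    · obtain ⟨η, hη, hη1, hη'⟩ := exists_integral_indicator_driftProfile_neg (chi_eq one i) (hα i) h
        (∑ j, P i j * θ j - θ i)
      refine eventually_lintegral_logHeight_le hP hc hv hK hα i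
        ((measurable_driftProfile _ _).indicator measurableSet_Ici)
        (integrableOn_indicator_driftProfile (chi_eq one i) (hα i) hη _) (fun u hu => ?_) hη'
      by_cases hηu : u ∈ Set.Ici η
      · rw [Set.indicator_of_mem hηu]
      · rw [Set.indicator_of_notMem hηu]
        have := Real.rpow_pos_of_pos hu (1 / chi one i)
        exact (driftProfile_le_neg_rpow (chi_eq one i) _ hu ((not_le.1 hηu).trans hη1)).trans
          (by linarith)
  obtain ⟨a, ha⟩ := exists_forall_of_eventually hev
  exact hX.isRecurrent hP hv (measurable_logHeight θ _) ha (tendsto_logHeight θ _)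

/-- The free value on branch k is lowered until the stationary mean equals -1, which is possible
because μ k > 0. -/
lemma IsWalk.isRecurrent_of_one_le (hP : P ∈ Matrix.rowStochastic ℝ S) (hirr : P.IsIrreducible)
    (hμ : IsInvariantLaw P μ) (hα : ∀ k, 0 < α k) (hc : ∀ k, 0 < c k)
    (hv : ∀ k, HeavyTailed (α k) (c k) (v k)) (hX : IsWalk P (increment one v) Pr X ξ)
    {k : S} (hk : 1 ≤ chi one k * α k) : IsRecurrent Pr X := by
  set b : S → ℝ := fun j => Real.pi * Real.cot (chi one j * Real.pi * α j) with hb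
  have hμk := hμ.pos hirr k
  set L := (∑ j, μ j * b j + 1) / μ k with hL
  refine hX.isRecurrent_of_sum_neg hP hirr hμ hα hc hv (fun j => b j - if j = k then L else 0)
    (fun j hj => ?_) ?_
  · have : j ≠ k := by
      rintro rfl
      exact absurd hj (not_lt.2 hk)
    rw [if_neg this, sub_zero]
  · have : ∑ j, μ j * (b j - if j = k then L else 0) = ∑ j, μ j * b j - μ k * L := by
      simp [mul_sub, Finset.sum_sub_distrib]
    rw [this, hL, mul_div_cancel₀ _ hμk.ne']
    linarith

omit [Nonempty S] [MeasurableSpace S] [MeasurableSingletonClass S] in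
lemma sum_mul_pi_mul_cot (μ : S → ℝ) (one : Finset S) (α : S → ℝ) :
    ∑ k, μ k * (Real.pi * Real.cot (chi one k * Real.pi * α k)) =
      Real.pi * ∑ k, μ k * Real.cot (chi one k * Real.pi * α k) := by
  rw [Finset.mul_sum]
  exact Finset.sum_congr rfl fun k _ => by ring

lemma IsWalk.isRecurrent_of_sum_eq_zero (hP : P ∈ Matrix.rowStochastic ℝ S)
    (hirr : P.IsIrreducible) (hμ : IsInvariantLaw P μ) (hα : ∀ k, 0 < α k) (hc : ∀ k, 0 < c k)
    (hv : ∀ k, HeavyTailed (α k) (c k) (v k)) (hX : IsWalk P (increment one v) Pr X ξ)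
    (hlt : ∀ k, chi one k * α k < 1) (hplus : ∀ k, HeavyTailedPlus (α k) (c k) (v k))
    (hzero : ∑ k, μ k * Real.cot (chi one k * Real.pi * α k) = 0) : IsRecurrent Pr X := by
  obtain ⟨θ, hθ⟩ := exists_poisson_solution hP hirr hμ
    fun k => Real.pi * Real.cot (chi one k * Real.pi * α k)
  simp only [sum_mul_pi_mul_cot, hzero, mul_zero] at hθ
  obtain ⟨a, ha⟩ := exists_forall_of_eventually fun i =>
    eventually_lintegral_sqrt_logHeight_le hP hc hv (abs_le_sum_abs θ) le_rfl hα i (hplus i)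
      (hlt i) (hθ i)
  exact hX.isRecurrent hP hv (measurable_logHeight θ _).sqrt ha
    fun i => Real.tendsto_sqrt_atTop.comp (tendsto_logHeight θ _ i)

lemma IsWalk.isTransient_of_sum_pos (hP : P ∈ Matrix.rowStochastic ℝ S)
    (hirr : P.IsIrreducible) (hμ : IsInvariantLaw P μ) (hα : ∀ k, 0 < α k) (hc : ∀ k, 0 < c k)
    (hv : ∀ k, HeavyTailed (α k) (c k) (v k)) (hX : IsWalk P (increment one v) Pr X ξ)
    (hlt : ∀ k, chi one k * α k < 1)
    (hpos : 0 < ∑ k, μ k * Real.cot (chi one k * Real.pi * α k)) : IsTransient Pr X := by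
  obtain ⟨θ, hθ⟩ := exists_poisson_solution hP hirr hμ
    fun k => Real.pi * Real.cot (chi one k * Real.pi * α k)
  simp only [sum_mul_pi_mul_cot] at hθ
  have hθpos := mul_pos Real.pi_pos hpos
  choose B₀ hB₀ using fun i => exists_eventually_lintegral_inv_logHeight_le hP hc hv
    (abs_le_sum_abs θ) hα i (hlt i) ((hθ i).symm ▸ hθpos)
  set Θ := ∑ k, |θ k| with hΘ
  -- One constant exceeding all the branch thresholds, and positive.
  set B := 1 + ∑ k, |B₀ k| with hB
  have hB0 : 0 < B := by
    have : 0 ≤ ∑ k, |B₀ k| := Finset.sum_nonneg fun _ _ => abs_nonneg _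
    linarith
  obtain ⟨a, ha⟩ := exists_forall_of_eventually fun i => hB₀ i B
    (((le_abs_self _).trans (abs_le_sum_abs B₀ i)).trans (by linarith)) hB0
  refine hX.isTransient hP hv (measurable_logHeight θ (B + Θ)).inv ha (fun b => ?_)
    fun i => (tendsto_logHeight θ _ i).inv_tendsto_atTop
  have hΘ0 : 0 ≤ Θ := Finset.sum_nonneg fun _ _ => abs_nonneg _
  have hb0 : 0 ≤ Real.posLog b := Real.posLog_nonneg
  -- The denominator is an upper bound for the height over all branches and all x ≤ b.
  refine ⟨(B + Θ + Real.posLog b + Θ)⁻¹, by positivity, fun x i hx hxb => ?_⟩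
  have h1 := abs_le.1 (abs_le_sum_abs θ i)
  have h2 : 0 ≤ Real.posLog x := Real.posLog_nonneg
  have h3 := Real.monotoneOn_posLog (show x ∈ Set.Ici 0 from hx) (show b ∈ Set.Ici 0 from
    hx.trans hxb) hxb
  refine inv_anti₀ ?_ ?_ <;> simp only [logHeight] <;> linarith

end Classification

end HalfLineWalk

theorem theorem1 {S : Type*} [Fintype S] [Nonempty S] [DecidableEq S]
    [MeasurableSpace S] [MeasurableSingletonClass S]
    (P : Matrix S S ℝ) (hP : P ∈ Matrix.rowStochastic ℝ S) (hirr : P.IsIrreducible)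
    (μ : S → ℝ) (hμ : IsInvariantLaw P μ)
    (one : Finset S) (α c : S → ℝ) (v : S → ℝ → ℝ)
    (hα : ∀ k, 0 < α k) (hc : ∀ k, 0 < c k)
    (hv : ∀ k, HeavyTailed (α k) (c k) (v k))
    {Ω : Type*} [MeasurableSpace Ω] (Pr : Measure Ω) [IsProbabilityMeasure Pr]
    (X : ℕ → Ω → ℝ) (ξ : ℕ → Ω → S) (hX : IsWalk P (increment one v) Pr X ξ) :
    (1 ≤ Finset.univ.sup' Finset.univ_nonempty (fun k => chi one k * α k) →
      IsRecurrent Pr X) ∧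
    (Finset.univ.sup' Finset.univ_nonempty (fun k => chi one k * α k) < 1 →
      (∑ k, μ k * Real.cot (chi one k * Real.pi * α k) < 0 → IsRecurrent Pr X) ∧
      (0 < ∑ k, μ k * Real.cot (chi one k * Real.pi * α k) → IsTransient Pr X) ∧
      ((∀ k, HeavyTailedPlus (α k) (c k) (v k)) →
        ∑ k, μ k * Real.cot (chi one k * Real.pi * α k) = 0 → IsRecurrent Pr X)) := by
  refine ⟨fun h => ?_, fun h => ?_⟩
  · obtain ⟨k, -, hk⟩ := (Finset.le_sup'_iff _).1 h
    exact hX.isRecurrent_of_one_le hP hirr hμ hα hc hv hk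
  · have hlt : ∀ k, chi one k * α k < 1 := fun k =>
      (Finset.sup'_lt_iff _).1 h k (Finset.mem_univ k)
    refine ⟨fun hneg => ?_, hX.isTransient_of_sum_pos hP hirr hμ hα hc hv hlt,
      hX.isRecurrent_of_sum_eq_zero hP hirr hμ hα hc hv hlt⟩
    refine hX.isRecurrent_of_sum_neg hP hirr hμ hα hc hv _ (fun k _ => rfl) ?_
    rw [sum_mul_pi_mul_cot]
    exact mul_neg_of_pos_of_neg Real.pi_pos hneg
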